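/- **Proposition.** Let $p$ be a prime and let $\mathcal G=(S,\mathcal F,\mathcal L)$ be a $p$-local compact group: $S$ is a discrete $p$-toral group (it has a normal subgroup of $p$-power index isomorphic to $(\mathbb Z/p^\infty)^r$ for some $r\ge 0$), $\mathcal F$ is a saturated fusion system over $S$, and $\mathcal L$ is a centric linking system associated to $\mathcal F$, that is, a transporter system with structure functors $\varepsilon$ (from the transporter category of $S$) and $\rho$ (to $\mathcal F$), whose objects are the $\mathcal F$-centric subgroups of $S$, and such that $\ker(\mathrm{Aut}_{\mathcal L}(P)\to\mathrm{Aut}_{\mathcal F}(P))=\varepsilon(Z(P))$ for each object $P$. A *Robinson setup* for $\mathcal G$ consists of the following. * A finite set $\mathcal P=\{P_0=S,P_1,\dots,P_k\}$ of $\mathcal F$-centric, fully $\mathcal F$-normalised subgroups of $S$ that contains at least one representative of each $\mathcal F$-conjugacy class of $\mathcal F$-centric $\mathcal F$-radical subgroups. Put $L_P=\mathrm{Aut}_{\mathcal L}(P)$ for $P\in\mathcal P$. * For each $P\in\mathcal P$ with $P\ne S$, a subgroup $N_P\le L_P$ that contains $\varepsilon_P(N_S(P))$, and a monomorphism $k_P\colon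 N_P\to L_S$ such that $k_P(\varepsilon_P(g))=\varepsilon_S(g)$ for all $g\in N_S(P)$. (One also puts $N_S=1$.) The *Robinson amalgam* $G$ is the colimit, in the category of groups, of the tree of groups which has a vertex $v_P$ with group $L_P$ for each $P\in\mathcal P$, and for each $P\in\mathcal P$ with $P\neq S$ an edge joining $v_S$ to $v_P$ with group $N_P$, mapped to $L_S$ by $k_P$ and to $L_P$ by the inclusion. Then, for every $p$-local compact group $\mathcal G$ and every Robinson setup for $\mathcal G$, the canonical homomorphism $S\xrightarrow{\varepsilon_S}L_S\to G$ is injective, and if $S$ is identified with its image: 1. $S$ is a Sylow $p$-subgroup of $G$, that is, every discrete $p$-toral subgroup of $G$ is conjugate in $G$ to a subgroup of $S$; 2. $\mathcal F_S(G)=\mathcal F$, that is, for all $P,Q\le S$, the morphisms $P\to Q$ in $\mathcal F$ are exactly the homomorphisms $x\mapsto gxg^{-1}$ with $g\in G$ and $gPg^{-1}\le Q$. -/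

import Mathlib

universe u

open CategoryTheory CategoryTheory.Limits

/-! ### Discrete `p`-toral groups and Sylow subgroups -/

/-- `ℤ/p^∞`, realised as the group of complex roots of unity of `p`-power order. -/
abbrev PruferGroup (p : ℕ) [Fact p.Prime] : Type := CommGroup.primaryComponent ℂˣ p

/-- `P` has a normal discrete `p`-torus of rank `r` and of index `p ^ n`; that is, `P` is discrete
`p`-toral of order `(r, p ^ n)`. The torus is unique, so `r` and `n` are determined by `P`. -/
def HasToralOrder (p : ℕ) [Fact p.Prime] (P : Type u) [Group P] (r n : ℕ) : Prop :=
  ∃ T : Subgroup P, T.Normal ∧ Nonempty (T ≃* (Fin r → PruferGroup p)) ∧ T.index = p ^ n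

def IsDiscretePToral (p : ℕ) [Fact p.Prime] (P : Type u) [Group P] : Prop :=
  ∃ r n : ℕ, HasToralOrder p P r n

/-- `|P| ≤ |Q|`: the orders `(rank, index of the maximal torus)` compared lexicographically. -/
def ToralOrderLE (p : ℕ) [Fact p.Prime] (P Q : Type u) [Group P] [Group Q] : Prop :=
  ∃ r n r' n' : ℕ, HasToralOrder p P r n ∧ HasToralOrder p Q r' n' ∧
    (r < r' ∨ (r = r' ∧ p ^ n ≤ p ^ n'))

/-- The transporter set `N_G(P, Q) = {g | g P g⁻¹ ≤ Q}`. -/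
def transporter {G : Type u} [Group G] (P Q : Subgroup G) : Set G :=
  {g | ∀ x ∈ P, g * x * g⁻¹ ∈ Q}

/-- `H` is a Sylow `p`-subgroup of `G`: it is discrete `p`-toral, and every discrete `p`-toral
subgroup of `G` is conjugate to a subgroup of `H`. -/
def IsSylowSubgroup (p : ℕ) [Fact p.Prime] {G : Type u} [Group G] (H : Subgroup G) : Prop :=
  IsDiscretePToral p H ∧
    ∀ Q : Subgroup G, IsDiscretePToral p Q → ∃ g : G, g ∈ transporter Q H

/-! ### Fusion systems -/

/-- A fusion system over `S`: a category whose objects are the subgroups of `S` and whose morphisms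
are injective homomorphisms, containing all conjugations by elements of `S`, in which every morphism
is an isomorphism of the category followed by an inclusion. -/
@[ext]
structure FusionSystem (S : Type u) [Group S] where
  hom (P Q : Subgroup S) : Set (P →* Q)
  id_mem (P : Subgroup S) : MonoidHom.id P ∈ hom P P
  comp_mem {P Q R : Subgroup S} {f : P →* Q} {g : Q →* R} :
    f ∈ hom P Q → g ∈ hom Q R → g.comp f ∈ hom P R
  conj_mem {P Q : Subgroup S} (s : S) (f : P →* Q) :
    (∀ x : P, (f x : S) = s * x * s⁻¹) → f ∈ hom P Q
  injective {P Q : Subgroup S} {f : P →* Q} : f ∈ hom P Q → Function.Injective f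
  factor {P Q : Subgroup S} {f : P →* Q} : f ∈ hom P Q →
    ∃ (R : Subgroup S) (hR : R ≤ Q) (e : P ≃* R), e.toMonoidHom ∈ hom P R ∧
      e.symm.toMonoidHom ∈ hom R P ∧ f = (Subgroup.inclusion hR).comp e.toMonoidHom

namespace FusionSystem

variable {S : Type u} [Group S]

/-- The fusion system `F_S(G)` of a group `G`, where `S` is identified with its image under an
injective homomorphism `i : S → G`: the morphisms `P → Q` are the maps `c_g` for `g ∈ N_G(P, Q)`. -/
def ofGroup {G : Type u} [Group G] (i : S →* G) (hi : Function.Injective i) : FusionSystem S where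
  hom P Q := {f | ∃ g : G, ∀ x : P, i (f x) = g * i x * g⁻¹}
  id_mem P := ⟨1, fun x => by simp⟩
  comp_mem := by
    rintro P Q R f g ⟨a, ha⟩ ⟨b, hb⟩
    exact ⟨b * a, fun x => by simp [ha, hb, mul_assoc]⟩
  conj_mem s f h := ⟨i s, fun x => by simp [h]⟩
  injective := by
    rintro P Q f ⟨g, hg⟩ x y hxy
    have h : g * i x * g⁻¹ = g * i y * g⁻¹ := by rw [← hg, ← hg, hxy]
    exact Subtype.ext (hi (by simpa using h))
  factor := by
    rintro P Q f ⟨g, hg⟩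
    have hf : Function.Injective (Q.subtype.comp f) := by
      intro x y hxy
      have h : g * i x * g⁻¹ = g * i y * g⁻¹ := by
        rw [← hg, ← hg]; exact congrArg i hxy
      exact Subtype.ext (hi (by simpa using h))
    refine ⟨(Q.subtype.comp f).range, ?_, MonoidHom.ofInjective hf, ⟨g, fun x => hg x⟩,
      ⟨g⁻¹, fun y => ?_⟩, ?_⟩
    · rintro _ ⟨x, rfl⟩
      exact (f x).2
    · obtain ⟨x, rfl⟩ := (MonoidHom.ofInjective hf).surjective y
      have h : i ((MonoidHom.ofInjective hf x : (Q.subtype.comp f).range) : S) =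
        g * i x * g⁻¹ := hg x
      simp only [MulEquiv.coe_toMonoidHom, MulEquiv.symm_apply_apply, h]
      group
    · ext x
      rfl

variable (F : FusionSystem S)

/-- `P` and `Q` are isomorphic in the category `F`. -/
def Conj (P Q : Subgroup S) : Prop :=
  ∃ e : P ≃* Q, e.toMonoidHom ∈ F.hom P Q ∧ e.symm.toMonoidHom ∈ F.hom Q P

def IsFullyCentralised (p : ℕ) [Fact p.Prime] (P : Subgroup S) : Prop :=
  ∀ Q : Subgroup S, F.Conj P Q →
    ToralOrderLE p (Subgroup.centralizer (Q : Set S)) (Subgroup.centralizer (P : Set S))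

def IsFullyNormalised (p : ℕ) [Fact p.Prime] (P : Subgroup S) : Prop :=
  ∀ Q : Subgroup S, F.Conj P Q →
    ToralOrderLE p (Subgroup.normalizer (Q : Set S)) (Subgroup.normalizer (P : Set S))

/-- `Aut_F(P)`. -/
def autF (P : Subgroup S) : Subgroup (MulAut P) where
  carrier := {a | a.toMonoidHom ∈ F.hom P P ∧ a.symm.toMonoidHom ∈ F.hom P P}
  one_mem' := ⟨F.id_mem P, F.id_mem P⟩
  mul_mem' ha hb := ⟨F.comp_mem hb.1 ha.1, F.comp_mem ha.2 hb.2⟩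
  inv_mem' ha := ⟨ha.2, ha.1⟩

/-- `Inn(P)`, as a subgroup of `Aut_F(P)`. -/
def innF (P : Subgroup S) : Subgroup (F.autF P) :=
  (MulAut.conj (G := P)).range.subgroupOf (F.autF P)

instance innF_normal (P : Subgroup S) : (F.innF P).Normal where
  conj_mem := by
    rintro a ⟨x, hx⟩ b
    refine ⟨(b : MulAut P) x, ?_⟩
    ext y
    have hx' : (a : MulAut P) = MulAut.conj x := hx.symm
    simp [hx', MulAut.conj_apply]

/-- `Out_F(P) = Aut_F(P) / Inn(P)`. -/
abbrev outF (P : Subgroup S) : Type u := F.autF P ⧸ F.innF P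

/-- `Out_S(P)`, the image of `Aut_S(P)` in `Out_F(P)`. -/
def outS (P : Subgroup S) : Subgroup (F.outF P) :=
  (P.normalizerMonoidHom.range.subgroupOf (F.autF P)).map (QuotientGroup.mk' (F.innF P))

/-- The image in `S` of a homomorphism `P → S`. -/
def imageOf {P : Subgroup S} (f : P →* (⊤ : Subgroup S)) : Subgroup S :=
  f.range.map (⊤ : Subgroup S).subtype

/-- `N_f`: the `g ∈ N_S(P)` such that `f ∘ c_g ∘ f⁻¹` is conjugation on `f(P)` by an element of
`N_S(f(P))`. -/
def extender {P : Subgroup S} (f : P →* (⊤ : Subgroup S)) : Subgroup S where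
  carrier := {g | g ∈ Subgroup.normalizer (P : Set S) ∧
    ∃ h ∈ Subgroup.normalizer (imageOf f : Set S),
      ∀ x y : P, (y : S) = g * x * g⁻¹ → (f y : S) = h * f x * h⁻¹}
  one_mem' := ⟨one_mem _, 1, one_mem _, fun x y hxy => by
    have : y = x := Subtype.ext (by simpa using hxy)
    simp [this]⟩
  mul_mem' := by
    rintro a b ⟨ha, h, hh, H⟩ ⟨hb, k, hk, K⟩
    refine ⟨mul_mem ha hb, h * k, mul_mem hh hk, fun x y hxy => ?_⟩
    have hz : b * x * b⁻¹ ∈ P := (Subgroup.mem_normalizer_iff.1 hb x).1 x.2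
    rw [H ⟨_, hz⟩ y (by simp [hxy, mul_assoc]), K x ⟨_, hz⟩ rfl]
    simp [mul_assoc]
  inv_mem' := by
    rintro a ⟨ha, h, hh, H⟩
    refine ⟨inv_mem ha, h⁻¹, inv_mem hh, fun x y hxy => ?_⟩
    rw [H y x (by simp [hxy, mul_assoc])]
    simp [mul_assoc]

/-- Every subgroup of `S` that is `F`-conjugate to `P` is centric in `S`. -/
def IsCentric (P : Subgroup S) : Prop :=
  ∀ Q : Subgroup S, F.Conj P Q →
    Subgroup.centralizer (Q : Set S) = (Subgroup.center Q).map Q.subtype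

/-- `Out_F(P)` has no nontrivial normal `p`-subgroup. -/
def IsRadical (p : ℕ) (P : Subgroup S) : Prop :=
  ∀ N : Subgroup (F.outF P), N.Normal → IsPGroup p N → N = ⊥

structure IsSaturated (p : ℕ) [Fact p.Prime] : Prop where
  sylow (P : Subgroup S) : F.IsFullyNormalised p P →
    F.IsFullyCentralised p P ∧ Finite (F.outF P) ∧ IsSylowSubgroup p (F.outS P)
  extend (P : Subgroup S) (f : P →* (⊤ : Subgroup S)) : f ∈ F.hom P ⊤ →
    F.IsFullyCentralised p (imageOf f) →
    ∃ f' ∈ F.hom (extender f) ⊤,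
      ∀ (x : P) (y : extender f), (y : S) = x → f' y = f x
  union (P : ℕ → Subgroup S) (f : (⨆ n, P n : Subgroup S) →* (⊤ : Subgroup S)) : Monotone P →
    (∀ n, f.comp (Subgroup.inclusion (le_iSup P n)) ∈ F.hom (P n) ⊤) → f ∈ F.hom (⨆ n, P n) ⊤

/-- A finite set of fully normalised subgroups, containing `S` and at least one representative of
each `F`-conjugacy class of subgroups that are both `F`-centric and `F`-radical. -/
structure IsFusionControlling (p : ℕ) [Fact p.Prime] (Φ : Set (Subgroup S)) : Prop where
  finite : Φ.Finite
  top_mem : ⊤ ∈ Φ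
  fullyNormalised : ∀ P ∈ Φ, F.IsFullyNormalised p P
  exists_conj : ∀ Q : Subgroup S, F.IsCentric Q → F.IsRadical p Q → ∃ P ∈ Φ, F.Conj Q P

end FusionSystem

/-! ### Transporter systems and centric linking systems -/

/-- The objects of a category whose set of objects is a set `𝓗` of subgroups. -/
structure SubgroupObj {S : Type u} [Group S] (𝓗 : Set (Subgroup S)) where
  grp : Subgroup S
  mem : grp ∈ 𝓗

/-- A category whose objects are subgroups of `S`, with functors `ε` from the transporter category
of `S` and `ρ` to `F`, which are the identity, respectively the inclusion, on objects.
Composition in `F` and in the transporter category is written from right to left, composition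
`≫` in the category from left to right. -/
structure TransporterData {S : Type u} [Group S] (F : FusionSystem S) where
  obj : Set (Subgroup S)
  cat : Category.{u} (SubgroupObj obj)
  ε (P Q : SubgroupObj obj) : transporter P.grp Q.grp → (P ⟶ Q)
  ε_one (P : SubgroupObj obj) (h : 1 ∈ transporter P.grp P.grp) : ε P P ⟨1, h⟩ = 𝟙 P
  ε_mul (P Q R : SubgroupObj obj) (g : transporter P.grp Q.grp) (h : transporter Q.grp R.grp)
    (hg : (h * g : S) ∈ transporter P.grp R.grp) :
    ε P R ⟨h * g, hg⟩ = ε P Q g ≫ ε Q R h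
  ρ {P Q : SubgroupObj obj} : (P ⟶ Q) → (P.grp →* Q.grp)
  ρ_mem {P Q : SubgroupObj obj} (φ : P ⟶ Q) : ρ φ ∈ F.hom P.grp Q.grp
  ρ_id (P : SubgroupObj obj) : ρ (𝟙 P) = MonoidHom.id P.grp
  ρ_comp {P Q R : SubgroupObj obj} (φ : P ⟶ Q) (ψ : Q ⟶ R) : ρ (φ ≫ ψ) = (ρ ψ).comp (ρ φ)

attribute [instance] TransporterData.cat

namespace TransporterData

variable {S : Type u} [Group S] {F : FusionSystem S} (T : TransporterData F)

theorem mem_transporter_of_mem_normalizer {P : Subgroup S} {g : S}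
    (hg : g ∈ Subgroup.normalizer (P : Set S)) : g ∈ transporter P P :=
  fun x hx => (Subgroup.mem_normalizer_iff.1 hg x).1 hx

theorem one_mem_transporter {P Q : Subgroup S} (h : P ≤ Q) : (1 : S) ∈ transporter P Q :=
  fun x hx => by simpa using h hx

/-- `ε` on automorphisms: the homomorphism `N_S(P) → Aut_T(P)`. (In Mathlib's group `Aut P`, the
product `a * b` is "`b` followed by `a`".) -/
def εAut (P : SubgroupObj T.obj) : Subgroup.normalizer (P.grp : Set S) →* Aut P where
  toFun g :=
    { hom := T.ε P P ⟨g, mem_transporter_of_mem_normalizer g.2⟩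
      inv := T.ε P P ⟨(g : S)⁻¹, mem_transporter_of_mem_normalizer (inv_mem g.2)⟩
      hom_inv_id := by
        rw [← T.ε_mul _ _ _ _ _ (by simpa using one_mem_transporter le_rfl)]
        simp only [inv_mul_cancel, T.ε_one]
      inv_hom_id := by
        rw [← T.ε_mul _ _ _ _ _ (by simpa using one_mem_transporter le_rfl)]
        simp only [mul_inv_cancel, T.ε_one] }
  map_one' := by
    ext
    exact T.ε_one P _
  map_mul' g h := by
    ext
    exact T.ε_mul P P P ⟨h, _⟩ ⟨g, _⟩ _

/-- `ι_{P,Q} = ε_{P,Q}(1)` for `P ≤ Q`. -/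
def ι (P Q : SubgroupObj T.obj) (h : P.grp ≤ Q.grp) : P ⟶ Q :=
  T.ε P Q ⟨1, one_mem_transporter h⟩

/-- `E(P)`, the kernel of `Aut_T(P) → Aut_F(P)`. -/
def E (P : SubgroupObj T.obj) : Set (Aut P) :=
  {a | T.ρ a.hom = MonoidHom.id P.grp}

/-- `T`, with its two functors, is a transporter system associated to `F`. -/
structure IsTransporterSystem (p : ℕ) [Fact p.Prime] : Prop where
  conj_closed {P Q : Subgroup S} : P ∈ T.obj → F.Conj P Q → Q ∈ T.obj
  over_closed {P Q : Subgroup S} : P ∈ T.obj → P ≤ Q → Q ∈ T.obj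
  free_right {P Q : SubgroupObj T.obj} (a : Aut P) (φ : P ⟶ Q) :
    a ∈ T.E P → a.hom ≫ φ = φ → a = 1
  free_left {P Q : SubgroupObj T.obj} (φ : P ⟶ Q) (b : Aut Q) :
    b ∈ T.E Q → φ ≫ b.hom = φ → b = 1
  ρ_surjective {P Q : SubgroupObj T.obj} {f : P.grp →* Q.grp} : f ∈ F.hom P.grp Q.grp →
    ∃ φ : P ⟶ Q, T.ρ φ = f
  ρ_eq_iff {P Q : SubgroupObj T.obj} (φ ψ : P ⟶ Q) :
    T.ρ φ = T.ρ ψ ↔ ∃ a ∈ T.E P, ψ = a.hom ≫ φ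
  ε_injective (P Q : SubgroupObj T.obj) : Function.Injective (T.ε P Q)
  ρ_ε {P Q : SubgroupObj T.obj} (g : transporter P.grp Q.grp) (x : P.grp) :
    (T.ρ (T.ε P Q g) x : S) = g * x * (g : S)⁻¹
  comm {P Q : SubgroupObj T.obj} (φ : P ⟶ Q) (x : P.grp) :
    (T.εAut P ⟨x, Subgroup.le_normalizer x.2⟩).hom ≫ φ =
      φ ≫ (T.εAut Q ⟨T.ρ φ x, Subgroup.le_normalizer (T.ρ φ x).2⟩).hom
  top_mem : ⊤ ∈ T.obj
  sylow : IsSylowSubgroup p (T.εAut ⟨⊤, top_mem⟩).range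
  extend {P P' R R' : SubgroupObj T.obj} (φ : P ≅ P')
    (hP : P.grp ≤ R.grp) (hR : R.grp ≤ Subgroup.normalizer (P.grp : Set S))
    (hP' : P'.grp ≤ R'.grp) (hR' : R'.grp ≤ Subgroup.normalizer (P'.grp : Set S)) :
    (∀ r : R.grp, ∃ r' : R'.grp,
      φ.inv ≫ (T.εAut P ⟨r, hR r.2⟩).hom ≫ φ.hom = (T.εAut P' ⟨r', hR' r'.2⟩).hom) →
    ∃ ψ : R ⟶ R', T.ι P R hP ≫ ψ = φ.hom ≫ T.ι P' R' hP'
  union (P : ℕ → SubgroupObj T.obj) (hP : Monotone fun n => (P n).grp)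
    (φ : ∀ n, P n ⟶ ⟨⊤, top_mem⟩) (Q : SubgroupObj T.obj) (hQ : Q.grp = ⨆ n, (P n).grp) :
    (∀ n, φ n = T.ι (P n) (P (n + 1)) (hP n.le_succ) ≫ φ (n + 1)) →
    ∃ ψ : Q ⟶ ⟨⊤, top_mem⟩,
      ∀ n, φ n = T.ι (P n) Q (hQ ▸ le_iSup (fun m => (P m).grp) n) ≫ ψ

/-- A centric linking system: a transporter system whose objects are the `F`-centric subgroups and
in which `E(P) = ε(Z(P))` for each object `P`. -/
structure IsCentricLinkingSystem (p : ℕ) [Fact p.Prime] : Prop extends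
    T.IsTransporterSystem p where
  obj_eq : T.obj = {P | F.IsCentric P}
  E_eq (P : SubgroupObj T.obj) : T.E P =
    {a | ∃ z : Subgroup.center P.grp, a = T.εAut P ⟨z, Subgroup.le_normalizer z.1.2⟩}

end TransporterData

structure PLocalCompactGroup (p : ℕ) [Fact p.Prime] (S : Type u) [Group S] where
  toral : IsDiscretePToral p S
  F : FusionSystem S
  saturated : F.IsSaturated p
  L : TransporterData F
  linking : L.IsCentricLinkingSystem p

/-! ### Colimits of graphs of groups -/

section Colimit

variable {J : MultispanShape.{u, u}} (I : MultispanIndex J GrpCat.{u})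

/-- The inclusion of a vertex group in the free product of the vertex groups. -/
def vertexIncl (v : J.R) : I.right v →* Monoid.CoprodI fun v => (I.right v : Type u) :=
  Monoid.CoprodI.of (M := fun v => (I.right v : Type u))

/-- The relations imposed on the free product of the vertex groups. -/
def graphRelations : Set (Monoid.CoprodI fun v => (I.right v : Type u)) :=
  {x | ∃ (e : J.L) (n : I.left e),
    x = vertexIncl I (J.fst e) ((I.fst e).hom n) * (vertexIncl I (J.snd e) ((I.snd e).hom n))⁻¹}

/-- A graph of groups has a colimit: the quotient of the free product of the vertex groups which
identifies the two images of each edge group. -/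
instance hasMulticoequalizer_grpCat : HasMulticoequalizer I := by
  let R := Subgroup.normalClosure (graphRelations I)
  let q := QuotientGroup.mk' R
  let c : Multicofork I := Multicofork.ofπ I (GrpCat.of (_ ⧸ R))
    (fun v => GrpCat.ofHom (q.comp (vertexIncl I v))) (fun e => by
      ext n
      change q _ = q _
      refine (QuotientGroup.eq_iff_div_mem (N := R)).2 ?_
      rw [div_eq_mul_inv]
      exact Subgroup.subset_normalClosure ⟨e, n, rfl⟩)
  let d (K : Multicofork I) : (Monoid.CoprodI fun v => (I.right v : Type u)) →* K.pt :=
    Monoid.CoprodI.lift fun v => (K.π v).hom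
  have hd (K : Multicofork I) : ∀ x ∈ R, d K x = 1 := by
    have h : R ≤ (d K).ker := Subgroup.normalClosure_le_normal (by
      rintro _ ⟨e, n, rfl⟩
      have := congrArg (fun f => f.hom n) (K.condition e)
      change d K _ = 1
      rw [map_mul, map_inv, mul_inv_eq_one]
      simp only [d, vertexIncl, Monoid.CoprodI.lift_of]
      exact this)
    exact fun x hx => h hx
  refine ⟨⟨c, Multicofork.IsColimit.mk _ (fun K => GrpCat.ofHom (QuotientGroup.lift R (d K) (hd K)))
    ?_ ?_⟩⟩
  · intro K v
    ext x
    change QuotientGroup.lift R (d K) (hd K) (q (vertexIncl I v x)) = _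
    exact Monoid.CoprodI.lift_of (M := fun v => (I.right v : Type u)) (fun v => (K.π v).hom) x
  · intro K m hm
    ext x
    obtain ⟨y, rfl⟩ := QuotientGroup.mk'_surjective R x
    have : (m.hom.comp q) = d K := by
      refine Monoid.CoprodI.ext_hom _ _ fun v => ?_
      ext x
      have := congrArg (fun f => f.hom x) (hm v)
      simp only [d, MonoidHom.comp_apply, Monoid.CoprodI.lift_of]
      exact this
    exact DFunLike.congr_fun this y

end Colimit

/-! ### Robinson setups and the Robinson amalgam -/

/-- A Robinson setup. Here `L_P = Aut_L(P)`, so that the members of the family have to be objects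
of the linking system; `N_P` is a subgroup of `L_P`, with a second embedding `k_P : N_P → L_S`, and
both contain `N_S(P)`, embedded by `ε_P` and by `ε_S`. -/
structure RobinsonSetup {p : ℕ} [Fact p.Prime] {S : Type u} [Group S]
    (𝒢 : PLocalCompactGroup p S) where
  family : Set (Subgroup S)
  controlling : 𝒢.F.IsFusionControlling p family
  family_subset : family ⊆ 𝒢.L.obj
  N (P : family) : Subgroup (Aut (⟨P, family_subset P.2⟩ : SubgroupObj 𝒢.L.obj))
  N_top : N ⟨⊤, controlling.top_mem⟩ = ⊥
  k (P : family) : P.1 ≠ ⊤ →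
    (N P →* Aut (⟨⊤, family_subset controlling.top_mem⟩ : SubgroupObj 𝒢.L.obj))
  k_injective (P : family) (hP : P.1 ≠ ⊤) : Function.Injective (k P hP)
  normalizer_le (P : family) (g : Subgroup.normalizer (P.1 : Set S)) : P.1 ≠ ⊤ →
    𝒢.L.εAut ⟨P, family_subset P.2⟩ g ∈ N P
  k_normalizer (P : family) (hP : P.1 ≠ ⊤) (g : Subgroup.normalizer (P.1 : Set S)) :
    k P hP ⟨𝒢.L.εAut ⟨P, family_subset P.2⟩ g, normalizer_le P g hP⟩ =
      𝒢.L.εAut ⟨⊤, family_subset controlling.top_mem⟩ ⟨g, Subgroup.le_normalizer (Subgroup.mem_top _)⟩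

namespace RobinsonSetup

variable {p : ℕ} [Fact p.Prime] {S : Type u} [Group S] {𝒢 : PLocalCompactGroup p S}
  (R : RobinsonSetup 𝒢)

/-- A member of the family, as an object of the linking system. -/
def vertexObj (P : R.family) : SubgroupObj 𝒢.L.obj := ⟨P, R.family_subset P.2⟩

/-- The vertex `S`. -/
def base : R.family := ⟨⊤, R.controlling.top_mem⟩

/-- The tree with a vertex `v_P` for each `P` in the family, and an edge `e_P` from `v_S` to `v_P`
for each `P ≠ S`. -/
def treeShape : MultispanShape.{u, u} where
  L := {P : R.family // P.1 ≠ ⊤}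
  R := R.family
  fst _ := R.base
  snd P := P.1

/-- The groups and monomorphisms of the Robinson tree of groups. -/
def treeOfGroups : MultispanIndex R.treeShape GrpCat.{u} where
  left P := GrpCat.of (R.N P.1)
  right P := GrpCat.of (Aut (R.vertexObj P))
  fst P := GrpCat.ofHom (R.k P.1 P.2)
  snd P := GrpCat.ofHom (R.N P.1).subtype

/-- The Robinson amalgam: the colimit, in the category of groups, of the functor given by the
Robinson tree of groups on the category associated with the tree. -/
noncomputable def amalgam : GrpCat.{u} := colimit R.treeOfGroups.multispan

/-- The canonical homomorphism `S → Aut_L(S) = L_S → G`. -/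
noncomputable def fromSylow : S →* R.amalgam :=
  (colimit.ι R.treeOfGroups.multispan (WalkingMultispan.right R.base)).hom.comp
    ((𝒢.L.εAut (R.vertexObj R.base)).comp
      { toFun := fun s => ⟨s, Subgroup.le_normalizer (Subgroup.mem_top s)⟩
        map_one' := rfl
        map_mul' := fun _ _ => rfl })

end RobinsonSetup

/-! The Robinson tree of groups is a star with centre `v_S`, so the amalgam `G` acts on a Bass–Serre
tree whose vertices are the cosets of the vertex groups (`IsStarAmalgam.starTree_isTree`). Vertex
groups embed in `G` (`IsStarAmalgam.injective`), hence so does `S`. The rest uses two facts about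
the tree, recorded in `IsTreeLike`: the vertices fixed by a subset span a connected subgraph, and a
subgroup with a finite orbit fixes a vertex.

Fusion of `G` lies in `F`: if `g` conjugates `Q ≤ S` into `S`, then `Q` fixes two base vertices and
so the path between them. On each edge of the path, `Q` can be conjugated into `N_S(P)`, which is
Sylow in the edge group. Passing through a vertex then amounts to conjugation by an element of a
vertex group, and this is a morphism of `F` by the extension axiom of the linking system. The
composite is conjugation by `g` (`IsFusionStar.mor_of_conj`).

`F` lies in the fusion of `G`: automorphisms in `F` of members of the family lift to the linking
system and so come from vertex groups, and by Alperin's fusion theorem they generate `F`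
(`FusionSystem.Mor.induced`). Alperin's argument is a descending induction on the order of
subgroups, which needs a finiteness statement because `S` is infinite. Every morphism on `P` extends
over the product of `P` with a divisible subgroup of the torus, its `torusHull`
(`FusionSystem.exists_extension_torusHull`), and the subgroups that contain their hull have only
finitely many orders. The induction runs over these.

Sylow property: a finite `p`-subgroup fixes a vertex, and the vertex groups have `S` or `N_S(P)` as
Sylow subgroups. For an infinite discrete torus `A`, the conjugations of the finite subgroups `A[p ^
n]` into `S` are glued along an ultrafilter to a homomorphism to `T` that is conjugation on each
finite subgroup (`IsFusionStar.exists_locally_conj`). Since `T` has only finitely many automorphisms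
in `F`, a large finite part of the torus controls all of it, and a walk in the tree shows that one
conjugating element suffices (`IsFusionStar.exists_conj_of_locally_conj`). The torus of a discrete
`p`-toral `Q` therefore fixes a vertex; as it has finite index in `Q`, the orbit of that vertex
under `Q` is finite, and `Q` fixes a vertex too. -/

set_option linter.unusedSectionVars false

/-! ### Discrete tori -/

/-- Every element of `D` has a `p`-th root in `D`. -/
def IsPDivisible (p : ℕ) {G : Type*} [Group G] (D : Subgroup G) : Prop :=
  ∀ x ∈ D, ∃ y ∈ D, y ^ p = x

/-- `D` is abelian, `p`-torsion and `p`-divisible, with finitely many elements of order `p`. -/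
structure IsDiscreteTorus (p : ℕ) {G : Type*} [Group G] (D : Subgroup G) : Prop where
  comm : ∀ x ∈ D, ∀ y ∈ D, x * y = y * x
  tors : ∀ x ∈ D, ∃ k : ℕ, x ^ p ^ k = 1
  fin : {x | x ∈ D ∧ x ^ p = 1}.Finite
  div : IsPDivisible p D

section Torus

variable {p : ℕ} {G : Type*} [Group G]

theorem IsPDivisible.exists_pow {D : Subgroup G} (hD : IsPDivisible p D) (k : ℕ) :
    ∀ x ∈ D, ∃ y ∈ D, y ^ p ^ k = x := by
  induction k with
  | zero => exact fun x hx => ⟨x, hx, by simp⟩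
  | succ k ih =>
    intro x hx
    obtain ⟨y, hy, rfl⟩ := hD x hx
    obtain ⟨z, hz, rfl⟩ := ih y hy
    exact ⟨z, hz, by rw [pow_succ, pow_mul]⟩

theorem mul_pow_of_comm {D : Subgroup G} (hD : ∀ x ∈ D, ∀ y ∈ D, x * y = y * x) {x y : G}
    (hx : x ∈ D) (hy : y ∈ D) (n : ℕ) : (x * y) ^ n = x ^ n * y ^ n :=
  Commute.mul_pow (hD x hx y hy) n

theorem inv_mul_pow_of_comm {D : Subgroup G} (hD : ∀ x ∈ D, ∀ y ∈ D, x * y = y * x) {x y : G}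
    (hx : x ∈ D) (hy : y ∈ D) (n : ℕ) : (x⁻¹ * y) ^ n = (x ^ n)⁻¹ * y ^ n := by
  rw [mul_pow_of_comm hD (inv_mem hx) hy, inv_pow]

/-- The subgroup of `n`-th powers of an abelian subgroup. -/
def powSubgroup (D : Subgroup G) (hD : ∀ x ∈ D, ∀ y ∈ D, x * y = y * x) (n : ℕ) : Subgroup G where
  carrier := {x | ∃ y ∈ D, y ^ n = x}
  one_mem' := ⟨1, one_mem D, one_pow n⟩
  mul_mem' := by
    rintro _ _ ⟨x, hx, rfl⟩ ⟨y, hy, rfl⟩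
    exact ⟨x * y, mul_mem hx hy, mul_pow_of_comm hD hx hy n⟩
  inv_mem' := by
    rintro _ ⟨x, hx, rfl⟩
    exact ⟨x⁻¹, inv_mem hx, inv_pow x n⟩

/-- The elements of order dividing `n` of an abelian subgroup. -/
def torsionSubgroup (D : Subgroup G) (hD : ∀ x ∈ D, ∀ y ∈ D, x * y = y * x) (n : ℕ) :
    Subgroup G where
  carrier := {x | x ∈ D ∧ x ^ n = 1}
  one_mem' := ⟨one_mem D, one_pow n⟩
  mul_mem' := by
    rintro x y ⟨hx, hx'⟩ ⟨hy, hy'⟩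
    exact ⟨mul_mem hx hy, by rw [mul_pow_of_comm hD hx hy, hx', hy', one_mul]⟩
  inv_mem' := by
    rintro x ⟨hx, hx'⟩
    exact ⟨inv_mem hx, by rw [inv_pow, hx', inv_one]⟩

/-- The fibres of the `p`-th power map on `D` are cosets of the socle, so finiteness climbs from one
exponent to the next. -/
theorem finite_torsion {D : Subgroup G} (hc : ∀ x ∈ D, ∀ y ∈ D, x * y = y * x)
    (hf : {x | x ∈ D ∧ x ^ p = 1}.Finite) (k : ℕ) : {x | x ∈ D ∧ x ^ p ^ k = 1}.Finite := by
  induction k with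
  | zero => exact (Set.finite_singleton 1).subset fun x hx => by simpa using hx.2
  | succ k ih =>
    refine Set.Finite.of_finite_fibers (fun x => x ^ p) (ih.subset ?_) ?_
    · rintro _ ⟨x, ⟨hx, hx'⟩, rfl⟩
      exact ⟨pow_mem hx p, by rw [← pow_mul, ← pow_succ', hx']⟩
    · rintro _ ⟨x, ⟨hx, -⟩, rfl⟩
      refine (hf.image (fun y => x * y)).subset ?_
      rintro z ⟨⟨hz, -⟩, hzx⟩
      refine ⟨x⁻¹ * z, ⟨mul_mem (inv_mem hx) hz, ?_⟩, by simp⟩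
      rw [inv_mul_pow_of_comm hc hx hz]
      simpa [inv_mul_eq_one] using Eq.symm hzx

/-- An abelian `p`-torsion group with finite socle has a largest `p`-divisible subgroup, and
some power maps the group into it. -/
theorem exists_divisible_part {B : Subgroup G} (hc : ∀ x ∈ B, ∀ y ∈ B, x * y = y * x)
    (ht : ∀ x ∈ B, ∃ k : ℕ, x ^ p ^ k = 1) (hf : {x | x ∈ B ∧ x ^ p = 1}.Finite) :
    ∃ D ≤ B, IsPDivisible p D ∧ ∃ K : ℕ, ∀ x ∈ B, x ^ p ^ K ∈ D := by
  -- `K` lies beyond all finite heights of elements of the finite socle.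
  obtain ⟨K, hK⟩ : ∃ K : ℕ, ∀ z ∈ {x | x ∈ B ∧ x ^ p = 1},
      (∃ y ∈ B, y ^ p ^ K = z) → ∀ j : ℕ, ∃ y ∈ B, y ^ p ^ j = z := by
    have : ∀ᶠ K : ℕ in Filter.atTop, ∀ z ∈ {x | x ∈ B ∧ x ^ p = 1},
        (∃ y ∈ B, y ^ p ^ K = z) → ∀ j : ℕ, ∃ y ∈ B, y ^ p ^ j = z := by
      rw [Filter.eventually_all_finite hf]
      intro z _
      by_cases h : ∀ j : ℕ, ∃ y ∈ B, y ^ p ^ j = z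
      · exact Filter.Eventually.of_forall fun _ _ => h
      · push Not at h
        obtain ⟨j, hj⟩ := h
        filter_upwards [Filter.eventually_ge_atTop j] with K hK
        rintro ⟨y, hy, hyz⟩
        refine (hj (y ^ p ^ (K - j)) (pow_mem hy _) ?_).elim
        rw [← pow_mul, ← pow_add, Nat.sub_add_cancel hK, hyz]
    exact this.exists
  refine ⟨powSubgroup B hc (p ^ K), ?_, ?_, K, fun x hx => ⟨x, hx, rfl⟩⟩
  · rintro _ ⟨y, hy, rfl⟩
    exact pow_mem hy _
  have main : ∀ (e : ℕ) (b : G), b ∈ B → (b ^ p ^ K) ^ p ^ e = 1 →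
      ∃ y ∈ B, (y ^ p ^ K) ^ p = b ^ p ^ K := by
    intro e
    induction e with
    | zero => exact fun b hb h => ⟨1, one_mem B, by simpa using h.symm⟩
    | succ e ih =>
      intro b hb h
      -- With exponent `1 + K + e`, dividing `b` by `c ^ p` kills the `p ^ e`-th power of `b ^ p ^
      -- K`. The factor split off contributes the root `c ^ p ^ K`.
      obtain ⟨c, hcB, hc'⟩ := hK ((b ^ p ^ K) ^ p ^ e)
        ⟨pow_mem (pow_mem hb _) _, by rw [← pow_mul, ← pow_succ, h]⟩
        ⟨b ^ p ^ e, pow_mem hb _, by rw [← pow_mul, ← pow_mul, mul_comm]⟩ (1 + K + e)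
      obtain ⟨y, hy, hy'⟩ := ih ((c ^ p)⁻¹ * b) (mul_mem (inv_mem (pow_mem hcB _)) hb) (by
        rw [inv_mul_pow_of_comm hc (pow_mem hcB p) hb,
          inv_mul_pow_of_comm hc (pow_mem (pow_mem hcB p) _) (pow_mem hb _), ← hc', inv_mul_eq_one]
        simp only [← pow_mul]
        congr 1
        ring)
      refine ⟨c * y, mul_mem hcB hy, ?_⟩
      rw [mul_pow_of_comm hc hcB hy, mul_pow_of_comm hc (pow_mem hcB _) (pow_mem hy _), hy',
        inv_mul_pow_of_comm hc (pow_mem hcB p) hb]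
      rw [← pow_mul, ← pow_mul, mul_comm p, mul_inv_cancel_left]
  rintro _ ⟨b, hb, rfl⟩
  obtain ⟨k, hk⟩ := ht _ (pow_mem hb (p ^ K))
  obtain ⟨y, hy, h⟩ := main k b hb hk
  exact ⟨y ^ p ^ K, ⟨y, hy, rfl⟩, h⟩

/-- Two nested discrete tori with the same socle are equal. -/
theorem le_of_socle_le {D D' : Subgroup G} (hc : ∀ x ∈ D', ∀ y ∈ D', x * y = y * x)
    (ht : ∀ x ∈ D', ∃ k : ℕ, x ^ p ^ k = 1) (hDD : D ≤ D') (hD : IsPDivisible p D)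
    (hs : ∀ x ∈ D', x ^ p = 1 → x ∈ D) : D' ≤ D := by
  have : ∀ (k : ℕ) (x : G), x ∈ D' → x ^ p ^ k = 1 → x ∈ D := by
    intro k
    induction k with
    | zero => exact fun x _ h => by simp_all
    | succ k ih =>
      intro x hx h
      -- A root in `D` of `x ^ p` differs from `x` by a socle element.
      obtain ⟨y, hy, hyx⟩ := hD (x ^ p) (ih _ (pow_mem hx p) (by rw [← pow_mul, ← pow_succ', h]))
      have := hs (y⁻¹ * x) (mul_mem (inv_mem (hDD hy)) hx) (by
        rw [inv_mul_pow_of_comm hc (hDD hy) hx, hyx, inv_mul_cancel])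
      simpa using mul_mem hy this
  intro x hx
  obtain ⟨k, hk⟩ := ht x hx
  exact this k x hx hk

/-! ### Prüfer groups and the classification of discrete tori. -/

variable [hp : Fact p.Prime]

instance : Module (ZMod p) (Additive (rootsOfUnity p ℂ)) :=
  AddCommGroup.zmodModule (n := p) fun x => by
    have := x.toMul.2
    rw [mem_rootsOfUnity] at this
    exact Subtype.ext this

theorem finrank_rootsOfUnity : Module.finrank (ZMod p) (Additive (rootsOfUnity p ℂ)) = 1 := by
  have h := Module.natCard_eq_pow_finrank (K := ZMod p) (V := Additive (rootsOfUnity p ℂ))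
  rw [show Nat.card (Additive (rootsOfUnity p ℂ)) = p from Complex.card_rootsOfUnity p,
    Nat.card_zmod] at h
  exact (Nat.pow_right_injective hp.out.two_le (by simpa using h)).symm

theorem mem_rootsOfUnity_of_prufer {x : PruferGroup p} (hx : x ^ p = 1) :
    (x : ℂˣ) ∈ rootsOfUnity p ℂ := by
  rw [mem_rootsOfUnity]
  exact congrArg Subtype.val hx

theorem prufer_exists_root (x : PruferGroup p) : ∃ y : PruferGroup p, y ^ p = x := by
  obtain ⟨z, hz⟩ := IsAlgClosed.exists_pow_nat_eq ((x : ℂˣ) : ℂ) hp.out.pos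
  have hz0 : z ≠ 0 := by
    rintro rfl
    rw [zero_pow hp.out.ne_zero] at hz
    exact (x : ℂˣ).ne_zero hz.symm
  have hzx : (Units.mk0 z hz0) ^ p = (x : ℂˣ) := Units.ext (by simpa using hz)
  obtain ⟨k, hk⟩ := CommGroup.mem_primaryComponent.1 x.2
  exact ⟨⟨Units.mk0 z hz0, CommGroup.mem_primaryComponent.2 ⟨k + 1, by
    rw [pow_succ', pow_mul, hzx, hk]⟩⟩, Subtype.ext hzx⟩

theorem prufer_tors (x : PruferGroup p) : ∃ k : ℕ, x ^ p ^ k = 1 := by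
  obtain ⟨k, hk⟩ := CommGroup.mem_primaryComponent.1 x.2
  exact ⟨k, Subtype.ext hk⟩

/-- The socle of a product of Prüfer groups. -/
def pruferSocle (p r : ℕ) [Fact p.Prime] :
    {x : Fin r → PruferGroup p // x ^ p = 1} ≃ (Fin r → rootsOfUnity p ℂ) where
  toFun x i := ⟨x.1 i, mem_rootsOfUnity_of_prufer (congrFun x.2 i)⟩
  invFun y := ⟨fun i => ⟨y i, CommGroup.mem_primaryComponent.2 ⟨1, by
    rw [pow_one]
    exact (mem_rootsOfUnity p _).1 (y i).2⟩⟩, funext fun i => Subtype.ext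
      ((mem_rootsOfUnity p _).1 (y i).2)⟩
  left_inv x := rfl
  right_inv y := rfl

theorem card_pruferSocle (r : ℕ) :
    Nat.card {x : Fin r → PruferGroup p // x ^ p = 1} = p ^ r := by
  rw [Nat.card_congr (pruferSocle p r), Nat.card_pi]
  simp only [Complex.card_rootsOfUnity, Finset.prod_const, Finset.card_univ, Fintype.card_fin]

theorem card_socle_of_equiv {D : Subgroup G} {r : ℕ} (e : D ≃* (Fin r → PruferGroup p)) :
    Nat.card {x | x ∈ D ∧ x ^ p = 1} = p ^ r := by
  rw [← card_pruferSocle]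
  refine Nat.card_congr
      ⟨fun x => ⟨e ⟨x, x.2.1⟩, ?_⟩, fun y => ⟨e.symm y.1, (e.symm y.1).2, ?_⟩, ?_, ?_⟩
  · rw [← map_pow, ← map_one e]
    exact congrArg e (Subtype.ext x.2.2)
  · have : (e.symm y.1) ^ p = 1 := by rw [← map_pow, y.2, map_one]
    exact congrArg Subtype.val this
  · intro x; simp
  · intro y; simp

theorem isDiscreteTorus_of_equiv {D : Subgroup G} {r : ℕ} (e : D ≃* (Fin r → PruferGroup p)) :
    IsDiscreteTorus p D where
  comm x hx y hy := by
    have : (⟨x, hx⟩ * ⟨y, hy⟩ : D) = ⟨y, hy⟩ * ⟨x, hx⟩ :=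
      e.injective (by rw [map_mul, map_mul, mul_comm])
    exact congrArg Subtype.val this
  tors x hx := by
    choose k hk using fun i => prufer_tors (e ⟨x, hx⟩ i)
    refine ⟨∑ i, k i, ?_⟩
    have : (⟨x, hx⟩ : D) ^ p ^ (∑ i, k i) = 1 := e.injective (by
      rw [map_pow, map_one]
      funext i
      rw [Pi.pow_apply, ← Finset.add_sum_erase _ _ (Finset.mem_univ i), pow_add, pow_mul, hk]
      simp)
    exact congrArg Subtype.val this
  fin := by
    refine Set.finite_coe_iff.1 (Nat.finite_of_card_ne_zero ?_)
    rw [card_socle_of_equiv e]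
    exact pow_ne_zero _ hp.out.ne_zero
  div x hx := by
    choose y hy using fun i => prufer_exists_root (e ⟨x, hx⟩ i)
    have : (e.symm y) ^ p = ⟨x, hx⟩ := e.injective (by
      rw [map_pow, MulEquiv.apply_symm_apply]
      exact funext hy)
    exact ⟨e.symm y, (e.symm y).2, congrArg Subtype.val this⟩

/-- For a prime other than `p`, taking powers is invertible on each cyclic `p`-group. -/
theorem exists_root_of_ne_zero {A : Type*} [CommGroup A] (ht : ∀ x : A, ∃ k : ℕ, x ^ p ^ k = 1)
    (hd : ∀ x : A, ∃ y, y ^ p = x) (n : ℕ) (hn : n ≠ 0) (x : A) : ∃ y, y ^ n = x := by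
  induction n using induction_on_primes generalizing x with
  | zero => exact absurd rfl hn
  | one => exact ⟨x, pow_one x⟩
  | prime_mul q m hq ih =>
    obtain ⟨y, rfl⟩ := ih (by rintro rfl; simp at hn) x
    suffices ∃ z, z ^ q = y by
      obtain ⟨z, rfl⟩ := this
      exact ⟨z, pow_mul z q m⟩
    by_cases hqp : q = p
    · exact hqp ▸ hd y
    obtain ⟨k, hk⟩ := ht y
    have hco : Nat.Coprime (p ^ k) q := ((Nat.coprime_primes hp.out hq).2 (Ne.symm hqp)).pow_left k
    have ho : Nat.Coprime (orderOf y) q := hco.coprime_dvd_left (orderOf_dvd_of_pow_eq_one hk)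
    obtain ⟨j, hj⟩ := exists_pow_eq_self_of_coprime ho.symm
    exact ⟨y ^ j, by rw [← pow_mul, mul_comm, pow_mul, hj]⟩

/-- The socle is a finite `F_p`-space, hence isomorphic to the socle of a power of the Prüfer group.
Divisible groups are injective, so this isomorphism extends to `A`. The extension is injective
because it is so on the socle, and surjective because its image is divisible and contains the socle.
-/
theorem exists_equiv_prufer {A : Type*} [CommGroup A] (ht : ∀ x : A, ∃ k : ℕ, x ^ p ^ k = 1)
    (hd : ∀ x : A, ∃ y, y ^ p = x) (hf : {x : A | x ^ p = 1}.Finite) :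
    ∃ r, Nonempty (A ≃* (Fin r → PruferGroup p)) := by
  let V : Subgroup A := (powMonoidHom p).ker
  let _ : Module (ZMod p) (Additive V) := AddCommGroup.zmodModule (n := p) fun x =>
    Subtype.ext x.toMul.2
  have : Finite (Additive V) := Set.finite_coe_iff.2 hf
  let r := Module.finrank (ZMod p) (Additive V)
  have hfr : Module.finrank (ZMod p) (Fin r → Additive (rootsOfUnity p ℂ)) = r := by
    rw [Module.finrank_pi_fintype]
    simp only [finrank_rootsOfUnity, Finset.sum_const, Finset.card_univ, Fintype.card_fin,
      smul_eq_mul, mul_one]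
  let e : Additive V ≃ₗ[ZMod p] (Fin r → Additive (rootsOfUnity p ℂ)) :=
    LinearEquiv.ofFinrankEq _ _ hfr.symm
  let Q := Additive (Fin r → PruferGroup p)
  let c : (Fin r → Additive (rootsOfUnity p ℂ)) →+ Q :=
    { toFun := fun y => Additive.ofMul ((pruferSocle p r).symm fun i => (y i).toMul).1
      map_zero' := rfl
      map_add' := fun _ _ => rfl }
  let g : Additive V →ₗ[ℤ] Q := (c.comp e.toLinearMap.toAddMonoidHom).toIntLinearMap
  let f : Additive V →ₗ[ℤ] Additive A := (MonoidHom.toAdditive V.subtype).toIntLinearMap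
  have hQ : ∀ x : Fin r → PruferGroup p, ∃ k : ℕ, x ^ p ^ k = 1 := by
    intro x
    choose k hk using fun i => prufer_tors (x i)
    refine ⟨∑ i, k i, funext fun i => ?_⟩
    rw [Pi.pow_apply, ← Finset.add_sum_erase _ _ (Finset.mem_univ i), pow_add, pow_mul, hk]
    simp
  have hQd : ∀ x : Fin r → PruferGroup p, ∃ y, y ^ p = x := by
    intro x
    choose y hy using fun i => prufer_exists_root (x i)
    exact ⟨y, funext hy⟩
  let _ : DivisibleBy Q ℕ := divisibleByOfSMulRightSurj Q ℕ fun {n} hn x => by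
    obtain ⟨y, hy⟩ := exists_root_of_ne_zero hQ hQd n hn x.toMul
    exact ⟨Additive.ofMul y, hy⟩
  let _ : DivisibleBy Q ℤ := AddGroup.divisibleByIntOfDivisibleByNat Q
  obtain ⟨h, hh⟩ := (Module.Baer.of_divisible Q).extension_property f
    (fun x y hxy => Subtype.ext hxy) g
  let φ : A →* (Fin r → PruferGroup p) :=
    { toFun := fun x => (h (Additive.ofMul x)).toMul
      map_one' := h.map_zero
      map_mul' := fun x y => h.map_add (Additive.ofMul x) (Additive.ofMul y) }
  have hφ : ∀ (x : A) (hx : x ^ p = 1), φ x =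
      ((pruferSocle p r).symm fun i => (e (Additive.ofMul ⟨x, hx⟩) i).toMul).1 := fun x hx =>
    LinearMap.congr_fun hh (Additive.ofMul ⟨x, hx⟩)
  have hinj : ∀ (k : ℕ) (x : A), x ^ p ^ k = 1 → φ x = 1 → x = 1 := by
    intro k
    induction k with
    | zero => exact fun x h _ => by simpa using h
    | succ k ih =>
      intro x hx h1
      have hxp : x ^ p = 1 := ih (x ^ p) (by rw [← pow_mul, ← pow_succ', hx])
        (by rw [map_pow, h1, one_pow])
      have h2 : (fun i => (e (Additive.ofMul ⟨x, hxp⟩) i).toMul) = fun _ => 1 := by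
        apply (pruferSocle p r).symm.injective
        apply Subtype.ext
        rw [← hφ x hxp, h1]
        rfl
      have h3 : e (Additive.ofMul ⟨x, hxp⟩) = 0 := funext fun i => congrFun h2 i
      exact congrArg (fun z : Additive V => (z.toMul : A)) (e.map_eq_zero_iff.1 h3)
  have hφi : Function.Injective φ := by
    rw [injective_iff_map_eq_one]
    intro x hx
    obtain ⟨k, hk⟩ := ht x
    exact hinj k x hk hx
  have hφs : (⊤ : Subgroup (Fin r → PruferGroup p)) ≤ φ.range := by
    refine le_of_socle_le (p := p) (fun x _ y _ => mul_comm x y) (fun x _ => hQ x) le_top ?_ ?_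
    · rintro _ ⟨x, rfl⟩
      obtain ⟨y, rfl⟩ := hd x
      exact ⟨φ y, ⟨y, rfl⟩, (map_pow φ y p).symm⟩
    · intro x _ hx
      let v : Additive V := e.symm fun i => Additive.ofMul (pruferSocle p r ⟨x, hx⟩ i)
      refine ⟨(v.toMul : A), ?_⟩
      rw [hφ _ v.toMul.2]
      have : e (Additive.ofMul ⟨(v.toMul : A), v.toMul.2⟩) =
          fun i => Additive.ofMul (pruferSocle p r ⟨x, hx⟩ i) := e.apply_symm_apply _
      rw [this]
      rfl
  exact ⟨r, ⟨MulEquiv.ofBijective φ ⟨hφi, fun y => hφs (Subgroup.mem_top y)⟩⟩⟩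

theorem IsDiscreteTorus.exists_equiv {D : Subgroup G} (hD : IsDiscreteTorus p D) :
    ∃ r, Nonempty (D ≃* (Fin r → PruferGroup p)) := by
  let _ : CommGroup D :=
    { (inferInstance : Group D) with mul_comm := fun x y => Subtype.ext (hD.comm x x.2 y y.2) }
  refine exists_equiv_prufer (A := D) ?_ ?_ ?_
  · intro x
    obtain ⟨k, hk⟩ := hD.tors x x.2
    exact ⟨k, Subtype.ext hk⟩
  · intro x
    obtain ⟨y, hy, hyx⟩ := hD.div x x.2
    exact ⟨⟨y, hy⟩, Subtype.ext hyx⟩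
  · refine Set.Finite.of_finite_image (f := Subtype.val) (hD.fin.subset ?_)
      Subtype.val_injective.injOn
    rintro _ ⟨x, hx, rfl⟩
    exact ⟨x.2, congrArg Subtype.val hx⟩

end Torus

/-! ### Orders of discrete `p`-toral groups -/

theorem exists_mul_of_mem_sup_normalizes {G : Type*} [Group G] {P J : Subgroup G}
    (h : ∀ x ∈ P, ∀ t ∈ J, x * t * x⁻¹ ∈ J) {z : G} (hz : z ∈ P ⊔ J) :
    ∃ x ∈ P, ∃ t ∈ J, x * t = z := by
  have hP : P ≤ Subgroup.normalizer (J : Set G) := fun x hx => by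
    refine Subgroup.mem_normalizer_iff.2 fun t => ⟨h x hx t, fun ht => ?_⟩
    simpa [mul_assoc] using h x⁻¹ (inv_mem hx) _ ht
  have : z ∈ ((P ⊔ J : Subgroup G) : Set G) := hz
  rw [Subgroup.coe_mul_of_left_le_normalizer_right P J hP] at this
  exact this

section ToralOrder

variable {p : ℕ} [hp : Fact p.Prime]

theorem IsPDivisible.map {G H : Type*} [Group G] [Group H] {D : Subgroup G} (hD : IsPDivisible p D)
    (f : G →* H) : IsPDivisible p (D.map f) := by
  rintro _ ⟨x, hx, rfl⟩
  obtain ⟨y, hy, rfl⟩ := hD x hx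
  exact ⟨f y, ⟨y, hy, rfl⟩, (map_pow f y p).symm⟩

theorem IsPDivisible.le_of_pow_mem {G : Type*} [Group G] {D T : Subgroup G} {m : ℕ}
    (hD : IsPDivisible p D) (hT : ∀ x ∈ D, x ^ p ^ m ∈ T) : D ≤ T := by
  intro x hx
  obtain ⟨y, hy, rfl⟩ := hD.exists_pow m x hx
  exact hT y hy

/-- The image of the torus `A` is divisible, hence lies in `B`; counting socles compares the ranks.
For equal ranks the socles correspond, so `A` maps onto `B` and is the preimage of `B`, which
compares the indices. -/
theorem HasToralOrder.lex {P Q : Type u} [Group P] [Group Q] {r n r' n' : ℕ}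
    (hP : HasToralOrder p P r n) (hQ : HasToralOrder p Q r' n') (f : P →* Q)
    (hf : Function.Injective f) :
    (r < r' ∨ (r = r' ∧ n ≤ n')) ∧ (r = r' → n = n' → Function.Surjective f) := by
  obtain ⟨A, hA, ⟨eA⟩, hAi⟩ := hP
  obtain ⟨B, hB, ⟨eB⟩, hBi⟩ := hQ
  have tA := isDiscreteTorus_of_equiv eA
  have tB := isDiscreteTorus_of_equiv eB
  have hAB : A.map f ≤ B := (tA.div.map f).le_of_pow_mem (m := n') fun x _ => by
    rw [← hBi]; exact B.pow_index_mem x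
  have hmaps : Set.MapsTo f {x | x ∈ A ∧ x ^ p = 1} {x | x ∈ B ∧ x ^ p = 1} := fun x hx =>
    ⟨hAB ⟨x, hx.1, rfl⟩, by rw [← map_pow, hx.2, map_one]⟩
  have hcard := Set.ncard_le_ncard_of_injOn f hmaps hf.injOn tB.fin
  have cA : {x | x ∈ A ∧ x ^ p = 1}.ncard = p ^ r := card_socle_of_equiv eA
  have cB : {x | x ∈ B ∧ x ^ p = 1}.ncard = p ^ r' := card_socle_of_equiv eB
  have hrr : r ≤ r' := by
    rw [cA, cB] at hcard
    exact (Nat.pow_le_pow_iff_right hp.out.one_lt).1 hcard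
  have heq : r = r' → A = B.comap f ∧ B ≤ f.range := by
    rintro rfl
    have himg : f '' {x | x ∈ A ∧ x ^ p = 1} = {x | x ∈ B ∧ x ^ p = 1} :=
      Set.eq_of_subset_of_ncard_le hmaps.image_subset (by
        rw [Set.ncard_image_of_injective _ hf, cA, cB]) tB.fin
    have hBA : B ≤ A.map f := le_of_socle_le tB.comm tB.tors hAB (tA.div.map f) fun x hx hx1 => by
      obtain ⟨y, hy, rfl⟩ := himg.ge ⟨hx, hx1⟩
      exact ⟨y, hy.1, rfl⟩
    refine ⟨le_antisymm (fun x hx => hAB ⟨x, hx, rfl⟩) fun x hx => ?_, fun x hx => ?_⟩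
    · obtain ⟨y, hy, hyx⟩ := hBA hx
      exact hf hyx ▸ hy
    · obtain ⟨y, -, rfl⟩ := hBA hx
      exact ⟨y, rfl⟩
  refine ⟨?_, ?_⟩
  · rcases hrr.lt_or_eq with h | h
    · exact Or.inl h
    · refine Or.inr ⟨h, ?_⟩
      have h1 : A.index ∣ B.index := by
        rw [(heq h).1, Subgroup.index_comap]
        exact Subgroup.relIndex_dvd_index_of_normal _ _
      rw [hAi, hBi] at h1
      exact (Nat.pow_dvd_pow_iff_le_right hp.out.one_lt).1 h1
  · intro h hn
    have h1 := Subgroup.relIndex_mul_index (heq h).2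
    rw [← Subgroup.index_comap, ← (heq h).1, hAi, hBi, hn] at h1
    have h2 : f.range.index = 1 := by
      have h0 : 0 < p ^ n' := pow_pos hp.out.pos _
      nlinarith
    exact MonoidHom.range_eq_top.1 (Subgroup.index_eq_one.1 h2)

theorem HasToralOrder.unique {P : Type u} [Group P] {r n r' n' : ℕ}
    (h : HasToralOrder p P r n) (h' : HasToralOrder p P r' n') : r = r' ∧ n = n' := by
  have h1 := (h.lex h' (MonoidHom.id P) Function.injective_id).1
  have h2 := (h'.lex h (MonoidHom.id P) Function.injective_id).1
  omega

theorem HasToralOrder.of_equiv {P Q : Type u} [Group P] [Group Q] {r n : ℕ}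
    (hP : HasToralOrder p P r n) (e : P ≃* Q) : HasToralOrder p Q r n := by
  obtain ⟨A, hA, ⟨eA⟩, hAi⟩ := hP
  refine ⟨A.map e.toMonoidHom, hA.map _ e.surjective, ⟨(e.subgroupMap A).symm.trans eA⟩, ?_⟩
  rw [← hAi]
  exact Subgroup.index_map_equiv A e

/-- `T` is a normal discrete torus of index `p ^ m`. -/
structure IsMaximalTorus (p : ℕ) {S : Type*} [Group S] (T : Subgroup S) (m : ℕ) : Prop extends
    IsDiscreteTorus p T where
  normal : T.Normal
  index_eq : T.index = p ^ m

theorem IsDiscretePToral.exists_maximalTorus {S : Type u} [Group S] (h : IsDiscretePToral p S) :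
    ∃ (T : Subgroup S) (m : ℕ), IsMaximalTorus p T m := by
  obtain ⟨r, m, T, hT, ⟨e⟩, hm⟩ := h
  exact ⟨T, m, { isDiscreteTorus_of_equiv e with normal := hT, index_eq := hm }⟩

namespace IsMaximalTorus

variable {S : Type u} [Group S] {T : Subgroup S} {m : ℕ}

theorem pow_mem (hT : IsMaximalTorus p T m) (x : S) : x ^ p ^ m ∈ T := by
  have := hT.normal
  rw [← hT.index_eq]
  exact T.pow_index_mem x

theorem exists_pow_eq_one (hT : IsMaximalTorus p T m) (x : S) : ∃ k : ℕ, x ^ p ^ k = 1 := by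
  obtain ⟨k, hk⟩ := hT.tors _ (hT.pow_mem x)
  exact ⟨m + k, by rw [pow_add, pow_mul, hk]⟩

theorem isPGroup (hT : IsMaximalTorus p T m) (P : Subgroup S) : IsPGroup p P := fun x => by
  obtain ⟨k, hk⟩ := hT.exists_pow_eq_one (x : S)
  exact ⟨k, Subtype.ext (by simpa using hk)⟩

theorem le_of_divisible (hT : IsMaximalTorus p T m) {D : Subgroup S} (hD : IsPDivisible p D) :
    D ≤ T :=
  hD.le_of_pow_mem fun x _ => hT.pow_mem x

theorem conj_mem (hT : IsMaximalTorus p T m) {x t : S} (ht : t ∈ T) : x * t * x⁻¹ ∈ T :=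
    hT.normal.conj_mem t ht x

theorem finite_torsion (hT : IsMaximalTorus p T m) (k : ℕ) : {x | x ∈ T ∧ x ^ p ^ k = 1}.Finite :=
  _root_.finite_torsion hT.comm hT.fin k

theorem finite_quotient (hT : IsMaximalTorus p T m) : Finite (S ⧸ T) :=
  have : T.FiniteIndex := ⟨by rw [hT.index_eq]; exact pow_ne_zero _ hp.out.ne_zero⟩
  inferInstance

theorem exists_divisible_part (hT : IsMaximalTorus p T m) {B : Subgroup S} (hB : B ≤ T) :
    ∃ D ≤ B, IsPDivisible p D ∧ ∃ K : ℕ, ∀ x ∈ B, x ^ p ^ K ∈ D :=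
  _root_.exists_divisible_part (fun x hx y hy => hT.comm x (hB hx) y (hB hy))
    (fun x hx => hT.tors x (hB hx)) (hT.fin.subset fun _ hx => ⟨hB hx.1, hx.2⟩)

theorem torus_of_le (hT : IsMaximalTorus p T m) {D : Subgroup S} (hDT : D ≤ T)
    (hD : IsPDivisible p D) :
    IsDiscreteTorus p D where
  comm x hx y hy := hT.comm x (hDT hx) y (hDT hy)
  tors x hx := hT.tors x (hDT hx)
  fin := hT.fin.subset fun _ hx => ⟨hDT hx.1, hx.2⟩
  div := hD

/-- An element with a power in a divisible subgroup of the torus is the product of an element of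
that subgroup and a torsion element. -/
theorem exists_mul_torsion (hT : IsMaximalTorus p T m) {D : Subgroup S} (hDT : D ≤ T)
    (hD : IsPDivisible p D) {K : ℕ} {x : S}
    (hx : x ∈ T) (hxD : x ^ p ^ K ∈ D) :
    ∃ d ∈ D, ∃ t ∈ {x | x ∈ T ∧ x ^ p ^ K = 1}, d * t = x := by
  obtain ⟨d, hd, hdx⟩ := hD.exists_pow K _ hxD
  refine ⟨d, hd, d⁻¹ * x, ⟨mul_mem (inv_mem (hDT hd)) hx, ?_⟩, by group⟩
  rw [inv_mul_pow_of_comm hT.comm (hDT hd) hx, hdx, inv_mul_cancel]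

/-- Each coset of `D` in `B` has a representative of order dividing `p ^ K`, and there are finitely
many of these. -/
theorem relIndex_ne_zero (hT : IsMaximalTorus p T m) {B D : Subgroup S} (hB : B ≤ T) (hDB : D ≤ B)
    (hD : IsPDivisible p D)
    {K : ℕ} (hK : ∀ x ∈ B, x ^ p ^ K ∈ D) : D.relIndex B ≠ 0 := by
  have : Finite {x | x ∈ T ∧ x ^ p ^ K = 1} := hT.finite_torsion K
  have : Finite {x : B // (x : S) ^ p ^ K = 1} :=
    Finite.of_injective (fun x => (⟨x.1, hB x.1.2, x.2⟩ : {x | x ∈ T ∧ x ^ p ^ K = 1}))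
      fun x y h => Subtype.ext (Subtype.ext (congrArg (fun z => z.1) h))
  have hs : Function.Surjective
      (fun x : {x : B // (x : S) ^ p ^ K = 1} => (x.1 : B ⧸ D.subgroupOf B)) := by
    intro q
    obtain ⟨x, rfl⟩ := QuotientGroup.mk_surjective q
    obtain ⟨d, hd, t, ⟨htT, ht⟩, hdt⟩ := hT.exists_mul_torsion (hDB.trans hB) hD (hB x.2) (hK x x.2)
    have htB : t ∈ B := by
      have : t = d⁻¹ * x := by rw [← hdt]; group
      exact this ▸ mul_mem (inv_mem (hDB hd)) x.2
    refine ⟨⟨⟨t, htB⟩, ht⟩, QuotientGroup.eq.2 ?_⟩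
    rw [Subgroup.mem_subgroupOf]
    change t⁻¹ * (x : S) ∈ D
    rw [← hdt, hT.comm d (hB (hDB hd)) t htT]
    simpa using hd
  have : Finite (B ⧸ D.subgroupOf B) := Finite.of_surjective _ hs
  exact Subgroup.index_ne_zero_of_finite

/-- A conjugate of `D` under `H` is again a divisible subgroup of `H ⊓ T`, and `D` contains all of
those. -/
theorem normal_subgroupOf (hT : IsMaximalTorus p T m) {D H : Subgroup S} (hDH : D ≤ H ⊓ T)
    (hD : IsPDivisible p D) {K : ℕ}
    (hK : ∀ x ∈ H ⊓ T, x ^ p ^ K ∈ D) : (D.subgroupOf H).Normal where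
  conj_mem := by
    rintro ⟨x, hxH⟩ hx ⟨h, hh⟩
    have hdiv := hD.map (MulAut.conj h).toMonoidHom
    have hle : D.map (MulAut.conj h).toMonoidHom ≤ H ⊓ T := by
      refine le_inf ?_ (hT.le_of_divisible hdiv)
      rintro _ ⟨y, hy, rfl⟩
      exact mul_mem (mul_mem hh (hDH hy).1) (inv_mem hh)
    exact hdiv.le_of_pow_mem (fun y hy => hK y (hle hy)) ⟨x, hx, rfl⟩

/-- The torus of `H` is the largest divisible subgroup `D` of `B`, and its index in `H` is `[B : D]`
times a divisor of `p ^ m`. So the rank, and a bound for the index, depend only on `B`. -/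
theorem exists_order_bound (hT : IsMaximalTorus p T m) {B : Subgroup S} (hB : B ≤ T) : ∃ r c : ℕ,
    ∀ H : Subgroup S,
    H ⊓ T = B → ∃ n, HasToralOrder p H r n ∧ n ≤ c := by
  obtain ⟨D, hDB, hD, K, hK⟩ := hT.exists_divisible_part hB
  obtain ⟨r, ⟨e⟩⟩ := (hT.torus_of_le (hDB.trans hB) hD).exists_equiv
  refine ⟨r, p ^ m * D.relIndex B, fun H hH => ?_⟩
  subst hH
  have hDH : D ≤ H := hDB.trans inf_le_left
  have hnorm := hT.normal_subgroupOf hDB hD hK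
  have hi : D.relIndex H = D.relIndex (H ⊓ T) * T.relIndex H := by
    rw [← Subgroup.relIndex_mul_relIndex D (H ⊓ T) H hDB inf_le_left, Subgroup.inf_relIndex_left]
  have hTi : T.relIndex H ∣ p ^ m := by
    have := hT.normal
    rw [← hT.index_eq]
    exact Subgroup.relIndex_dvd_index_of_normal _ _
  have h0 : D.relIndex H ≠ 0 := by
    rw [hi]
    exact mul_ne_zero (hT.relIndex_ne_zero hB hDB hD hK)
      (ne_zero_of_dvd_ne_zero (pow_ne_zero _ hp.out.ne_zero) hTi)
  have : (D.subgroupOf H).FiniteIndex := ⟨h0⟩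
  obtain ⟨n, hn⟩ := ((hT.isPGroup H).to_quotient (D.subgroupOf H)).exists_card_eq
  refine ⟨n, ⟨D.subgroupOf H, hnorm, ⟨(Subgroup.subgroupOfEquivOfLe hDH).trans e⟩, hn⟩, ?_⟩
  have hn' : p ^ n = D.relIndex (H ⊓ T) * T.relIndex H := by rw [← hi]; exact hn.symm
  calc n ≤ p ^ n := (Nat.lt_pow_self hp.out.one_lt).le
    _ ≤ _ := by
      rw [hn', mul_comm]
      exact Nat.mul_le_mul_right _ (Nat.le_of_dvd (pow_pos hp.out.pos _) hTi)

theorem exists_toralOrder (hT : IsMaximalTorus p T m) (H : Subgroup S) : ∃ r n : ℕ,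
    HasToralOrder p H r n := by
  obtain ⟨r, c, h⟩ := hT.exists_order_bound (B := H ⊓ T) inf_le_right
  obtain ⟨n, hn, -⟩ := h H rfl
  exact ⟨r, n, hn⟩

theorem finite_orders (hT : IsMaximalTorus p T m) {X : Set (Subgroup S)}
    (hX : ((fun H => H ⊓ T) '' X).Finite) :
    {o : ℕ × ℕ | ∃ H ∈ X, HasToralOrder p H o.1 o.2}.Finite := by
  have key : ∀ B ∈ (fun H => H ⊓ T) '' X,
      {o : ℕ × ℕ | ∃ H : Subgroup S, H ⊓ T = B ∧ HasToralOrder p H o.1 o.2}.Finite := by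
    rintro _ ⟨H, -, rfl⟩
    obtain ⟨r, c, h⟩ := hT.exists_order_bound (B := H ⊓ T) inf_le_right
    refine ((Set.finite_singleton r).prod (Set.finite_Iic c)).subset ?_
    rintro ⟨r', n'⟩ ⟨H', hH', ho⟩
    obtain ⟨n, hn, hnc⟩ := h H' hH'
    obtain ⟨rfl, rfl⟩ := ho.unique hn
    exact ⟨rfl, hnc⟩
  refine (hX.biUnion key).subset ?_
  rintro o ⟨H, hH, ho⟩
  exact Set.mem_biUnion ⟨H, hH, rfl⟩ ⟨H, rfl, ho⟩

/-- Applied with `N` the centralizer or the normalizer, to find fully centralised and fully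
normalised conjugates. -/
theorem exists_max_order (hT : IsMaximalTorus p T m) {X : Set (Subgroup S)} (hne : X.Nonempty)
    {N : Subgroup S → Subgroup S}
    (hX : ((fun H => N H ⊓ T) '' X).Finite) :
    ∃ Q ∈ X, ∀ Q' ∈ X, ToralOrderLE p (N Q') (N Q) := by
  have hfin := hT.finite_orders (X := N '' X) (by rwa [Set.image_image])
  obtain ⟨Q₀, hQ₀⟩ := hne
  obtain ⟨r₀, n₀, h₀⟩ := hT.exists_toralOrder (N Q₀)
  obtain ⟨⟨r, n⟩, ⟨_, ⟨Q, hQ, rfl⟩, ho⟩, hmax⟩ :=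
    Set.exists_max_image _ (fun o : ℕ × ℕ => toLex o) hfin ⟨(r₀, n₀), N Q₀, ⟨Q₀, hQ₀, rfl⟩, h₀⟩
  refine ⟨Q, hQ, fun Q' hQ' => ?_⟩
  obtain ⟨r', n', h'⟩ := hT.exists_toralOrder (N Q')
  refine ⟨r', n', r, n, h', ho, ?_⟩
  have := hmax (r', n') ⟨N Q', ⟨Q', hQ', rfl⟩, h'⟩
  rw [Prod.Lex.toLex_le_toLex] at this
  exact this.imp_right fun h => ⟨h.1, Nat.pow_le_pow_right hp.out.pos h.2⟩

/-! ### Growth of normalizers. -/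

theorem mem_normalizer_of_conj_mem (hT : IsMaximalTorus p T m) {P : Subgroup S} {t : S}
    (h : ∀ x ∈ P, t⁻¹ * x * t ∈ P) :
    t ∈ Subgroup.normalizer (P : Set S) := by
  have hk : ∀ (k : ℕ), ∀ x ∈ P, (t⁻¹) ^ k * x * t ^ k ∈ P := by
    intro k
    induction k with
    | zero => simp
    | succ k ih =>
      intro x hx
      have := h _ (ih x hx)
      rw [pow_succ' t⁻¹, pow_succ t]
      simpa [mul_assoc] using this
  obtain ⟨k, hk1⟩ := hT.exists_pow_eq_one t
  -- Finite order makes `t` a nonnegative power of `t⁻¹`, so the one-sided inclusion suffices.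
  have ht : t = (t⁻¹) ^ (p ^ k - 1) := by
    have h1 : t ^ (p ^ k - 1) * t = 1 := by
      rw [← pow_succ, Nat.sub_add_cancel (Nat.one_le_pow _ _ hp.out.pos), hk1]
    rw [inv_pow]
    exact (inv_eq_of_mul_eq_one_right h1).symm
  refine Subgroup.mem_normalizer_iff.2 fun x => ⟨fun hx => ?_, fun hx => ?_⟩
  · have := hk (p ^ k - 1) x hx
    rwa [← ht, show t ^ (p ^ k - 1) = t⁻¹ by rw [eq_inv_iff_mul_eq_one, ← pow_succ,
      Nat.sub_add_cancel (Nat.one_le_pow _ _ hp.out.pos), hk1]] at this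
  · simpa [mul_assoc] using h _ hx

/-- A subgroup `P` that normalizes, but does not contain, a finite subgroup `X`, is normalized by
an element of `X` outside `P`. -/
theorem exists_mem_normalizer_of_finite (hT : IsMaximalTorus p T m) {P X : Subgroup S}
    (hX : (X : Set S).Finite)
    (hPX : ∀ x ∈ P, ∀ t ∈ X, x * t * x⁻¹ ∈ X) (hne : ¬ X ≤ P) :
    ∃ t ∈ X, t ∉ P ∧ t ∈ Subgroup.normalizer (P : Set S) := by
  have : Finite X := hX
  -- `P` acts by conjugation on the cosets of `P ⊓ X` in `X`. The trivial coset is fixed and `p`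
  -- divides the number of cosets, so another coset is fixed; its representatives normalize `P`.
  let c (x : P) (t : X) : X := ⟨x * t * (x : S)⁻¹, hPX x x.2 t t.2⟩
  let _ : MulAction P (X ⧸ P.subgroupOf X) :=
    { smul := fun x => Quotient.map' (c x) fun s t hst => by
        rw [QuotientGroup.leftRel_apply, Subgroup.mem_subgroupOf] at hst ⊢
        have : ((c x s)⁻¹ * c x t : X).1 = x * (s⁻¹ * t : X) * (x : S)⁻¹ := by
          simp [c, mul_assoc]
        rw [this]
        exact mul_mem (mul_mem x.2 hst) (inv_mem x.2)
      one_smul := fun q => by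
        obtain ⟨t, rfl⟩ := QuotientGroup.mk_surjective q
        exact congrArg QuotientGroup.mk (Subtype.ext (by simp [c]))
      mul_smul := fun x y q => by
        obtain ⟨t, rfl⟩ := QuotientGroup.mk_surjective q
        exact congrArg QuotientGroup.mk (Subtype.ext (by simp [c, mul_assoc])) }
  have hsmul : ∀ (x : P) (t : X), x • (t : X ⧸ P.subgroupOf X) = (c x t : X) := fun _ _ => rfl
  have hdvd : p ∣ Nat.card (X ⧸ P.subgroupOf X) := by
    obtain ⟨n, hn⟩ := ((hT.isPGroup X).index (P.subgroupOf X))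
    change p ∣ (P.subgroupOf X).index
    rw [hn]
    refine dvd_pow_self p ?_
    rintro rfl
    rw [pow_zero, Subgroup.index_eq_one, Subgroup.subgroupOf_eq_top] at hn
    exact hne hn
  obtain ⟨q, hq, hq1⟩ := (hT.isPGroup P).exists_fixed_point_of_prime_dvd_card_of_fixed_point
    (X ⧸ P.subgroupOf X) hdvd (a := ((1 : X) : X ⧸ P.subgroupOf X)) fun x => by
      rw [hsmul]
      exact congrArg QuotientGroup.mk (Subtype.ext (by simp [c]))
  obtain ⟨t, rfl⟩ := QuotientGroup.mk_surjective q
  refine ⟨t, t.2, fun ht => hq1 ?_, hT.mem_normalizer_of_conj_mem fun x hx => ?_⟩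
  · rw [QuotientGroup.eq, Subgroup.mem_subgroupOf]
    simpa using ht
  · have := hq ⟨x, hx⟩
    rw [hsmul, eq_comm, QuotientGroup.eq, Subgroup.mem_subgroupOf] at this
    have h2 := mul_mem this hx
    simpa [c, mul_assoc] using h2

/-- If `P` contains `T`, it has `p`-power index and acts on its own cosets by translation, with a
second fixed point. Otherwise some finite `T[p ^ k]`, which is normal in `S`, is not contained in
`P`. -/
theorem exists_mem_normalizer (hT : IsMaximalTorus p T m) {P : Subgroup S} (hP : P ≠ ⊤) :
    ∃ t, t ∉ P ∧ t ∈ Subgroup.normalizer (P : Set S) := by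
  by_cases hTP : T ≤ P
  · have hfi : P.FiniteIndex := by
      have : T.FiniteIndex := ⟨by rw [hT.index_eq]; exact pow_ne_zero _ hp.out.ne_zero⟩
      exact Subgroup.finiteIndex_of_le hTP
    have hdvd : p ∣ Nat.card (S ⧸ P) := by
      have hd : P.index ∣ p ^ m := hT.index_eq ▸ Subgroup.index_dvd_of_le hTP
      obtain ⟨n, -, hn⟩ := (Nat.dvd_prime_pow hp.out).1 hd
      change p ∣ P.index
      rw [hn]
      refine dvd_pow_self p ?_
      rintro rfl
      rw [pow_zero, Subgroup.index_eq_one] at hn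
      exact hP hn
    obtain ⟨q, hq, hq1⟩ := (hT.isPGroup P).exists_fixed_point_of_prime_dvd_card_of_fixed_point
      (S ⧸ P) hdvd (a := ((1 : S) : S ⧸ P)) fun x => by
        change ((x * 1 : S) : S ⧸ P) = _
        rw [QuotientGroup.eq]
        simp
    obtain ⟨t, rfl⟩ := QuotientGroup.mk_surjective q
    refine ⟨t, fun ht => hq1 ?_, hT.mem_normalizer_of_conj_mem fun x hx => ?_⟩
    · rw [QuotientGroup.eq]
      simpa using ht
    · have : ((x * t : S) : S ⧸ P) = t := hq ⟨x, hx⟩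
      rw [eq_comm, QuotientGroup.eq] at this
      simpa [mul_assoc] using this
  · obtain ⟨t, htT, htP⟩ := SetLike.not_le_iff_exists.1 hTP
    obtain ⟨k, hk⟩ := hT.tors t htT
    obtain ⟨s, -, hs⟩ := hT.exists_mem_normalizer_of_finite (P := P)
      (X := torsionSubgroup T hT.comm (p ^ k)) (hT.finite_torsion k)
      (fun x _ s hs => ⟨hT.conj_mem hs.1, by rw [conj_pow, hs.2]; simp⟩)
      (fun h => htP (h ⟨htT, hk⟩))
    exact ⟨s, hs⟩

end IsMaximalTorus

end ToralOrder

/-! ### Morphisms of a fusion system as maps on `S` -/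

namespace FusionSystem

variable {S : Type u} [Group S] (F : FusionSystem S)

/-- The restriction of `φ : S → S` to `P` is a morphism `P → S` of `F`. -/
def Mor (P : Subgroup S) (φ : S → S) : Prop :=
  ∃ f ∈ F.hom P ⊤, ∀ x : P, φ x = f x

/-- The maps `φ` and `ψ` restrict to inverse isomorphisms of `F` between `P` and `Q`. -/
structure IsoOn (P Q : Subgroup S) (φ ψ : S → S) : Prop where
  mor : F.Mor P φ
  mor_symm : F.Mor Q ψ
  maps : ∀ x ∈ P, φ x ∈ Q
  maps_symm : ∀ y ∈ Q, ψ y ∈ P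
  left_inv : ∀ x ∈ P, ψ (φ x) = x
  right_inv : ∀ y ∈ Q, φ (ψ y) = y

variable {F}

theorem inclusion_mem {P Q : Subgroup S} (h : P ≤ Q) : Subgroup.inclusion h ∈ F.hom P Q :=
  F.conj_mem 1 _ fun x => by simp

theorem Mor.congr {P : Subgroup S} {φ φ' : S → S} (h : F.Mor P φ) (hφ : ∀ x ∈ P, φ' x = φ x) :
    F.Mor P φ' := by
  obtain ⟨f, hf, hfφ⟩ := h
  exact ⟨f, hf, fun x => (hφ x x.2).trans (hfφ x)⟩

theorem Mor.mono {P P' : Subgroup S} {φ : S → S} (h : F.Mor P φ) (hP : P' ≤ P) : F.Mor P' φ := by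
  obtain ⟨f, hf, hfφ⟩ := h
  exact ⟨_, F.comp_mem (inclusion_mem hP) hf, fun x => hfφ (Subgroup.inclusion hP x)⟩

/-- Morphisms factor as an isomorphism and an inclusion, so membership in `F` does not depend on the
codomain. This permits treating morphisms as plain maps `S → S`. -/
theorem Mor.mem_hom {P Q : Subgroup S} {φ : S → S} (h : F.Mor P φ) (f : P →* Q)
    (hf : ∀ x : P, φ x = f x) : f ∈ F.hom P Q := by
  obtain ⟨g, hg, hgφ⟩ := h
  obtain ⟨R, hR, e, he, -, rfl⟩ := F.factor hg
  have hRQ : R ≤ Q := fun y hy => by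
    obtain ⟨x, hx⟩ := e.surjective ⟨y, hy⟩
    have h1 := (hf x).symm.trans (hgφ x)
    have h2 : ((Subgroup.inclusion hR).comp e.toMonoidHom x : (⊤ : Subgroup S)).1 = y := by
      change (e x : S) = y
      rw [hx]
    rw [show y = (f x : S) from (h1.trans h2).symm]
    exact (f x).2
  have : f = (Subgroup.inclusion hRQ).comp e.toMonoidHom := by
    ext x
    exact (hf x).symm.trans (hgφ x)
  rw [this]
  exact F.comp_mem he (inclusion_mem hRQ)

theorem mor_of_mem_hom {P Q : Subgroup S} {φ : S → S} {f : P →* Q} (h : f ∈ F.hom P Q)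
    (hf : ∀ x : P, φ x = f x) : F.Mor P φ :=
  ⟨_, F.comp_mem h (inclusion_mem le_top), hf⟩

open Classical in
theorem exists_mor_of_mem_hom {P Q : Subgroup S} {f : P →* Q} (h : f ∈ F.hom P Q) :
    ∃ φ, F.Mor P φ ∧ ∀ x : P, φ x = f x := by
  let φ : S → S := fun x => if hx : x ∈ P then (f ⟨x, hx⟩ : S) else 1
  have hφ : ∀ x : P, φ x = f x := fun x => by simp [φ]
  exact ⟨φ, mor_of_mem_hom h hφ, hφ⟩

theorem Mor.map_mul {P : Subgroup S} {φ : S → S} (h : F.Mor P φ) {x y : S} (hx : x ∈ P)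
    (hy : y ∈ P) : φ (x * y) = φ x * φ y := by
  obtain ⟨f, -, hf⟩ := h
  have hxy := hf (⟨x, hx⟩ * ⟨y, hy⟩)
  rw [_root_.map_mul] at hxy
  exact hxy.trans (congrArg₂ (· * ·) (hf ⟨x, hx⟩) (hf ⟨y, hy⟩)).symm

theorem Mor.map_one {P : Subgroup S} {φ : S → S} (h : F.Mor P φ) : φ 1 = 1 := by
  have := h.map_mul (one_mem P) (one_mem P)
  simpa using this

theorem Mor.map_inv {P : Subgroup S} {φ : S → S} (h : F.Mor P φ) {x : S} (hx : x ∈ P) :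
    φ x⁻¹ = (φ x)⁻¹ := by
  have := h.map_mul hx (inv_mem hx)
  rw [mul_inv_cancel, h.map_one] at this
  exact (inv_eq_of_mul_eq_one_right this.symm).symm

theorem Mor.map_pow {P : Subgroup S} {φ : S → S} (h : F.Mor P φ) {x : S} (hx : x ∈ P) (n : ℕ) :
    φ (x ^ n) = φ x ^ n := by
  induction n with
  | zero => simpa using h.map_one
  | succ n ih => rw [pow_succ, pow_succ, h.map_mul (pow_mem hx n) hx, ih]

theorem Mor.map_conj {P : Subgroup S} {φ : S → S} (h : F.Mor P φ) {x y : S} (hx : x ∈ P)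
    (hy : y ∈ P) : φ (x * y * x⁻¹) = φ x * φ y * (φ x)⁻¹ := by
  rw [h.map_mul (mul_mem hx hy) (inv_mem hx), h.map_mul hx hy, h.map_inv hx]

theorem Mor.injOn {P : Subgroup S} {φ : S → S} (h : F.Mor P φ) {x y : S} (hx : x ∈ P)
    (hy : y ∈ P) (hxy : φ x = φ y) : x = y := by
  obtain ⟨f, hf, hfφ⟩ := h
  have := F.injective hf (a₁ := ⟨x, hx⟩) (a₂ := ⟨y, hy⟩)
    (Subtype.ext ((hfφ ⟨x, hx⟩).symm.trans (hxy.trans (hfφ ⟨y, hy⟩))))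
  exact congrArg Subtype.val this

theorem Mor.conj (P : Subgroup S) (s : S) : F.Mor P fun x => s * x * s⁻¹ :=
  ⟨(Subgroup.inclusion le_top).comp ((MulAut.conj s).toMonoidHom.subgroupMap P),
    F.conj_mem s _ fun _ => rfl, fun _ => rfl⟩

theorem Mor.id (P : Subgroup S) : F.Mor P fun x => x :=
  ⟨_, inclusion_mem le_top, fun _ => rfl⟩

/-- The restriction of a morphism to a map between subgroups. -/
def Mor.toHom {P Q : Subgroup S} {φ : S → S} (h : F.Mor P φ) (hPQ : ∀ x ∈ P, φ x ∈ Q) :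
    P →* Q where
  toFun x := ⟨φ x, hPQ x x.2⟩
  map_one' := Subtype.ext h.map_one
  map_mul' x y := Subtype.ext (h.map_mul x.2 y.2)

theorem Mor.toHom_mem {P Q : Subgroup S} {φ : S → S} (h : F.Mor P φ) (hPQ : ∀ x ∈ P, φ x ∈ Q) :
    h.toHom hPQ ∈ F.hom P Q :=
  h.mem_hom _ fun _ => rfl

theorem Mor.comp {P Q : Subgroup S} {φ ψ : S → S} (hψ : F.Mor Q ψ) (hφ : F.Mor P φ)
    (hPQ : ∀ x ∈ P, φ x ∈ Q) : F.Mor P fun x => ψ (φ x) := by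
  obtain ⟨g, hg, hgψ⟩ := hψ
  exact ⟨_, F.comp_mem (hφ.toHom_mem hPQ) hg, fun x => hgψ (hφ.toHom hPQ x)⟩

theorem Mor.exists_isoOn {P : Subgroup S} {φ : S → S} (h : F.Mor P φ) :
    ∃ Q ψ, F.IsoOn P Q φ ψ := by
  have h' := h
  obtain ⟨f, hf, hfφ⟩ := h'
  obtain ⟨R, hR, e, -, he, rfl⟩ := F.factor hf
  obtain ⟨ψ, hψ, hψe⟩ := exists_mor_of_mem_hom he
  have hφ : ∀ x : P, φ x = e x := hfφ
  have hψ' : ∀ y : R, ψ y = e.symm y := hψe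
  refine ⟨R, ψ, h, hψ, fun x hx => ?_, fun y hy => ?_, fun x hx => ?_, fun y hy => ?_⟩
  · rw [hφ ⟨x, hx⟩]; exact (e ⟨x, hx⟩).2
  · rw [hψ' ⟨y, hy⟩]; exact (e.symm ⟨y, hy⟩).2
  · rw [hφ ⟨x, hx⟩, hψ' (e ⟨x, hx⟩), e.symm_apply_apply]
  · rw [hψ' ⟨y, hy⟩, hφ (e.symm ⟨y, hy⟩), e.apply_symm_apply]

namespace IsoOn

variable {P Q R : Subgroup S} {φ ψ φ' ψ' : S → S}

theorem symm (h : F.IsoOn P Q φ ψ) : F.IsoOn Q P ψ φ :=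
  ⟨h.mor_symm, h.mor, h.maps_symm, h.maps, h.right_inv, h.left_inv⟩

theorem trans (h : F.IsoOn P Q φ ψ) (h' : F.IsoOn Q R φ' ψ') :
    F.IsoOn P R (fun x => φ' (φ x)) (fun x => ψ (ψ' x)) where
  mor := h'.mor.comp h.mor h.maps
  mor_symm := h.mor_symm.comp h'.mor_symm h'.maps_symm
  maps x hx := h'.maps _ (h.maps x hx)
  maps_symm x hx := h.maps_symm _ (h'.maps_symm x hx)
  left_inv x hx := by rw [h'.left_inv _ (h.maps x hx), h.left_inv x hx]
  right_inv x hx := by rw [h.right_inv _ (h'.maps_symm x hx), h'.right_inv x hx]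

/-- The isomorphism of groups underlying an isomorphism of `F`. -/
def toMulEquiv (h : F.IsoOn P Q φ ψ) : P ≃* Q where
  toFun x := ⟨φ x, h.maps x x.2⟩
  invFun y := ⟨ψ y, h.maps_symm y y.2⟩
  left_inv x := Subtype.ext (h.left_inv x x.2)
  right_inv y := Subtype.ext (h.right_inv y y.2)
  map_mul' x y := Subtype.ext (h.mor.map_mul x.2 y.2)

theorem conj (h : F.IsoOn P Q φ ψ) : F.Conj P Q :=
  ⟨h.toMulEquiv, h.mor.mem_hom _ fun _ => rfl, h.mor_symm.mem_hom _ fun _ => rfl⟩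

theorem mem_image_iff (h : F.IsoOn P Q φ ψ) {y : S} : y ∈ Q ↔ ∃ x ∈ P, φ x = y :=
  ⟨fun hy => ⟨ψ y, h.maps_symm y hy, h.right_inv y hy⟩, by
    rintro ⟨x, hx, rfl⟩
    exact h.maps x hx⟩

theorem divisible {p : ℕ} (h : F.IsoOn P Q φ ψ) (hP : IsPDivisible p P) : IsPDivisible p Q := by
  intro y hy
  obtain ⟨x, hx, hxy⟩ := hP _ (h.maps_symm y hy)
  exact ⟨φ x, h.maps x hx, by rw [← h.mor.map_pow hx, hxy, h.right_inv y hy]⟩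

/-- An element inducing, through `φ`, conjugation by `h` on the target, normalizes the target. -/
theorem mem_normalizer (h : F.IsoOn P Q φ ψ) {g s : S}
    (hg : g ∈ Subgroup.normalizer (P : Set S)) (hs : ∀ x ∈ P, φ (g * x * g⁻¹) = s * φ x * s⁻¹) :
    s ∈ Subgroup.normalizer (Q : Set S) := by
  have hg1 := Subgroup.mem_normalizer_iff.1 hg
  have hg2 := Subgroup.mem_normalizer_iff''.1 hg
  refine Subgroup.mem_normalizer_iff.2 fun y => ⟨fun hy => ?_, fun hy => ?_⟩
  · obtain ⟨x, hx, rfl⟩ := h.mem_image_iff.1 hy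
    rw [← hs x hx]
    exact h.maps _ ((hg1 x).1 hx)
  · obtain ⟨x, hx, hxy⟩ := h.mem_image_iff.1 hy
    have hx' : g⁻¹ * x * g ∈ P := (hg2 x).1 hx
    have := hs _ hx'
    rw [show g * (g⁻¹ * x * g) * g⁻¹ = x by group, hxy] at this
    have h2 : y = φ (g⁻¹ * x * g) := by simpa using this
    rw [h2]
    exact h.maps _ hx'

end IsoOn

theorem Conj.exists_isoOn {P Q : Subgroup S} (h : F.Conj P Q) : ∃ φ ψ, F.IsoOn P Q φ ψ := by
  obtain ⟨e, he, he'⟩ := h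
  obtain ⟨φ, hφ, hφe⟩ := exists_mor_of_mem_hom he
  obtain ⟨ψ, hψ, hψe⟩ := exists_mor_of_mem_hom he'
  have hφ' : ∀ x : P, φ x = e x := hφe
  have hψ' : ∀ y : Q, ψ y = e.symm y := hψe
  refine ⟨φ, ψ, hφ, hψ, fun x hx => ?_, fun y hy => ?_, fun x hx => ?_, fun y hy => ?_⟩
  · rw [hφ' ⟨x, hx⟩]; exact (e ⟨x, hx⟩).2
  · rw [hψ' ⟨y, hy⟩]; exact (e.symm ⟨y, hy⟩).2
  · rw [hφ' ⟨x, hx⟩, hψ' (e ⟨x, hx⟩), e.symm_apply_apply]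
  · rw [hψ' ⟨y, hy⟩, hφ' (e.symm ⟨y, hy⟩), e.apply_symm_apply]

theorem Conj.refl (P : Subgroup S) : F.Conj P P :=
  ⟨MulEquiv.refl P, F.id_mem P, F.id_mem P⟩

theorem Conj.symm {P Q : Subgroup S} (h : F.Conj P Q) : F.Conj Q P := by
  obtain ⟨e, he, he'⟩ := h
  exact ⟨e.symm, he', he⟩

theorem Conj.trans {P Q R : Subgroup S} (h : F.Conj P Q) (h' : F.Conj Q R) : F.Conj P R := by
  obtain ⟨φ, ψ, h⟩ := h.exists_isoOn
  obtain ⟨φ', ψ', h'⟩ := h'.exists_isoOn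
  exact (h.trans h').conj

section Saturated

variable {p : ℕ} [hp : Fact p.Prime]

/-- The element `s` automatically normalizes `Q` (`IsoOn.mem_normalizer`), so `N` lies in the
extender as soon as some `s` exists. -/
theorem IsSaturated.exists_extension (hF : F.IsSaturated p) {P Q N : Subgroup S} {φ ψ : S → S}
    (h : F.IsoOn P Q φ ψ) (hQ : F.IsFullyCentralised p Q)
    (hN : ∀ g ∈ N, g ∈ Subgroup.normalizer (P : Set S) ∧
      ∃ s, ∀ x ∈ P, φ (g * x * g⁻¹) = s * φ x * s⁻¹) :
    ∃ φ', F.Mor N φ' ∧ ∀ x ∈ P, x ∈ N → φ' x = φ x := by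
  let f : P →* (⊤ : Subgroup S) := h.mor.toHom fun _ _ => Subgroup.mem_top _
  have himg : imageOf f = Q := by
    ext y
    constructor
    · rintro ⟨_, ⟨x, rfl⟩, rfl⟩
      exact h.maps x x.2
    · intro hy
      exact ⟨f ⟨ψ y, h.maps_symm y hy⟩, ⟨_, rfl⟩, h.right_inv y hy⟩
  obtain ⟨f', hf', hff'⟩ := hF.extend P f (h.mor.toHom_mem _) (himg ▸ hQ)
  have hNe : N ≤ extender f := fun g hg => by
    obtain ⟨hg1, s, hs⟩ := hN g hg
    refine ⟨hg1, s, himg ▸ h.mem_normalizer hg1 hs, fun x y hxy => ?_⟩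
    change φ y = s * φ x * s⁻¹
    rw [hxy, hs x x.2]
  obtain ⟨φ', hφ', hφf⟩ := exists_mor_of_mem_hom hf'
  refine ⟨φ', hφ'.mono hNe, fun x hx hxN => ?_⟩
  rw [hφf ⟨x, hNe hxN⟩, hff' ⟨x, hx⟩ ⟨x, hNe hxN⟩ rfl]
  rfl

theorem IsSaturated.exists_extension_centralizer (hF : F.IsSaturated p) {P Q : Subgroup S}
    {φ ψ : S → S} (h : F.IsoOn P Q φ ψ) (hQ : F.IsFullyCentralised p Q) :
    ∃ φ', F.Mor (P ⊔ Subgroup.centralizer (P : Set S)) φ' ∧ ∀ x ∈ P, φ' x = φ x := by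
  have hle : P ⊔ Subgroup.centralizer (P : Set S) ≤ Subgroup.normalizer (P : Set S) :=
    sup_le Subgroup.le_normalizer (Subgroup.centralizer_le_normalizer _)
  obtain ⟨φ', h1, h2⟩ := hF.exists_extension (N := P ⊔ Subgroup.centralizer (P : Set S)) h hQ
    fun g hg => by
      refine ⟨hle hg, ?_⟩
      obtain ⟨x, hx, c, hc, rfl⟩ := exists_mul_of_mem_sup_normalizes (fun x hx c hc => by
        have hxc := Subgroup.mem_centralizer_iff.1 hc x hx
        rw [hxc]
        simpa using hc) hg
      refine ⟨φ x, fun y hy => ?_⟩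
      have hcy := Subgroup.mem_centralizer_iff.1 hc y hy
      rw [show x * c * y * (x * c)⁻¹ = x * y * x⁻¹ by
        rw [mul_assoc x c y, ← hcy]; group]
      exact h.mor.map_conj hx hy
  exact ⟨φ', h1, fun x hx => h2 x hx (le_sup_left (a := P) hx)⟩

theorem IsSaturated.mor_iSup (hF : F.IsSaturated p) {P : ℕ → Subgroup S} (hP : Monotone P)
    {φ : S → S} (h : ∀ n, F.Mor (P n) φ) : F.Mor (⨆ n, P n) φ := by
  have hmem : ∀ x, x ∈ ⨆ n, P n ↔ ∃ n, x ∈ P n := fun x =>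
    Subgroup.mem_iSup_of_directed hP.directed_le
  let f : (⨆ n, P n : Subgroup S) →* (⊤ : Subgroup S) :=
    { toFun := fun x => ⟨φ x, Subgroup.mem_top _⟩
      map_one' := Subtype.ext (h 0).map_one
      map_mul' := fun x y => Subtype.ext (by
        obtain ⟨i, hi⟩ := (hmem x).1 x.2
        obtain ⟨j, hj⟩ := (hmem y).1 y.2
        exact (h (max i j)).map_mul (hP (le_max_left i j) hi) (hP (le_max_right i j) hj)) }
  exact ⟨f, hF.union P f hP fun n => (h n).mem_hom _ fun _ => rfl, fun _ => rfl⟩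

end Saturated

end FusionSystem

/-! ### The maximal torus of a saturated fusion system -/

/-- The subgroup generated by the `p`-divisible subgroups of `B`. -/
def divisiblePart (p : ℕ) {G : Type*} [Group G] (B : Subgroup G) : Subgroup G :=
  sSup {D | D ≤ B ∧ IsPDivisible p D}

theorem divisiblePart_le {p : ℕ} {G : Type*} [Group G] (B : Subgroup G) : divisiblePart p B ≤ B :=
  sSup_le fun _ hD => hD.1

theorem le_divisiblePart {p : ℕ} {G : Type*} [Group G] {B D : Subgroup G} (h : D ≤ B)
    (hD : IsPDivisible p D) : D ≤ divisiblePart p B :=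
  le_sSup ⟨h, hD⟩

theorem divisiblePart_mono {p : ℕ} {G : Type*} [Group G] {B B' : Subgroup G} (h : B ≤ B') :
    divisiblePart p B ≤ divisiblePart p B' :=
  sSup_le_sSup fun _ hD => ⟨hD.1.trans h, hD.2⟩

/-- The elements of `T` whose commutators with all elements over `U` lie in `D`. -/
def commutatorSlice {S : Type*} [Group S] (T : Subgroup S) (U : Set (S ⧸ T)) (D : Set S) : Set S :=
  {t | t ∈ T ∧ ∀ s : S, (s : S ⧸ T) ∈ U → t * s * t⁻¹ * s⁻¹ ∈ D}

namespace IsMaximalTorus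

variable {p : ℕ} [hp : Fact p.Prime] {S : Type u} [Group S] {T : Subgroup S} {m : ℕ}

theorem divisiblePart_eq (hT : IsMaximalTorus p T m) {B : Subgroup S} (hB : B ≤ T) :
    IsPDivisible p (divisiblePart p B) ∧ ∃ K : ℕ, ∀ x ∈ B, x ^ p ^ K ∈ divisiblePart p B := by
  obtain ⟨D, hDB, hD, K, hK⟩ := hT.exists_divisible_part hB
  have : divisiblePart p B = D := le_antisymm
    (sSup_le fun D' hD' => hD'.2.le_of_pow_mem fun x hx => hK x (hD'.1 hx))
        (le_divisiblePart hDB hD)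
  rw [this]
  exact ⟨hD, K, hK⟩

/-- Changing `s` within its coset inserts an element of the abelian group `T`, which commutes with
`t`. -/
theorem commutator_eq (hT : IsMaximalTorus p T m) {t s s' : S} (ht : t ∈ T) (h : (s : S ⧸ T) = s') :
    t * s * t⁻¹ * s⁻¹ = t * s' * t⁻¹ * s'⁻¹ := by
  obtain ⟨a, ha, rfl⟩ : ∃ a ∈ T, s' = s * a := ⟨s⁻¹ * s', QuotientGroup.eq.1 h, by group⟩
  have hc := hT.comm a ha t⁻¹ (inv_mem ht)
  calc t * s * t⁻¹ * s⁻¹ = t * s * (t⁻¹ * a) * a⁻¹ * s⁻¹ := by group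
    _ = _ := by rw [← hc]; group

theorem centralizer_inf (hT : IsMaximalTorus p T m) (Q : Subgroup S) :
    ((Subgroup.centralizer (Q : Set S) ⊓ T : Subgroup S) : Set S) =
      commutatorSlice T ((fun s : S => (s : S ⧸ T)) '' (Q : Set S)) {1} := by
  ext t
  constructor
  · rintro ⟨ht, htT⟩
    refine ⟨htT, ?_⟩
    rintro s ⟨x, hx, hxs⟩
    rw [hT.commutator_eq htT hxs.symm, Set.mem_singleton_iff,
      ← Subgroup.mem_centralizer_iff.1 ht x hx]
    group
  · rintro ⟨htT, ht⟩
    refine ⟨Subgroup.mem_centralizer_iff.2 fun x hx => ?_, htT⟩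
    have := ht x ⟨x, hx, rfl⟩
    rw [Set.mem_singleton_iff, mul_inv_eq_one, mul_inv_eq_iff_eq_mul] at this
    exact this.symm

theorem normalizer_inf (hT : IsMaximalTorus p T m) (Q : Subgroup S) :
    ((Subgroup.normalizer (Q : Set S) ⊓ T : Subgroup S) : Set S) =
      commutatorSlice T ((fun s : S => (s : S ⧸ T)) '' (Q : Set S)) (Q ⊓ T : Subgroup S) := by
  ext t
  constructor
  · rintro ⟨ht, htT⟩
    refine ⟨htT, ?_⟩
    rintro s ⟨x, hx, hxs⟩
    rw [hT.commutator_eq htT hxs.symm]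
    refine ⟨Q.mul_mem ((Subgroup.mem_normalizer_iff.1 ht x).1 hx) (Q.inv_mem hx), ?_⟩
    have := T.mul_mem htT (hT.conj_mem (x := x) (T.inv_mem htT))
    simpa [mul_assoc] using this
  · rintro ⟨htT, ht⟩
    refine ⟨?_, htT⟩
    have h : t⁻¹ ∈ Subgroup.normalizer (Q : Set S) := hT.mem_normalizer_of_conj_mem fun x hx => by
      have := mul_mem (ht x ⟨x, hx, rfl⟩).1 hx
      simpa using this
    exact (Subgroup.inv_mem_iff _).1 h

/-- `C_T(Q)` depends only on the image of `Q` in the finite group `S ⧸ T`. -/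
theorem finite_centralizer_inf (hT : IsMaximalTorus p T m) (X : Set (Subgroup S)) :
    ((fun Q : Subgroup S => Subgroup.centralizer (Q : Set S) ⊓ T) '' X).Finite := by
  have := hT.finite_quotient
  refine Set.Finite.of_finite_image (f := fun H : Subgroup S => (H : Set S))
    ((Set.finite_range fun U : Set (S ⧸ T) => commutatorSlice T U {1}).subset ?_)
    SetLike.coe_injective.injOn
  rintro _ ⟨_, ⟨Q, -, rfl⟩, rfl⟩
  exact ⟨_, (hT.centralizer_inf Q).symm⟩

/-- `N_T(Q)` depends on the image of `Q` in `S ⧸ T` and also on `Q ⊓ T`; hence the hypothesis, which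
centralizers do not need. -/
theorem finite_normalizer_inf (hT : IsMaximalTorus p T m) {X : Set (Subgroup S)}
    (hX : ((fun Q => Q ⊓ T) '' X).Finite) :
    ((fun Q : Subgroup S => Subgroup.normalizer (Q : Set S) ⊓ T) '' X).Finite := by
  have := hT.finite_quotient
  refine Set.Finite.of_finite_image (f := fun H : Subgroup S => (H : Set S))
    (((Set.finite_univ (α := Set (S ⧸ T))).image2
      (fun U (D : Subgroup S) => commutatorSlice T U D) hX).subset ?_)
    SetLike.coe_injective.injOn
  rintro _ ⟨_, ⟨Q, hQ, rfl⟩, rfl⟩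
  exact ⟨_, trivial, _, ⟨Q, hQ, rfl⟩, (hT.normalizer_inf Q).symm⟩

end IsMaximalTorus

/-! ### Automorphisms of the torus and torus hulls. -/

namespace FusionSystem

variable {p : ℕ} [hp : Fact p.Prime] {S : Type u} [Group S] (F : FusionSystem S)

/-- The elements of `T` fixed by all automorphisms of `T` in `F` that fix `A`. -/
def hull (T : Subgroup S) (A : Set S) : Subgroup S where
  carrier := {t | t ∈ T ∧ ∀ w, F.Mor T w → (∀ a ∈ A, w a = a) → w t = t}
  one_mem' := ⟨one_mem T, fun _ hw _ => hw.map_one⟩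
  mul_mem' := fun {x y} hx hy => ⟨mul_mem hx.1 hy.1, fun w hw h => by
    rw [hw.map_mul hx.1 hy.1, hx.2 w hw h, hy.2 w hw h]⟩
  inv_mem' := fun {x} hx => ⟨inv_mem hx.1, fun w hw h => by rw [hw.map_inv hx.1, hx.2 w hw h]⟩

/-- The `p ^ m`-th powers of the elements of `P`. -/
def powers (p m : ℕ) (P : Subgroup S) : Set S := {y | ∃ x ∈ P, y = x ^ p ^ m}

/-- The largest divisible subgroup of the hull of the set of `p ^ m`-th powers of `P`. -/
def torusHull (p m : ℕ) (T P : Subgroup S) : Subgroup S :=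
  divisiblePart p (F.hull T (powers p m P))

variable {F} {T : Subgroup S} {m : ℕ}

theorem exists_fullyCentralised (hT : IsMaximalTorus p T m) (P : Subgroup S) :
    ∃ Q φ ψ, F.IsoOn P Q φ ψ ∧ F.IsFullyCentralised p Q := by
  obtain ⟨Q, hQ, hmax⟩ := hT.exists_max_order (X := {Q | F.Conj P Q}) ⟨P, Conj.refl P⟩
    (N := fun Q => Subgroup.centralizer (Q : Set S)) (hT.finite_centralizer_inf _)
  obtain ⟨φ, ψ, h⟩ := Conj.exists_isoOn hQ
  exact ⟨Q, φ, ψ, h, fun Q' hQ' => hmax Q' (Conj.trans hQ hQ')⟩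

theorem Mor.map_mem_torus (hT : IsMaximalTorus p T m) {D : Subgroup S} {φ : S → S}
    (h : F.Mor D φ) (hD : IsPDivisible p D) {x : S} (hx : x ∈ D) : φ x ∈ T := by
  obtain ⟨y, hy, rfl⟩ := hD.exists_pow m x hx
  rw [h.map_pow hy]
  exact hT.pow_mem _

theorem IsoOn.hasToralOrder {P Q : Subgroup S} {φ ψ : S → S} (h : F.IsoOn P Q φ ψ) {r n : ℕ}
    (hP : HasToralOrder p P r n) : HasToralOrder p Q r n :=
  hP.of_equiv h.toMulEquiv

/-- Isomorphic groups have the same toral order, and a subgroup with the order of the whole group is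
the whole group. -/
theorem IsoOn.eq_of_le (hT : IsMaximalTorus p T m) {P Q : Subgroup S} {φ ψ : S → S}
    (h : F.IsoOn P Q φ ψ) (hQP : Q ≤ P) : Q = P := by
  obtain ⟨r, n, ho⟩ := hT.exists_toralOrder P
  have hs := ((h.hasToralOrder ho).lex ho (Subgroup.inclusion hQP)
    (Subgroup.inclusion_injective hQP)).2 rfl rfl
  refine le_antisymm hQP fun x hx => ?_
  obtain ⟨y, hy⟩ := hs ⟨x, hx⟩
  rw [← show (y : S) = x from congrArg Subtype.val hy]
  exact y.2

theorem Mor.exists_isoOn_torus (hT : IsMaximalTorus p T m) {w : S → S} (hw : F.Mor T w) :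
    ∃ w', F.IsoOn T T w w' := by
  obtain ⟨Q, w', h⟩ := hw.exists_isoOn
  have hQ : Q = T := h.eq_of_le hT (hT.le_of_divisible (h.divisible hT.div))
  exact ⟨w', hQ ▸ h⟩

theorem Mor.torus_mem (hT : IsMaximalTorus p T m) {w : S → S} (hw : F.Mor T w) {t : S}
    (ht : t ∈ T) : w t ∈ T :=
  hw.map_mem_torus hT hT.div ht

theorem le_centralizer_of_le_torus (hT : IsMaximalTorus p T m) {P : Subgroup S} (hP : P ≤ T) :
    T ≤ P ⊔ Subgroup.centralizer (P : Set S) :=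
  le_trans (fun t ht => Subgroup.mem_centralizer_iff.2 fun x hx => hT.comm x (hP hx) t ht)
    le_sup_right

/-- A morphism between subgroups of the torus is the restriction of an automorphism of the torus. -/
theorem exists_torus_extension (hT : IsMaximalTorus p T m) (hF : F.IsSaturated p) {P : Subgroup S}
    {φ : S → S} (h : F.Mor P φ) (hP : P ≤ T) (hφ : ∀ x ∈ P, φ x ∈ T) :
    ∃ w, F.Mor T w ∧ ∀ x ∈ P, w x = φ x := by
  obtain ⟨P', ψ, i⟩ := h.exists_isoOn
  have hP' : P' ≤ T := fun y hy => by
    obtain ⟨x, hx, rfl⟩ := i.mem_image_iff.1 hy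
    exact hφ x hx
  -- Extension requires a fully centralised target, so `P` and `P'` are both mapped to such a `Q`.
  -- As `T` centralizes both, the two maps extend to automorphisms of `T`; their quotient is the one
  -- wanted.
  obtain ⟨Q, α, α', iα, hQ⟩ := exists_fullyCentralised (F := F) hT P
  obtain ⟨a, ha, haα⟩ := hF.exists_extension_centralizer iα hQ
  obtain ⟨b, hb, hbα⟩ := hF.exists_extension_centralizer (i.symm.trans iα) hQ
  replace ha := ha.mono (le_centralizer_of_le_torus hT hP)
  replace hb := hb.mono (le_centralizer_of_le_torus hT hP')
  obtain ⟨b', ib⟩ := hb.exists_isoOn_torus hT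
  refine ⟨fun x => b' (a x), ib.mor_symm.comp ha fun x hx => ha.torus_mem hT hx, fun x hx => ?_⟩
  have : b (φ x) = α x := by rw [hbα _ (i.maps x hx), i.left_inv x hx]
  change b' (a x) = φ x
  rw [haα x hx, ← this, ib.left_inv _ (hφ x hx)]

theorem isFullyNormalised_torus (hT : IsMaximalTorus p T m) : F.IsFullyNormalised p T := by
  intro Q hQ
  obtain ⟨φ, ψ, h⟩ := hQ.exists_isoOn
  have hQ : Q = T := h.eq_of_le hT (hT.le_of_divisible (h.divisible hT.div))
  obtain ⟨r, n, ho⟩ := hT.exists_toralOrder (Subgroup.normalizer (T : Set S))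
  exact ⟨r, n, r, n, hQ ▸ ho, ho, Or.inr ⟨rfl, le_rfl⟩⟩

/-- `Out_F(T)` is finite since `T` is fully normalised, and `Inn(T)` is trivial. -/
theorem finite_torus_automorphisms (hT : IsMaximalTorus p T m) (hF : F.IsSaturated p) :
    {f : T → S | ∃ w, F.Mor T w ∧ ∀ t : T, f t = w t}.Finite := by
  obtain ⟨-, hfin, -⟩ := hF.sylow T (isFullyNormalised_torus hT)
  have hsub : Subsingleton (F.innF T) := by
    refine ⟨fun a b => ?_⟩
    have key : ∀ a : F.innF T, ((a : F.autF T) : MulAut T) = 1 := by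
      rintro ⟨a, x, hx⟩
      change (a : MulAut T) = 1
      rw [← show MulAut.conj x = (a : MulAut T) from hx]
      ext y
      have := hT.comm x x.2 y y.2
      simp [this]
    exact Subtype.ext (Subtype.ext ((key a).trans (key b).symm))
  have : Finite (F.autF T) := by
    have h1 : Finite (F.autF T ⧸ F.innF T) := hfin
    have h2 : Finite (F.innF T) := inferInstance
    exact Finite.of_equiv _ (Subgroup.groupEquivQuotientProdSubgroup (s := F.innF T)).symm
  refine (Set.finite_range fun a : F.autF T => fun t : T => (((a : MulAut T) t : T) : S)).subset ?_
  rintro f ⟨w, hw, hf⟩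
  obtain ⟨w', i⟩ := hw.exists_isoOn_torus hT
  exact ⟨⟨i.toMulEquiv, i.mor.mem_hom _ fun _ => rfl, i.mor_symm.mem_hom _ fun _ => rfl⟩,
    funext fun t => (hf t).symm⟩

theorem hull_le (A : Set S) : F.hull T A ≤ T := fun _ h => h.1

theorem torusHull_le_hull (P : Subgroup S) : F.torusHull p m T P ≤ F.hull T (powers p m P) :=
  divisiblePart_le _

theorem torusHull_le (P : Subgroup S) : F.torusHull p m T P ≤ T :=
  (torusHull_le_hull P).trans (hull_le _)

theorem torusHull_divisible (hT : IsMaximalTorus p T m) (P : Subgroup S) :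
    IsPDivisible p (F.torusHull p m T P) :=
  (hT.divisiblePart_eq (hull_le _)).1

theorem hull_mono {A A' : Set S} (h : A ⊆ A') : F.hull T A ≤ F.hull T A' :=
  fun _ ht => ⟨ht.1, fun w hw hA => ht.2 w hw fun a ha => hA a (h ha)⟩

theorem torusHull_mono {P P' : Subgroup S} (h : P ≤ P') :
    F.torusHull p m T P ≤ F.torusHull p m T P' :=
  divisiblePart_mono (hull_mono fun _ ⟨x, hx, hy⟩ => ⟨x, h hx, hy⟩)

/-- The automorphism `w⁻¹ ∘ v` fixes `A`, hence its hull. -/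
theorem eq_on_hull (hT : IsMaximalTorus p T m) {A : Set S} {v w : S → S} (hv : F.Mor T v)
    (hw : F.Mor T w) (hA : A ⊆ T) (h : ∀ a ∈ A, v a = w a) {t : S} (ht : t ∈ F.hull T A) :
    v t = w t := by
  obtain ⟨w', i⟩ := hw.exists_isoOn_torus hT
  have := ht.2 _ (i.mor_symm.comp hv fun x hx => hv.torus_mem hT hx) fun a ha => by
    rw [h a ha, i.left_inv a (hA ha)]
  rw [← this, i.right_inv _ (hv.torus_mem hT ht.1)]
  exact congrArg v this

theorem powers_subset (hT : IsMaximalTorus p T m) (P : Subgroup S) :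
    powers p m P ⊆ (T : Set S) := by
  rintro _ ⟨x, -, rfl⟩
  exact hT.pow_mem x

theorem powers_subset_self (P : Subgroup S) : powers p m P ⊆ (P : Set S) := by
  rintro _ ⟨x, hx, rfl⟩
  exact pow_mem hx _

theorem conj_mem_powers {P : Subgroup S} {x a : S} (hx : x ∈ P) (ha : a ∈ powers p m P) :
    x * a * x⁻¹ ∈ powers p m P := by
  obtain ⟨y, hy, rfl⟩ := ha
  exact ⟨x * y * x⁻¹, mul_mem (mul_mem hx hy) (inv_mem hx), conj_pow.symm⟩

theorem map_mem_powers {P Q : Subgroup S} {φ : S → S} (h : F.Mor P φ) (hPQ : ∀ x ∈ P, φ x ∈ Q)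
    {a : S} (ha : a ∈ powers p m P) : φ a ∈ powers p m Q := by
  obtain ⟨y, hy, rfl⟩ := ha
  exact ⟨φ y, hPQ y hy, h.map_pow hy _⟩

theorem hull_map (hT : IsMaximalTorus p T m) {A A' : Set S} {w : S → S} (hw : F.Mor T w)
    (hA : A ⊆ T) (h : ∀ a ∈ A, w a ∈ A') {t : S} (ht : t ∈ F.hull T A) : w t ∈ F.hull T A' := by
  refine ⟨hw.torus_mem hT ht.1, fun v hv hv' => ?_⟩
  exact eq_on_hull hT (hv.comp hw fun x hx => hw.torus_mem hT hx) hw hA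
    (fun a ha => hv' _ (h a ha)) ht

theorem torusHull_map (hT : IsMaximalTorus p T m) {P Q : Subgroup S} {w : S → S} (hw : F.Mor T w)
    (h : ∀ a ∈ powers p m P, w a ∈ powers p m Q) {t : S} (ht : t ∈ F.torusHull p m T P) :
    w t ∈ F.torusHull p m T Q := by
  obtain ⟨J, w', i⟩ := (hw.mono (torusHull_le (F := F) (p := p) (m := m) P)).exists_isoOn
  refine le_divisiblePart ?_ (i.divisible (torusHull_divisible hT P)) (i.maps t ht)
  intro y hy
  obtain ⟨x, hx, rfl⟩ := i.mem_image_iff.1 hy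
  exact hull_map hT hw (powers_subset hT P) h (torusHull_le_hull P hx)

theorem conj_mem_torusHull (hT : IsMaximalTorus p T m) {P : Subgroup S} {x t : S} (hx : x ∈ P)
    (ht : t ∈ F.torusHull p m T P) : x * t * x⁻¹ ∈ F.torusHull p m T P :=
  torusHull_map hT (Mor.conj T x) (fun _ ha => conj_mem_powers hx ha) ht

/-- A morphism maps `p ^ m`-th powers to `p ^ m`-th powers, and these lie in `T`; so its restriction
to the subgroup `B` is a morphism inside the torus. -/
theorem exists_torus_mor (hT : IsMaximalTorus p T m) (hF : F.IsSaturated p) {P : Subgroup S}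
    {φ : S → S} (h : F.Mor P φ) : ∃ w, F.Mor T w ∧ ∀ a ∈ powers p m P, w a = φ a := by
  let B : Subgroup S :=
    { carrier := {x | x ∈ P ∧ x ∈ T ∧ φ x ∈ T}
      one_mem' := ⟨one_mem P, one_mem T, h.map_one.symm ▸ one_mem T⟩
      mul_mem' := fun {x y} hx hy => ⟨mul_mem hx.1 hy.1, mul_mem hx.2.1 hy.2.1, by
        rw [h.map_mul hx.1 hy.1]; exact mul_mem hx.2.2 hy.2.2⟩
      inv_mem' := fun {x} hx => ⟨inv_mem hx.1, inv_mem hx.2.1, by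
        rw [h.map_inv hx.1]; exact inv_mem hx.2.2⟩ }
  obtain ⟨w, hw, hwφ⟩ := exists_torus_extension hT hF (h.mono (P' := B) fun x hx => hx.1)
    (fun x hx => hx.2.1) fun x hx => hx.2.2
  refine ⟨w, hw, ?_⟩
  rintro _ ⟨x, hx, rfl⟩
  refine hwφ _ ⟨pow_mem hx _, hT.pow_mem x, ?_⟩
  rw [h.map_pow hx]
  exact hT.pow_mem _

end FusionSystem

/-! ### Extension of morphisms over the torus hull -/

namespace FusionSystem

variable {p : ℕ} [hp : Fact p.Prime] {S : Type u} [Group S] {F : FusionSystem S}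
  {T : Subgroup S} {m : ℕ}

/-- A morphism on `P` agrees on `P ∩ J` with the automorphism of the torus that extends it on
`p ^ m`-th powers, where `J` is the torus hull of `P`. -/
theorem eq_on_torusHull (hT : IsMaximalTorus p T m) (hF : F.IsSaturated p) {P : Subgroup S}
    {φ w : S → S} (hφ : F.Mor P φ) (hw : F.Mor T w) (hA : ∀ a ∈ powers p m P, w a = φ a) {y : S}
    (hyP : y ∈ P) (hyJ : y ∈ F.torusHull p m T P) : φ y = w y := by
  have hAT := powers_subset hT P
  have hAB : ∀ a ∈ powers p m P, a ∈ P ⊓ T := fun a ha => ⟨powers_subset_self P ha, hAT ha⟩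
  -- The powers do not generate `P ⊓ J`, so agreement there needs proof. The image `C` of `P ⊓ T` is
  -- carried to a fully centralised `B'`: by `c`, defined on `C` and its centralizer, and, after
  -- `φ`, by `w₁` on all of `T`. It suffices that `c ∘ w = w₁` on `J`, since `c` is injective.
  obtain ⟨C, φ', iB⟩ := (hφ.mono (inf_le_left : P ⊓ T ≤ P)).exists_isoOn
  obtain ⟨B', χ, χ', iC, hB'⟩ := exists_fullyCentralised (F := F) hT C
  obtain ⟨w₁, hw₁, hw₁B⟩ := hF.exists_extension_centralizer (iB.trans iC) hB'
  replace hw₁ := hw₁.mono (le_centralizer_of_le_torus hT inf_le_right)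
  obtain ⟨c, hc, hcC⟩ := hF.exists_extension_centralizer iC hB'
  obtain ⟨w', iw⟩ := hw.exists_isoOn_torus hT
  have hcent : ∀ t ∈ F.torusHull p m T P, w t ∈ C ⊔ Subgroup.centralizer (C : Set S) := by
    intro t ht
    refine (le_sup_right : Subgroup.centralizer (C : Set S) ≤ _) ?_
    refine Subgroup.mem_centralizer_iff.2 fun y hy => ?_
    obtain ⟨b, hb, rfl⟩ := iB.mem_image_iff.1 hy
    -- Conjugation by `φ b` after `w` agrees with `w` on the powers, as `b ∈ T` commutes with them;
    -- hence on the hull.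
    have h1 : φ b * w t * (φ b)⁻¹ = w t := by
      refine eq_on_hull hT ((Mor.conj T (φ b)).comp hw fun x hx => hw.torus_mem hT hx) hw hAT
        (fun a ha => ?_) (torusHull_le_hull P ht)
      rw [hA a ha, ← hφ.map_conj hb.1 (hAB a ha).1, hT.comm b hb.2 a (hAT ha), mul_inv_cancel_right]
    exact mul_inv_eq_iff_eq_mul.1 h1
  let L : Subgroup S :=
    { carrier := {z | z ∈ T ∧ w z ∈ C ⊔ Subgroup.centralizer (C : Set S) ∧ c (w z) ∈ T}
      one_mem' := ⟨one_mem T, by rw [hw.map_one]; exact one_mem _, by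
        rw [hw.map_one, hc.map_one]; exact one_mem _⟩
      mul_mem' := fun {x y} hx hy => ⟨mul_mem hx.1 hy.1, by
        rw [hw.map_mul hx.1 hy.1]; exact mul_mem hx.2.1 hy.2.1, by
        rw [hw.map_mul hx.1 hy.1, hc.map_mul hx.2.1 hy.2.1]; exact mul_mem hx.2.2 hy.2.2⟩
      inv_mem' := fun {x} hx => ⟨inv_mem hx.1, by
        rw [hw.map_inv hx.1]; exact inv_mem hx.2.1, by
        rw [hw.map_inv hx.1, hc.map_inv hx.2.1]; exact inv_mem hx.2.2⟩ }
  -- Divisibility of the hull forces its image under `c ∘ w` into `T`, so `c ∘ w` extends to an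
  -- automorphism `w₂` of `T`.
  have hJL : F.torusHull p m T P ≤ L := fun t ht => by
    refine ⟨torusHull_le P ht, hcent t ht, ?_⟩
    obtain ⟨s, hs, rfl⟩ := (torusHull_divisible hT P).exists_pow m t ht
    rw [hw.map_pow (torusHull_le P hs), hc.map_pow (hcent s hs)]
    exact hT.pow_mem _
  have hcw : ∀ a ∈ powers p m P, c (w a) = w₁ a := fun a ha => by
    rw [hA a ha, hcC _ (iB.maps a (hAB a ha)), hw₁B a (hAB a ha)]
  obtain ⟨w₂, hw₂, hw₂L⟩ := exists_torus_extension hT hF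
    (hc.comp (hw.mono fun z (hz : z ∈ L) => hz.1) fun z hz => hz.2.1) (fun z hz => hz.1)
    fun z hz => hz.2.2
  have h12 : w₂ y = w₁ y := eq_on_hull hT hw₂ hw₁ hAT (fun a ha => by
    rw [hw₂L a ⟨hAT ha, ?_, ?_⟩, hcw a ha]
    · rw [hA a ha]
      exact (le_sup_left : C ≤ _) (iB.maps a (hAB a ha))
    · rw [hcw a ha]
      exact hw₁.torus_mem hT (hAT ha)) (torusHull_le_hull P hyJ)
  have hyB : y ∈ P ⊓ T := ⟨hyP, torusHull_le P hyJ⟩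
  refine hc.injOn ((le_sup_left : C ≤ _) (iB.maps y hyB)) (hcent y hyJ) ?_
  rw [hcC _ (iB.maps y hyB), ← hw₂L y (hJL hyJ), h12, hw₁B y hyB]

theorem torus_equivariant (hT : IsMaximalTorus p T m) {P : Subgroup S}
    {φ w : S → S} (hφ : F.Mor P φ) (hw : F.Mor T w) (hA : ∀ a ∈ powers p m P, w a = φ a) {x t : S}
    (hx : x ∈ P) (ht : t ∈ F.hull T (powers p m P)) :
    w (x * t * x⁻¹) = φ x * w t * (φ x)⁻¹ := by
  refine eq_on_hull hT (hw.comp (Mor.conj T x) fun s hs => hT.conj_mem hs)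
    ((Mor.conj T (φ x)).comp hw fun s hs => hw.torus_mem hT hs) (powers_subset hT P)
    (fun a ha => ?_) ht
  rw [hA _ (conj_mem_powers hx ha), hA a ha, hφ.map_conj hx (powers_subset_self P ha)]

theorem map_conj_torusHull (hT : IsMaximalTorus p T m) (hF : F.IsSaturated p) {P : Subgroup S}
    {φ w : S → S} (hφ : F.Mor P φ) (hw : F.Mor T w) (hA : ∀ a ∈ powers p m P, w a = φ a) {x t : S}
    (hx : x ∈ P) (ht : t ∈ F.torusHull p m T P) (htP : t ∈ Subgroup.normalizer (P : Set S)) :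
    φ (t * x * t⁻¹) = w t * φ x * (w t)⁻¹ := by
  have hJ := conj_mem_torusHull hT hx (inv_mem ht)
  have hu : t * (x * t⁻¹ * x⁻¹) ∈ P := by
    have := mul_mem ((Subgroup.mem_normalizer_iff.1 htP x).1 hx) (inv_mem hx)
    simpa [mul_assoc] using this
  -- The commutator `t * (x * t⁻¹ * x⁻¹)` lies in `P` and in the hull, where `φ` and `w` agree.
  have heq : t * x * t⁻¹ = t * (x * t⁻¹ * x⁻¹) * x := by group
  rw [heq, hφ.map_mul hu hx, eq_on_torusHull hT hF hφ hw hA hu (mul_mem ht hJ),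
    hw.map_mul (torusHull_le P ht) (torusHull_le P hJ),
    torus_equivariant hT hφ hw hA hx (inv_mem (torusHull_le_hull P ht)),
    hw.map_inv (torusHull_le P ht)]
  group

/-- The elements of the torus hull of `P` that normalize `P`. -/
def hullNormalizer (F : FusionSystem S) (p m : ℕ) (T P : Subgroup S) : Subgroup S :=
  F.torusHull p m T P ⊓ Subgroup.normalizer (P : Set S)

theorem exists_mul_of_mem_sup_hullNormalizer (hT : IsMaximalTorus p T m) {P : Subgroup S} {z : S}
    (hz : z ∈ P ⊔ F.hullNormalizer p m T P) :
    ∃ x ∈ P, ∃ t ∈ F.hullNormalizer p m T P, x * t = z :=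
  exists_mul_of_mem_sup_normalizes (J := F.hullNormalizer p m T P)
    (fun _ hx _ ht => ⟨conj_mem_torusHull hT hx ht.1, Subgroup.mul_mem _
      (Subgroup.mul_mem _ (Subgroup.le_normalizer hx) ht.2)
      (Subgroup.inv_mem _ (Subgroup.le_normalizer hx))⟩) hz

/-- For `x ∈ P` and `t` in the hull normalizing `P`, the map `φ` carries conjugation by `x * t` to
conjugation by `φ x * w t`, so the extension axiom applies. -/
theorem exists_extension_hullNormalizer_of_fullyCentralised (hT : IsMaximalTorus p T m)
    (hF : F.IsSaturated p) {P Q : Subgroup S} {φ ψ : S → S} (h : F.IsoOn P Q φ ψ)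
    (hQ : F.IsFullyCentralised p Q) :
    ∃ φ', F.Mor (P ⊔ F.hullNormalizer p m T P) φ' ∧ ∀ x ∈ P, φ' x = φ x := by
  obtain ⟨w, hw, hA⟩ := exists_torus_mor hT hF h.mor
  obtain ⟨φ', h1, h2⟩ := hF.exists_extension (N := P ⊔ F.hullNormalizer p m T P) h hQ
    fun g hg => by
      refine ⟨(sup_le Subgroup.le_normalizer inf_le_right : P ⊔ F.hullNormalizer p m T P ≤ _) hg,
          ?_⟩
      obtain ⟨x, hx, t, ht, rfl⟩ := exists_mul_of_mem_sup_hullNormalizer hT hg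
      refine ⟨φ x * w t, fun y hy => ?_⟩
      have hy' := (Subgroup.mem_normalizer_iff.1 ht.2 y).1 hy
      rw [show x * t * y * (x * t)⁻¹ = x * (t * y * t⁻¹) * x⁻¹ by group, h.mor.map_conj hx hy',
        map_conj_torusHull hT hF h.mor hw hA hy ht.1 ht.2]
      group
  exact ⟨φ', h1, fun x hx => h2 x hx (le_sup_left (a := P) hx)⟩

/-- Both `P` and its image `Q` are mapped to a fully centralised `R`. The extensions `a` and `c`
satisfy `a (x * t) = c (φ x * w t)`, so `c⁻¹ ∘ a` is defined and extends `φ`. -/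
theorem exists_extension_hullNormalizer (hT : IsMaximalTorus p T m)
    (hF : F.IsSaturated p) {P : Subgroup S} {φ : S → S} (hφ : F.Mor P φ) :
    ∃ φ', F.Mor (P ⊔ F.hullNormalizer p m T P) φ' ∧ ∀ x ∈ P, φ' x = φ x := by
  obtain ⟨Q, ψ, i⟩ := hφ.exists_isoOn
  obtain ⟨R, χ, χ', iR, hR⟩ := exists_fullyCentralised (F := F) hT Q
  obtain ⟨a, ha, haP⟩ := exists_extension_hullNormalizer_of_fullyCentralised hT hF (i.trans iR) hR
  obtain ⟨c, hc, hcQ⟩ := exists_extension_hullNormalizer_of_fullyCentralised hT hF iR hR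
  obtain ⟨w, hw, hA⟩ := exists_torus_mor hT hF hφ
  obtain ⟨v, hv, hvc⟩ := exists_torus_mor hT hF hc
  obtain ⟨v', hv', hva⟩ := exists_torus_mor hT hF ha
  have hPle : P ≤ P ⊔ F.hullNormalizer p m T P := le_sup_left
  have hQle : Q ≤ Q ⊔ F.hullNormalizer p m T Q := le_sup_left
  have hAm : ∀ a ∈ powers p m P, φ a ∈ powers p m Q := fun a ha => map_mem_powers hφ i.maps ha
  have pm : ∀ {X Y : Subgroup S} {a : S}, X ≤ Y → a ∈ powers p m X → a ∈ powers p m Y :=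
    fun hXY ⟨x, hx, h⟩ => ⟨x, hXY hx, h⟩
  have hwt : ∀ t ∈ F.hullNormalizer p m T P, w t ∈ F.hullNormalizer p m T Q := fun t ht =>
    ⟨torusHull_map hT hw (fun a ha => (hA a ha).symm ▸ hAm a ha) ht.1,
      i.mem_normalizer ht.2 fun x hx => map_conj_torusHull hT hF hφ hw hA hx ht.1 ht.2⟩
  -- On the hull both sides are automorphisms of `T`, and these agree on the powers of `P`.
  have hca : ∀ t ∈ F.hullNormalizer p m T P, c (w t) = a t := by
    intro t ht
    rw [eq_on_torusHull hT hF hc hv hvc ((le_sup_right (a := Q)) (hwt t ht))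
        (torusHull_mono hQle (hwt t ht).1),
      eq_on_torusHull hT hF ha hv' hva ((le_sup_right (a := P)) ht) (torusHull_mono hPle ht.1)]
    refine eq_on_hull hT (hv.comp hw fun x hx => hw.torus_mem hT hx) hv' (powers_subset hT P)
      (fun b hb => ?_) (torusHull_le_hull P ht.1)
    rw [hA b hb, hvc _ (pm hQle (hAm b hb)), hva b (pm hPle hb),
      hcQ _ (powers_subset_self Q (hAm b hb)), haP b (powers_subset_self P hb)]
  obtain ⟨Z, ζ, iZ⟩ := hc.exists_isoOn
  refine ⟨fun z => ζ (a z), iZ.mor_symm.comp ha fun z hz => ?_, fun x hx => ?_⟩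
  · obtain ⟨x, hx, t, ht, rfl⟩ := exists_mul_of_mem_sup_hullNormalizer hT hz
    refine iZ.mem_image_iff.2 ⟨φ x * w t, mul_mem (hQle (i.maps x hx))
      ((le_sup_right (a := Q)) (hwt t ht)), ?_⟩
    rw [hc.map_mul (hQle (i.maps x hx)) ((le_sup_right (a := Q)) (hwt t ht)), hca t ht,
      ha.map_mul (hPle hx) ((le_sup_right (a := P)) ht), hcQ _ (i.maps x hx), haP x hx]
  · change ζ (a x) = φ x
    rw [haP x hx, ← hcQ _ (i.maps x hx), iZ.left_inv _ (hQle (i.maps x hx))]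

/-- The elements of order dividing `p ^ i` in the torus hull of `P`. -/
def hullTorsion (F : FusionSystem S) (hT : IsMaximalTorus p T m) (P : Subgroup S) (i : ℕ) :
    Subgroup S :=
  torsionSubgroup (F.torusHull p m T P)
    (fun x hx y hy => hT.comm x (torusHull_le P hx) y (torusHull_le P hy)) (p ^ i)

theorem conj_mem_hullTorsion (hT : IsMaximalTorus p T m) {P : Subgroup S} {x t : S} {i : ℕ}
    (hx : x ∈ P) (ht : t ∈ F.hullTorsion hT P i) : x * t * x⁻¹ ∈ F.hullTorsion hT P i :=
  ⟨conj_mem_torusHull hT hx ht.1, by rw [conj_pow, ht.2]; simp⟩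

theorem finite_hullTorsion (hT : IsMaximalTorus p T m) (P : Subgroup S) (i : ℕ) :
    (F.hullTorsion hT P i : Set S).Finite :=
  (hT.finite_torsion i).subset fun _ hx => ⟨torusHull_le P hx.1, hx.2⟩

theorem finite_subgroups_le {X : Subgroup S} (hX : (X : Set S).Finite) :
    {Y : Subgroup S | Y ≤ X}.Finite := by
  refine Set.Finite.of_finite_image (f := fun H : Subgroup S => (H : Set S))
    (hX.finite_subsets.subset ?_) SetLike.coe_injective.injOn
  rintro _ ⟨Y, hY, rfl⟩
  exact hY

/-- Take a maximal subgroup `X` of the finite torsion group with an extension to `P ⊔ X`. If `P ⊔ X`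
misses part of that group, some missing element normalizes it, and the previous extension
contradicts maximality. -/
theorem exists_extension_hullTorsion (hT : IsMaximalTorus p T m)
    (hF : F.IsSaturated p) {P : Subgroup S} {φ : S → S} (hφ : F.Mor P φ) (i : ℕ) :
    ∃ φ', F.Mor (P ⊔ F.hullTorsion hT P i) φ' ∧ ∀ x ∈ P, φ' x = φ x := by
  let Ji := F.hullTorsion hT P i
  have hfin : {X : Subgroup S | X ≤ Ji ∧ ∃ φ', F.Mor (P ⊔ X) φ' ∧ ∀ x ∈ P, φ' x = φ x}.Finite :=
    (finite_subgroups_le (finite_hullTorsion hT P i)).subset fun X hX => hX.1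
  obtain ⟨X, ⟨hX, φ', hφ', hP'⟩, hmax⟩ := hfin.exists_maximal
    ⟨⊥, bot_le, φ, by rwa [sup_bot_eq], fun _ _ => rfl⟩
  suffices hle : Ji ≤ P ⊔ X from ⟨φ', hφ'.mono (sup_le le_sup_left hle), hP'⟩
  by_contra hne
  have hnorm : P ⊔ X ≤ Subgroup.normalizer (Ji : Set S) := by
    refine sup_le (fun x hx => ?_) (hX.trans Subgroup.le_normalizer)
    refine hT.mem_normalizer_of_conj_mem fun t ht => ?_
    simpa using conj_mem_hullTorsion hT (inv_mem hx) ht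
  obtain ⟨t, htJ, htP, htN⟩ := hT.exists_mem_normalizer_of_finite (P := P ⊔ X)
    (finite_hullTorsion hT P i)
    (fun x hx t ht => (Subgroup.mem_normalizer_iff.1 (hnorm hx) t).1 ht) hne
  obtain ⟨φ'', hφ'', hP''⟩ := exists_extension_hullNormalizer hT hF hφ'
  have ht : t ∈ F.hullNormalizer p m T (P ⊔ X) := ⟨torusHull_mono le_sup_left htJ.1, htN⟩
  have hmem := hmax (y := X ⊔ Subgroup.zpowers t)
    ⟨sup_le hX (Subgroup.zpowers_le.2 htJ), φ'', hφ''.mono ?_, fun x hx => ?_⟩ le_sup_left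
  · exact htP (le_sup_right (a := P) (hmem (le_sup_right (a := X) (Subgroup.mem_zpowers t))))
  · exact sup_le (le_sup_left.trans le_sup_left) (sup_le (le_sup_right.trans le_sup_left)
      (Subgroup.zpowers_le.2 (le_sup_right (a := P ⊔ X) ht)))
  · rw [hP'' x (le_sup_left (a := P) hx), hP' x hx]

/-- Every morphism on `P` extends over the torus hull of `P`. -/
theorem exists_extension_torusHull (hT : IsMaximalTorus p T m)
    (hF : F.IsSaturated p) {P : Subgroup S} {φ : S → S} (hφ : F.Mor P φ) :
    ∃ φ', F.Mor (P ⊔ F.torusHull p m T P) φ' ∧ ∀ x ∈ P, φ' x = φ x := by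
  classical
  choose f hf hfP using fun i => exists_extension_hullTorsion hT hF hφ i
  obtain ⟨w, hw, hA⟩ := exists_torus_mor hT hF hφ
  let X (i : ℕ) : Subgroup S := P ⊔ F.hullTorsion hT P i
  have hmonoJ : Monotone fun i => F.hullTorsion hT P i := fun i j hij t ht => ⟨ht.1, by
    rw [← Nat.sub_add_cancel hij, pow_add, mul_comm, pow_mul, ht.2, one_pow]⟩
  have hmono : Monotone X := fun i j hij => sup_le_sup_left (hmonoJ hij) P
  have hPX : ∀ i, P ≤ X i := fun i => le_sup_left
  -- Extensions of `φ` are forced on the hull: they all equal `w` there. So they are compatible and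
  -- glue by the union axiom.
  have hval : ∀ i, ∀ t ∈ F.hullTorsion hT P i, f i t = w t := fun i t ht => by
    obtain ⟨v, hv, hvf⟩ := exists_torus_mor hT hF (hf i)
    rw [eq_on_torusHull hT hF (hf i) hv hvf (le_sup_right (a := P) ht)
      (torusHull_mono le_sup_left ht.1)]
    refine eq_on_hull hT hv hw (powers_subset hT P) (fun a ha => ?_) (torusHull_le_hull P ht.1)
    have haX : a ∈ powers p m (P ⊔ F.hullTorsion hT P i) := by
      obtain ⟨x, hx, rfl⟩ := ha
      exact ⟨x, hPX i hx, rfl⟩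
    rw [hvf a haX, hfP i a (powers_subset_self P ha), hA a ha]
  have hcompat : ∀ i j, i ≤ j → ∀ z ∈ X i, f j z = f i z := fun i j hij z hz => by
    obtain ⟨x, hx, t, ht, rfl⟩ := exists_mul_of_mem_sup_normalizes
      (fun x hx t ht => conj_mem_hullTorsion hT hx ht) hz
    rw [(hf j).map_mul (hPX j hx) (le_sup_right (a := P) (hmonoJ hij ht)),
      (hf i).map_mul (hPX i hx) (le_sup_right (a := P) ht), hval i t ht,
      hval j t (hmonoJ hij ht), hfP i x hx, hfP j x hx]
  let Φ : S → S := fun z => if h : ∃ i, z ∈ X i then f (Nat.find h) z else 1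
  have hΦ : ∀ i, ∀ z ∈ X i, Φ z = f i z := fun i z hz => by
    have h : ∃ i, z ∈ X i := ⟨i, hz⟩
    simp only [Φ, dif_pos h]
    exact (hcompat _ _ (Nat.find_min' h hz) z (Nat.find_spec h)).symm
  refine ⟨Φ, (hF.mor_iSup hmono fun i => (hf i).congr (hΦ i)).mono ?_, fun x hx => ?_⟩
  · refine sup_le ((hPX 0).trans (le_iSup X 0)) fun t ht => ?_
    obtain ⟨k, hk⟩ := hT.tors t (torusHull_le P ht)
    exact le_iSup X k (le_sup_right (a := P) ⟨ht, hk⟩)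
  · rw [hΦ 0 x (hPX 0 hx), hfP 0 x hx]

/-! ### Finiteness for hull-closed subgroups. -/

/-- `P` contains its torus hull. -/
def IsHullClosed (F : FusionSystem S) (p m : ℕ) (T P : Subgroup S) : Prop :=
  F.torusHull p m T P ≤ P

theorem exists_mul_pow {P J : Subgroup S} (h : ∀ x ∈ P, ∀ t ∈ J, x * t * x⁻¹ ∈ J) {x t : S}
    (hx : x ∈ P) (ht : t ∈ J) (n : ℕ) : ∃ u ∈ J, (x * t) ^ n = x ^ n * u := by
  induction n with
  | zero => exact ⟨1, one_mem J, by simp⟩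
  | succ n ih =>
    obtain ⟨u, hu, hun⟩ := ih
    refine ⟨x⁻¹ * u * x * t, mul_mem ?_ ht, ?_⟩
    · simpa using h x⁻¹ (inv_mem hx) u hu
    · rw [pow_succ, hun, pow_succ]
      group

/-- A `p ^ m`-th power in the enlarged group is one in `P` times an element of the hull, so
automorphisms that fix the powers of `P` fix it and the hull does not grow. -/
theorem isHullClosed_sup_torusHull (hT : IsMaximalTorus p T m) (P : Subgroup S) :
    F.IsHullClosed p m T (P ⊔ F.torusHull p m T P) := by
  refine le_trans (divisiblePart_mono (p := p) fun t ht => ?_) (le_sup_right (a := P))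
  refine ⟨ht.1, fun w hw hA => ht.2 w hw ?_⟩
  rintro _ ⟨z, hz, rfl⟩
  obtain ⟨x, hx, s, hs, rfl⟩ := exists_mul_of_mem_sup_normalizes
    (fun x hx t ht => conj_mem_torusHull hT hx ht) hz
  obtain ⟨u, hu, hun⟩ := exists_mul_pow (fun x hx t ht => conj_mem_torusHull hT hx ht) hx hs (p ^ m)
  rw [hun, hw.map_mul (hT.pow_mem x) (torusHull_le P hu), hA _ ⟨x, hx, rfl⟩,
    (torusHull_le_hull P hu).2 w hw hA]

/-- The torus automorphisms extending the isomorphism on powers match the hulls of `P` and `Q`; on a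
hull contained in `P` they coincide with the isomorphism itself. -/
theorem IsoOn.isHullClosed (hT : IsMaximalTorus p T m) (hF : F.IsSaturated p) {P Q : Subgroup S}
    {φ ψ : S → S} (i : F.IsoOn P Q φ ψ) (hP : F.IsHullClosed p m T P) :
    F.IsHullClosed p m T Q := by
  intro t ht
  obtain ⟨w, hw, hA⟩ := exists_torus_mor hT hF i.mor
  obtain ⟨w', hw', hA'⟩ := exists_torus_mor hT hF i.mor_symm
  have hm : ∀ a ∈ powers p m Q, ψ a ∈ powers p m P := fun a ha =>
    map_mem_powers i.mor_symm i.maps_symm ha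
  have hs : w' t ∈ F.torusHull p m T P :=
    torusHull_map hT hw' (fun a ha => (hA' a ha).symm ▸ hm a ha) ht
  have hww : w (w' t) = t := by
    refine eq_on_hull hT (hw.comp hw' fun x hx => hw'.torus_mem hT hx) (Mor.id T)
      (powers_subset hT Q) (fun a ha => ?_) (torusHull_le_hull Q ht)
    rw [hA' a ha, hA _ (hm a ha), i.right_inv a (powers_subset_self Q ha)]
  rw [← hww, ← eq_on_torusHull hT hF i.mor hw hA (hP hs) hs]
  exact i.maps _ (hP hs)

/-- A hull is the fixed subgroup of a set of automorphisms of `T` in `F`, and there are finitely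
many of these. -/
theorem finite_hulls (hT : IsMaximalTorus p T m) (hF : F.IsSaturated p) :
    (Set.range fun A : Set S => F.hull T A).Finite := by
  have hfin := finite_torus_automorphisms hT hF
  refine Set.Finite.of_finite_image (f := fun H : Subgroup S => (H : Set S))
    ((hfin.finite_subsets.image fun U => {t : S | ∃ ht : t ∈ T, ∀ f ∈ U, f ⟨t, ht⟩ = t}).subset ?_)
    SetLike.coe_injective.injOn
  rintro _ ⟨_, ⟨A, rfl⟩, rfl⟩
  refine ⟨{f : T → S | ∃ w, F.Mor T w ∧ (∀ t : T, f t = w t) ∧ ∀ a ∈ A, w a = a},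
    fun f ⟨w, h1, h2, _⟩ => ⟨w, h1, h2⟩, ?_⟩
  ext t
  constructor
  · rintro ⟨ht, h⟩
    exact ⟨ht, fun w hw hA => h (fun t => w t) ⟨w, hw, fun _ => rfl, hA⟩⟩
  · rintro ⟨ht, h⟩
    refine ⟨ht, ?_⟩
    rintro f ⟨w, hw, hf, hA⟩
    rw [hf]
    exact h w hw hA

/-- For a given hull with divisible part `J`, a closed `P` contains `J`, and `p ^ (m + K)` maps `P ⊓
T` into `J`. So `P ⊓ T` is `J` times a subset of the finite group `T[p ^ (m + K)]`. -/
theorem finite_closed_inf (hT : IsMaximalTorus p T m) (hF : F.IsSaturated p) :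
    ((fun P => P ⊓ T) '' {P : Subgroup S | F.IsHullClosed p m T P}).Finite := by
  have key : ∀ I ∈ Set.range fun A : Set S => F.hull T A,
      ((fun P => P ⊓ T) '' {P : Subgroup S | F.IsHullClosed p m T P ∧
        F.hull T (powers p m P) = I}).Finite := by
    rintro _ ⟨A, rfl⟩
    obtain ⟨hdiv, K, hK⟩ := hT.divisiblePart_eq (hull_le (F := F) A)
    let J := divisiblePart p (F.hull T A)
    refine Set.Finite.of_finite_image (f := fun H : Subgroup S => (H : Set S))
      (((hT.finite_torsion (m + K)).finite_subsets.image fun U =>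
        {x : S | ∃ d ∈ J, ∃ t ∈ U, d * t = x}).subset ?_) SetLike.coe_injective.injOn
    rintro _ ⟨_, ⟨P, ⟨hP, hPA⟩, rfl⟩, rfl⟩
    change F.hull T (powers p m P) = F.hull T A at hPA
    have hJP : J ≤ P := by
      have := hP
      rwa [IsHullClosed, torusHull, hPA] at this
    have hJT : J ≤ T := (divisiblePart_le _).trans (hull_le A)
    refine ⟨{t | t ∈ P ∧ t ∈ T ∧ t ^ p ^ (m + K) = 1}, fun t ht => ht.2, ?_⟩
    ext x
    constructor
    · rintro ⟨d, hd, t, ht, rfl⟩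
      exact ⟨mul_mem (hJP hd) ht.1, mul_mem (hJT hd) ht.2.1⟩
    · rintro ⟨hxP, hxT⟩
      have hxI : x ^ p ^ m ∈ F.hull T A := by
        rw [← hPA]
        exact ⟨hT.pow_mem x, fun w _ h => h _ ⟨x, hxP, rfl⟩⟩
      have hxJ : x ^ p ^ (m + K) ∈ J := by
        rw [pow_add, pow_mul]
        exact hK _ hxI
      obtain ⟨d, hd, t, ht, hdt⟩ := hT.exists_mul_torsion hJT hdiv hxT hxJ
      refine ⟨d, hd, t, ⟨?_, ht⟩, hdt⟩
      have : t = d⁻¹ * x := by rw [← hdt]; group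
      exact this ▸ mul_mem (inv_mem (hJP hd)) hxP
  refine ((finite_hulls hT hF).biUnion key).subset ?_
  rintro _ ⟨P, hP, rfl⟩
  exact Set.mem_biUnion ⟨powers p m P, rfl⟩ ⟨P, ⟨hP, rfl⟩, rfl⟩

theorem exists_fullyNormalised (hT : IsMaximalTorus p T m) (hF : F.IsSaturated p) {P : Subgroup S}
    (hP : F.IsHullClosed p m T P) : ∃ Q φ ψ, F.IsoOn P Q φ ψ ∧ F.IsFullyNormalised p Q := by
  obtain ⟨Q, hQ, hmax⟩ := hT.exists_max_order (X := {Q | F.Conj P Q}) ⟨P, Conj.refl P⟩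
    (N := fun Q => Subgroup.normalizer (Q : Set S))
    ((hT.finite_normalizer_inf (finite_closed_inf hT hF)).subset (Set.image_mono fun Q hQ => by
      obtain ⟨φ, ψ, i⟩ := Conj.exists_isoOn hQ
      exact i.isHullClosed hT hF hP))
  obtain ⟨φ, ψ, h⟩ := Conj.exists_isoOn hQ
  exact ⟨Q, φ, ψ, h, fun Q' hQ' => hmax Q' (Conj.trans hQ hQ')⟩

end FusionSystem

/-! ### Generation of a saturated fusion system by automorphism groups -/

section FinitePGroup

variable {p : ℕ} [hp : Fact p.Prime]

theorem isDiscretePToral_of_finite {P : Type u} [Group P] [Finite P] (hP : IsPGroup p P) :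
    IsDiscretePToral p P := by
  obtain ⟨n, hn⟩ := hP.exists_card_eq
  let e : (⊥ : Subgroup P) ≃* (Fin 0 → PruferGroup p) :=
    { toFun := fun _ => 1
      invFun := fun _ => 1
      left_inv := fun _ => Subsingleton.elim _ _
      right_inv := fun _ => Subsingleton.elim _ _
      map_mul' := fun _ _ => Subsingleton.elim _ _ }
  exact ⟨0, n, ⊥, inferInstance, ⟨e⟩, by rw [Subgroup.index_bot, hn]⟩

theorem IsDiscretePToral.isPGroup {P : Type u} [Group P] (hP : IsDiscretePToral p P) :
    IsPGroup p P := by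
  obtain ⟨T, m, hT⟩ := hP.exists_maximalTorus
  exact fun x => hT.exists_pow_eq_one x

theorem IsSylowSubgroup.exists_conj {G : Type u} [Group G] [Finite G] {H Q : Subgroup G}
    (hH : IsSylowSubgroup p H) (hQ : IsPGroup p Q) : ∃ g : G, ∀ x ∈ Q, g * x * g⁻¹ ∈ H :=
  hH.2 Q (isDiscretePToral_of_finite hQ)

theorem IsSylowSubgroup.normal_le {G : Type u} [Group G] [Finite G] {H N : Subgroup G}
    (hH : IsSylowSubgroup p H) (hN : N.Normal) (hNp : IsPGroup p N) : N ≤ H := by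
  obtain ⟨g, hg⟩ := hH.exists_conj hNp
  intro x hx
  have := hg (g⁻¹ * x * g) (by simpa using hN.conj_mem x hx g⁻¹)
  simpa [mul_assoc] using this

end FinitePGroup

namespace FusionSystem

variable {p : ℕ} [hp : Fact p.Prime] {S : Type u} [Group S] {F : FusionSystem S}
  {T : Subgroup S} {m : ℕ}

theorem autF_isoOn {R : Subgroup S} (a : F.autF R) : ∃ α α', F.IsoOn R R α α' ∧
    (∀ x : R, α x = (a : MulAut R) x) ∧ ∀ x : R, α' x = (a : MulAut R).symm x := by
  obtain ⟨α, hα, h1⟩ := exists_mor_of_mem_hom a.2.1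
  obtain ⟨α', hα', h2⟩ := exists_mor_of_mem_hom a.2.2
  have h1' : ∀ x : R, α x = (a : MulAut R) x := h1
  have h2' : ∀ x : R, α' x = (a : MulAut R).symm x := h2
  refine ⟨α, α', ⟨hα, hα', fun x hx => ?_, fun x hx => ?_, fun x hx => ?_, fun x hx => ?_⟩, h1',
      h2'⟩
  · rw [h1' ⟨x, hx⟩]; exact ((a : MulAut R) ⟨x, hx⟩).2
  · rw [h2' ⟨x, hx⟩]; exact ((a : MulAut R).symm ⟨x, hx⟩).2
  · rw [h1' ⟨x, hx⟩, h2', MulEquiv.symm_apply_apply]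
  · rw [h2' ⟨x, hx⟩, h1', MulEquiv.apply_symm_apply]

/-- The element of `Aut_F(R)` given by an automorphism of `R` in `F`. -/
def IsoOn.toAutF {R : Subgroup S} {α α' : S → S} (h : F.IsoOn R R α α') : F.autF R :=
  ⟨h.toMulEquiv, h.mor.mem_hom _ fun _ => rfl, h.mor_symm.mem_hom _ fun _ => rfl⟩

theorem mk_mem_outS_iff {R : Subgroup S} (a : F.autF R) :
    (a : F.outF R) ∈ F.outS R ↔ ∃ s ∈ Subgroup.normalizer (R : Set S),
      ∀ x : R, (((a : MulAut R) x : R) : S) = s * x * s⁻¹ := by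
  constructor
  · rintro ⟨b, ⟨h, hh⟩, hab⟩
    obtain ⟨y, hy⟩ : b⁻¹ * a ∈ F.innF R := QuotientGroup.eq.1 hab
    refine ⟨h * y, mul_mem h.2 (Subgroup.le_normalizer y.2), fun x => ?_⟩
    have ha : (a : MulAut R) = (b : MulAut R) * MulAut.conj y := by
      rw [show MulAut.conj y = ((b⁻¹ * a : F.autF R) : MulAut R) from hy]
      simp
    rw [ha, ← show R.normalizerMonoidHom h = (b : MulAut R) from hh]
    simp [mul_assoc]
  · rintro ⟨s, hs, h⟩
    refine ⟨a, ⟨⟨s, hs⟩, ?_⟩, rfl⟩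
    ext x
    rw [Subgroup.normalizerMonoidHom_apply_apply_coe]
    exact (h x).symm

/-- Transported by `φ`, the group `N_S(P)` acts on `R` through a `p`-subgroup of the finite group
`Out_F(R)`. By Sylow some `β ∈ Aut_F(R)` conjugates it into `Out_S(R)`, and then `β ∘ φ` meets the
extension condition on all of `N_S(P)`. -/
theorem exists_normalizer_extension (hT : IsMaximalTorus p T m) (hF : F.IsSaturated p)
    {P R : Subgroup S} {φ ψ : S → S} (i : F.IsoOn P R φ ψ) (hR : F.IsFullyNormalised p R) :
    ∃ χ χ', F.Mor (Subgroup.normalizer (P : Set S)) χ ∧ F.IsoOn P R χ χ' := by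
  obtain ⟨hfc, hfin, hsyl⟩ := hF.sylow R hR
  let κ₀ : Subgroup.normalizer (P : Set S) →* MulAut R :=
    (MulAut.congr i.toMulEquiv).toMonoidHom.comp P.normalizerMonoidHom
  have hκ₀ : ∀ g : Subgroup.normalizer (P : Set S), ∀ x : R,
      ((κ₀ g x : R) : S) = φ (g * ψ x * (g : S)⁻¹) := fun g x => rfl
  have hconj : ∀ g ∈ Subgroup.normalizer (P : Set S), F.Mor R fun x => φ (g * ψ x * g⁻¹) :=
    fun g hg => i.mor.comp ((Mor.conj P g).comp i.mor_symm i.maps_symm) fun x hx =>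
      (Subgroup.mem_normalizer_iff.1 hg _).1 (i.maps_symm x hx)
  have hmem : ∀ g, κ₀ g ∈ F.autF R := fun g =>
    ⟨(hconj g g.2).mem_hom _ fun x => (hκ₀ g x).symm,
      (hconj g⁻¹ (inv_mem g.2)).mem_hom _ fun x => by
        have h1 := hκ₀ g⁻¹ x
        rw [map_inv] at h1
        exact h1.symm⟩
  let κ : Subgroup.normalizer (P : Set S) →* F.outF R :=
    (QuotientGroup.mk' (F.innF R)).comp (κ₀.codRestrict (F.autF R) hmem)
  have hpg : IsPGroup p κ.range := (hT.isPGroup _).of_surjective κ.rangeRestrict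
    κ.rangeRestrict_surjective
  obtain ⟨b, hb⟩ := hsyl.exists_conj hpg
  obtain ⟨β₀, rfl⟩ := QuotientGroup.mk_surjective b
  obtain ⟨β, β', iβ, hβ, hβ'⟩ := autF_isoOn β₀
  have iφβ := i.trans iβ
  obtain ⟨χ, hχ, hχP⟩ := hF.exists_extension (N := Subgroup.normalizer (P : Set S)) iφβ hfc
    fun g hg => by
      refine ⟨hg, ?_⟩
      obtain ⟨s, -, hs⟩ := (mk_mem_outS_iff (β₀ * ⟨κ₀ ⟨g, hg⟩, hmem _⟩ * β₀⁻¹)).1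
        (hb (κ ⟨g, hg⟩) ⟨⟨g, hg⟩, rfl⟩)
      refine ⟨s, fun x hx => ?_⟩
      have hxR := iφβ.maps x hx
      have h1 := hs ⟨_, hxR⟩
      have h2 : (((β₀ * ⟨κ₀ ⟨g, hg⟩, hmem _⟩ * β₀⁻¹ : F.autF R) : MulAut R) ⟨_, hxR⟩ : R) =
          (β₀ : MulAut R) (κ₀ ⟨g, hg⟩ ((β₀ : MulAut R).symm ⟨_, hxR⟩)) := rfl
      have h3 : (β₀ : MulAut R).symm ⟨β (φ x), hxR⟩ = ⟨φ x, i.maps x hx⟩ := Subtype.ext (by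
        rw [← hβ' ⟨_, hxR⟩]
        exact iβ.left_inv _ (i.maps x hx))
      rw [h2, h3, ← hβ, hκ₀] at h1
      change β (φ (g * ψ (φ x) * g⁻¹)) = s * β (φ x) * s⁻¹ at h1
      rw [i.left_inv x hx] at h1
      exact h1
  have hχP' : ∀ x ∈ P, χ x = β (φ x) := fun x hx => hχP x hx (Subgroup.le_normalizer hx)
  refine ⟨χ, fun x => ψ (β' x), hχ, hχ.mono Subgroup.le_normalizer, iφβ.mor_symm, fun x hx => ?_,
    iφβ.maps_symm, fun x hx => ?_, fun x hx => ?_⟩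
  · rw [hχP' x hx]; exact iφβ.maps x hx
  · rw [hχP' x hx]; exact iφβ.left_inv x hx
  · rw [hχP' _ (iφβ.maps_symm x hx)]; exact iφβ.right_inv x hx

/-- An automorphism of a fully normalised subgroup that is not both centric and radical extends to
a larger subgroup. -/
theorem exists_extension_of_not_centric_radical (hF : F.IsSaturated p)
    {R : Subgroup S} (hR : F.IsFullyNormalised p R) (hcr : ¬ (F.IsCentric R ∧ F.IsRadical p R))
    {α α' : S → S} (i : F.IsoOn R R α α') :
    ∃ N α₁, R ≤ N ∧ ¬ N ≤ R ∧ F.Mor N α₁ ∧ ∀ x ∈ R, α₁ x = α x := by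
  obtain ⟨hfc, hfin, hsyl⟩ := hF.sylow R hR
  by_cases hcent : F.IsCentric R
  · have hrad : ¬ F.IsRadical p R := fun h => hcr ⟨hcent, h⟩
    simp only [IsRadical, not_forall] at hrad
    obtain ⟨N, hN, hNp, hN1⟩ := hrad
    -- A normal `p`-subgroup of `Out_F(R)` lies in the Sylow subgroup `Out_S(R)`, so its elements
    -- come from `N_S(R)`. A nontrivial one gives `g ∉ R`, and normality puts `g` in the extender of
    -- `α`.
    have hNS := hsyl.normal_le hN hNp
    obtain ⟨n, hnN, hn1⟩ := N.bot_or_exists_ne_one.resolve_left hN1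
    obtain ⟨a, rfl⟩ := QuotientGroup.mk_surjective n
    obtain ⟨g, hgR, hg⟩ := (mk_mem_outS_iff a).1 (hNS hnN)
    have hgn : g ∉ R := fun hgR' => hn1 ((QuotientGroup.eq_one_iff a).2 ⟨⟨g, hgR'⟩, by
      ext x
      simp [hg x]⟩)
    let X : Subgroup S :=
      { carrier := {g | g ∈ Subgroup.normalizer (R : Set S) ∧
          ∃ s, ∀ x ∈ R, α (g * x * g⁻¹) = s * α x * s⁻¹}
        one_mem' := ⟨one_mem _, 1, fun x _ => by simp⟩
        mul_mem' := by
          rintro a b ⟨ha, s, hs⟩ ⟨hb, t, ht⟩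
          refine ⟨mul_mem ha hb, s * t, fun x hx => ?_⟩
          have hx' := (Subgroup.mem_normalizer_iff.1 hb x).1 hx
          rw [show a * b * x * (a * b)⁻¹ = a * (b * x * b⁻¹) * a⁻¹ by group, hs _ hx', ht x hx]
          group
        inv_mem' := by
          rintro a ⟨ha, s, hs⟩
          refine ⟨inv_mem ha, s⁻¹, fun x hx => ?_⟩
          have hx' := (Subgroup.mem_normalizer_iff.1 (inv_mem ha) x).1 hx
          have := hs _ hx'
          rw [show a * (a⁻¹ * x * a⁻¹⁻¹) * a⁻¹ = x by group] at this
          rw [this]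
          group }
    have hRX : R ≤ X := fun x hx =>
        ⟨Subgroup.le_normalizer hx, α x, fun y hy => i.mor.map_conj hx hy⟩
    have hgX : g ∈ X := by
      refine ⟨hgR, ?_⟩
      obtain ⟨s, -, hs⟩ := (mk_mem_outS_iff (i.toAutF * a * i.toAutF⁻¹)).1
        (hNS (hN.conj_mem _ hnN (i.toAutF : F.outF R)))
      refine ⟨s, fun x hx => ?_⟩
      have h1 := hs ⟨α x, i.maps x hx⟩
      have h2 : (((i.toAutF * a * i.toAutF⁻¹ : F.autF R) : MulAut R) ⟨α x, i.maps x hx⟩ : R) =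
        ⟨α ((a : MulAut R) ⟨α' (α x), i.maps_symm _ (i.maps x hx)⟩ : R), i.maps _ (Subtype.prop _)⟩
            :=
        rfl
      rw [h2] at h1
      change α _ = s * α x * s⁻¹ at h1
      rw [hg] at h1
      change α (g * α' (α x) * g⁻¹) = s * α x * s⁻¹ at h1
      rwa [i.left_inv x hx] at h1
    obtain ⟨α₁, h1, h2⟩ := hF.exists_extension (N := X) i hfc fun g hg => hg
    exact ⟨X, α₁, hRX, fun h => hgn (h hgX), h1, fun x hx => h2 x hx (hRX hx)⟩
  · obtain ⟨α₁, h1, h2⟩ := hF.exists_extension_centralizer i hfc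
    -- If `R` contained its centralizer, extending an isomorphism `Q → R` over the centralizer of
    -- `Q` would force `C_S(Q) ≤ Q` for every conjugate `Q`, making `R` centric.
    refine ⟨_, α₁, le_sup_left, fun hle => hcent fun Q hQ => ?_, h1, h2⟩
    have hCR : Subgroup.centralizer (R : Set S) ≤ R := le_sup_right.trans hle
    obtain ⟨φ, ψ, iQ⟩ := hQ.symm.exists_isoOn
    obtain ⟨χ, hχ, hχQ⟩ := hF.exists_extension_centralizer iQ hfc
    have hCQ : Subgroup.centralizer (Q : Set S) ≤ Q := fun c hc => by
      have hc' : c ∈ Q ⊔ Subgroup.centralizer (Q : Set S) := le_sup_right (a := Q) hc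
      have hχc : χ c ∈ R := hCR (Subgroup.mem_centralizer_iff.2 fun y hy => by
        obtain ⟨x, hx, rfl⟩ := iQ.mem_image_iff.1 hy
        rw [← hχQ x hx, ← hχ.map_mul (le_sup_left (a := Q) hx) hc',
          ← hχ.map_mul hc' (le_sup_left (a := Q) hx), Subgroup.mem_centralizer_iff.1 hc x hx])
      obtain ⟨x, hx, hxc⟩ := iQ.mem_image_iff.1 hχc
      rw [← hχQ x hx] at hxc
      exact hχ.injOn (le_sup_left (a := Q) hx) hc' hxc ▸ hx
    ext c
    constructor
    · intro hc
      refine ⟨⟨c, hCQ hc⟩, Subgroup.mem_center_iff.2 fun y => Subtype.ext ?_, rfl⟩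
      exact Subgroup.mem_centralizer_iff.1 hc y y.2
    · rintro ⟨c, hc, rfl⟩
      exact Subgroup.mem_centralizer_iff.2 fun y hy =>
        congrArg Subtype.val (Subgroup.mem_center_iff.1 hc ⟨y, hy⟩)

/-! ### Alperin's fusion theorem. -/

section Induced

variable {G : Type u} [Group G] (j : S →* G)

/-- The map `φ` is given on `P` by conjugation with an element of `G`. -/
def Induced (P : Subgroup S) (φ : S → S) : Prop :=
  ∃ g : G, ∀ x ∈ P, j (φ x) = g * j x * g⁻¹

variable {j}

theorem Induced.mono {P P' : Subgroup S} {φ : S → S} (h : Induced j P φ) (hP : P' ≤ P) :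
    Induced j P' φ :=
  h.imp fun _ hg x hx => hg x (hP hx)

theorem Induced.congr {P : Subgroup S} {φ φ' : S → S} (h : Induced j P φ)
    (hP : ∀ x ∈ P, φ' x = φ x) : Induced j P φ' :=
  h.imp fun _ hg x hx => hP x hx ▸ hg x hx

theorem Induced.comp {P Q : Subgroup S} {φ ψ : S → S} (hψ : Induced j Q ψ) (hφ : Induced j P φ)
    (hPQ : ∀ x ∈ P, φ x ∈ Q) : Induced j P fun x => ψ (φ x) := by
  obtain ⟨a, ha⟩ := hψ
  obtain ⟨b, hb⟩ := hφ
  exact ⟨a * b, fun x hx => by rw [ha _ (hPQ x hx), hb x hx]; group⟩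

theorem Induced.symm {P Q : Subgroup S} {φ ψ : S → S} (hφ : Induced j P φ)
    (i : F.IsoOn P Q φ ψ) : Induced j Q ψ := by
  obtain ⟨b, hb⟩ := hφ
  refine ⟨b⁻¹, fun y hy => ?_⟩
  have := hb _ (i.maps_symm y hy)
  rw [i.right_inv y hy] at this
  rw [this]
  group

/-- If all automorphisms of the members of a fusion controlling family are induced by `G`, then so
are all morphisms. -/
theorem Mor.induced (hT : IsMaximalTorus p T m) (hF : F.IsSaturated p) {Φ : Set (Subgroup S)}
    (hΦ : F.IsFusionControlling p Φ)
    (hj : ∀ Q ∈ Φ, ∀ φ ψ, F.IsoOn Q Q φ ψ → Induced j Q φ) {P : Subgroup S} {φ : S → S}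
    (hφ : F.Mor P φ) : Induced j P φ := by
  suffices hclosed : ∀ P, F.IsHullClosed p m T P → ∀ φ, F.Mor P φ → Induced j P φ by
    obtain ⟨φ', h1, h2⟩ := exists_extension_torusHull hT hF hφ
    exact ((hclosed _ (isHullClosed_sup_torusHull hT P) φ' h1).mono le_sup_left).congr
      fun x hx => (h2 x hx).symm
  by_contra hbad
  push Not at hbad
  obtain ⟨P₀, hP₀, φ₀, hφ₀, hnot₀⟩ := hbad
  -- A counterexample of maximal order exists because hull-closed subgroups have finitely many
  -- orders.
  let X : Set (Subgroup S) := {P | F.IsHullClosed p m T P ∧ ∃ φ, F.Mor P φ ∧ ¬ Induced j P φ}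
  have hfin := hT.finite_orders (X := X)
    ((finite_closed_inf hT hF).subset (Set.image_mono fun P hP => hP.1))
  obtain ⟨r₀, n₀, ho₀⟩ := hT.exists_toralOrder P₀
  obtain ⟨⟨r, n⟩, ⟨P, ⟨hP, φ, hφ, hnot⟩, ho⟩, hmax⟩ := Set.exists_max_image _
    (fun o : ℕ × ℕ => toLex o) hfin ⟨(r₀, n₀), P₀, ⟨hP₀, φ₀, hφ₀, hnot₀⟩, ho₀⟩
  dsimp only at ho hmax
  -- Maximality in usable form: `P₁` need not be hull-closed, since a morphism on it extends over
  -- its hull, which only enlarges the order.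
  have ih : ∀ (P' P₁ : Subgroup S), HasToralOrder p P' r n → P' ≤ P₁ → ¬ P₁ ≤ P' →
      ∀ φ₁, F.Mor P₁ φ₁ → Induced j P₁ φ₁ := by
    intro P' P₁ ho' hle hnle φ₁ hφ₁
    obtain ⟨φ₂, h1, h2⟩ := exists_extension_torusHull hT hF hφ₁
    by_contra hn
    have hn2 : ¬ Induced j (P₁ ⊔ F.torusHull p m T P₁) φ₂ := fun h =>
      hn ((h.mono le_sup_left).congr fun x hx => (h2 x hx).symm)
    obtain ⟨r₂, n₂, ho₂⟩ := hT.exists_toralOrder (P₁ ⊔ F.torusHull p m T P₁)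
    have hm := hmax (r₂, n₂)
      ⟨_, ⟨isHullClosed_sup_torusHull hT P₁, φ₂, h1, hn2⟩, ho₂⟩
    rw [Prod.Lex.toLex_le_toLex] at hm
    have hle' : P' ≤ P₁ ⊔ F.torusHull p m T P₁ := hle.trans le_sup_left
    obtain ⟨hlex, hsurj⟩ := ho'.lex ho₂ (Subgroup.inclusion hle')
      (Subgroup.inclusion_injective hle')
    refine hnle fun x hx => ?_
    obtain ⟨y, hy⟩ := hsurj (by dsimp only at hm; omega) (by dsimp only at hm; omega)
      ⟨x, le_sup_left (a := P₁) hx⟩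
    rw [← show (y : S) = x from congrArg Subtype.val hy]
    exact y.2
  apply hnot
  obtain ⟨P₂, ψ, i⟩ := hφ.exists_isoOn
  by_cases hPtop : P = ⊤
  · subst hPtop
    have : P₂ = ⊤ := i.eq_of_le hT le_top
    subst this
    exact hj _ hΦ.top_mem _ _ i
  -- A centric radical representative is replaced by a member of the family; any other has
  -- automorphisms that extend to a larger subgroup.
  obtain ⟨R, a, b, iR, hR, hRΦ⟩ : ∃ R a b, F.IsoOn P R a b ∧ F.IsFullyNormalised p R ∧
      (R ∈ Φ ∨ ¬ (F.IsCentric R ∧ F.IsRadical p R)) := by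
    obtain ⟨R, a, b, iR, hR⟩ := exists_fullyNormalised hT hF hP
    by_cases hcr : F.IsCentric R ∧ F.IsRadical p R
    · obtain ⟨R', hR', hc⟩ := hΦ.exists_conj R hcr.1 hcr.2
      obtain ⟨a', b', i'⟩ := hc.exists_isoOn
      exact ⟨R', _, _, iR.trans i', hΦ.fullyNormalised R' hR', Or.inl hR'⟩
    · exact ⟨R, a, b, iR, hR, Or.inr hcr⟩
  have haut : ∀ α α', F.IsoOn R R α α' → Induced j R α := by
    intro α α' iα
    rcases hRΦ with h | h
    · exact hj R h _ _ iα
    · obtain ⟨N, α₁, hRN, hNR, h1, h2⟩ := exists_extension_of_not_centric_radical hF hR h iα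
      exact ((ih R N (iR.hasToralOrder ho) hRN hNR α₁ h1).mono hRN).congr
        fun x hx => (h2 x hx).symm
  have hto : ∀ P' c d, F.IsoOn P P' c d → ∃ χ χ', F.IsoOn P' R χ χ' ∧ Induced j P' χ := by
    intro P' c d i'
    obtain ⟨χ, χ', hχ, iχ⟩ := exists_normalizer_extension hT hF (i'.symm.trans iR) hR
    refine ⟨χ, χ', iχ, (ih P' _ (i'.hasToralOrder ho) Subgroup.le_normalizer ?_ χ hχ).mono
      Subgroup.le_normalizer⟩
    have hP'top : P' ≠ ⊤ := by
      rintro rfl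
      exact hPtop (i'.symm.eq_of_le hT le_top)
    obtain ⟨t, htP, htN⟩ := hT.exists_mem_normalizer hP'top
    exact fun h => htP (h htN)
  obtain ⟨χ₁, χ₁', i₁, g₁⟩ := hto P _ _ ⟨Mor.id P, Mor.id P, fun _ h => h, fun _ h => h,
    fun _ _ => rfl, fun _ _ => rfl⟩
  obtain ⟨χ₂, χ₂', i₂, g₂⟩ := hto P₂ _ _ i
  -- `φ` is decomposed as `χ₂⁻¹ ∘ α ∘ χ₁`: the outer maps extend to normalizers, which are strictly
  -- larger, and `α` is an automorphism of `R`.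
  have hα := haut _ _ ((i₁.symm.trans i).trans i₂)
  have h3 := ((g₂.symm i₂).comp hα ((i₁.symm.trans i).trans i₂).maps).comp g₁ i₁.maps
  refine h3.congr fun x hx => ?_
  rw [i₁.left_inv x hx, i₂.left_inv _ (i.maps x hx)]

end Induced

end FusionSystem

/-! ### Groups acting on trees -/

namespace SimpleGraph

variable {V : Type*} {Γ : SimpleGraph V} {G : Type*} [Group G] [MulAction G V]

theorem IsTree.mem_support_of_isPath (hΓ : Γ.IsTree) {u v w : V} {q : Γ.Walk u v}
    (hq : q.IsPath) (hw : w ∈ q.support) (r : Γ.Walk u v) : w ∈ r.support := by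
  classical
  have h := (hΓ.isAcyclic.subsingleton_path u v).elim ⟨q, hq⟩ ⟨r.bypass, r.bypass_isPath⟩
  have h' : q = r.bypass := congrArg Subtype.val h
  exact r.support_bypass_subset_support (h' ▸ hw)

/-- Geodesics from `z` to `u` and to `v` together join `u` to `v`, so one of them passes through `w`
before its end. -/
theorem IsTree.dist_lt_max (hΓ : Γ.IsTree) {u v w : V} {q : Γ.Walk u v} (hq : q.IsPath)
    (hw : w ∈ q.support) (hwu : w ≠ u) (hwv : w ≠ v) (z : V) :
    Γ.dist w z < Γ.dist u z ∨ Γ.dist w z < Γ.dist v z := by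
  classical
  obtain ⟨a, ha⟩ := hΓ.connected.exists_walk_length_eq_dist z u
  obtain ⟨b, hb⟩ := hΓ.connected.exists_walk_length_eq_dist z v
  have hmem := hΓ.mem_support_of_isPath hq hw (a.reverse.append b)
  rw [Walk.mem_support_append_iff, Walk.support_reverse, List.mem_reverse] at hmem
  rw [Γ.dist_comm (u := w), Γ.dist_comm (u := u), Γ.dist_comm (u := v), ← ha, ← hb]
  rcases hmem with h | h
  · exact Or.inl ((dist_le _).trans_lt (Walk.length_takeUntil_lt_length h hwu))
  · exact Or.inr ((dist_le _).trans_lt (Walk.length_takeUntil_lt_length h hwv))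

theorem eq_of_mem_of_map_eq {α : Type*} {f : α → α} {l : List α} (h : l.map f = l) :
    ∀ a ∈ l, f a = a := by
  induction l with
  | nil => simp
  | cons b l ih =>
    rw [List.map_cons, List.cons.injEq] at h
    rintro a (_ | ⟨_, ha⟩)
    · exact h.1
    · exact ih h.2 a ha

/-- The graph endomorphism given by the action of a group element. -/
def smulHom (hadj : ∀ (g : G) (u v : V), Γ.Adj u v → Γ.Adj (g • u) (g • v)) (g : G) : Γ →g Γ :=
    ⟨fun v => g • v, fun h => hadj g _ _ h⟩

/-- The translate of the path is a path with the same ends, so it is the same path, vertex by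
vertex. -/
theorem IsTree.smul_eq_of_mem_support
    (hadj : ∀ (g : G) (u v : V), Γ.Adj u v → Γ.Adj (g • u) (g • v)) (hΓ : Γ.IsTree) {u v w : V}
    {q : Γ.Walk u v}
    (hq : q.IsPath) (hw : w ∈ q.support) {g : G} (hu : g • u = u) (hv : g • v = v) :
    g • w = w := by
  have hpath : (q.map (smulHom hadj g)).IsPath :=
    Walk.IsPath.map (MulAction.injective g) hq
  have hu' : smulHom hadj g u = u := hu
  have hv' : smulHom hadj g v = v := hv
  have h1 : ((q.map (smulHom hadj g)).copy hu' hv').IsPath := by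
    rwa [Walk.isPath_copy]
  have h := (hΓ.isAcyclic.subsingleton_path u v).elim ⟨_, h1⟩ ⟨q, hq⟩
  have h' := congrArg (fun r : Γ.Path u v => r.1.support) h
  simp only [Walk.support_copy, Walk.support_map] at h'
  exact eq_of_mem_of_map_eq h' w hw

/-- A property that spreads along edges fixed by `X` spreads between vertices fixed by `X`. -/
theorem IsTree.fixed_induction (hadj : ∀ (g : G) (u v : V), Γ.Adj u v → Γ.Adj (g • u) (g • v))
    (hΓ : Γ.IsTree) (X : Set G) {C : V → Prop}
    (hstep : ∀ a b, Γ.Adj a b → (∀ x ∈ X, x • a = a) → (∀ x ∈ X, x • b = b) → C a → C b)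
    {u v : V} (hu : ∀ x ∈ X, x • u = u) (hv : ∀ x ∈ X, x • v = v) (hC : C u) : C v := by
  classical
  obtain ⟨r⟩ := hΓ.connected.preconnected u v
  have hfix : ∀ w ∈ r.bypass.support, ∀ x ∈ X, x • w = w := fun w hw x hx =>
    hΓ.smul_eq_of_mem_support hadj r.bypass_isPath hw (hu x hx) (hv x hx)
  generalize r.bypass = q at hfix
  clear r hu hv
  induction q with
  | nil => exact hC
  | cons h q ih =>
    refine ih (hstep _ _ h (hfix _ (by simp)) (hfix _ (by simp)) hC) fun w hw => hfix w
        (by simp [hw])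

theorem dist_smul (hadj : ∀ (g : G) (u v : V), Γ.Adj u v → Γ.Adj (g • u) (g • v)) (g : G)
    (u v : V) : Γ.dist (g • u) (g • v) = Γ.dist u v := by
  have hle : ∀ (g : G) (u v : V), Γ.Reachable u v → Γ.dist (g • u) (g • v) ≤ Γ.dist u v := by
    intro g u v h
    obtain ⟨r, hr⟩ := h.exists_walk_length_eq_dist
    rw [← hr, ← Walk.length_map (smulHom hadj g) r]
    exact dist_le _
  have hre : ∀ (g : G) (u v : V), Γ.Reachable u v → Γ.Reachable (g • u) (g • v) :=
    fun g u v h => h.map (smulHom hadj g)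
  by_cases h : Γ.Reachable u v
  · refine le_antisymm (hle g u v h) ?_
    simpa using hle g⁻¹ _ _ (hre g u v h)
  · have h' : ¬ Γ.Reachable (g • u) (g • v) := fun h' => h (by simpa using hre g⁻¹ _ _ h')
    rw [dist_eq_zero_of_not_reachable h, dist_eq_zero_of_not_reachable h']

/-- A group that acts on a tree without inversions and has a finite orbit fixes a vertex. -/
theorem IsTree.exists_fixed (hadj : ∀ (g : G) (u v : V), Γ.Adj u v → Γ.Adj (g • u) (g • v))
    (hΓ : Γ.IsTree) (hinv : ∀ (g : G) (v : V), ¬ Γ.Adj v (g • v))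
    (X : Subgroup G) (v₀ : V) (hfin : {v | ∃ x ∈ X, v = x • v₀}.Finite) :
    ∃ v : V, ∀ x ∈ X, x • v = v := by
  classical
  let O := hfin.toFinset
  have hO : ∀ x ∈ X, ∀ w ∈ O, x • w ∈ O := by
    intro x hx w hw
    obtain ⟨y, hy, rfl⟩ := (Set.Finite.mem_toFinset hfin).1 hw
    exact (Set.Finite.mem_toFinset hfin).2 ⟨x * y, mul_mem hx hy, (mul_smul x y v₀).symm⟩
  have hv₀ : v₀ ∈ O := (Set.Finite.mem_toFinset hfin).2 ⟨1, one_mem X, (one_smul G v₀).symm⟩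
  -- `ρ` is the eccentricity relative to the orbit. A minimizer `u` is fixed: otherwise the next
  -- vertex on the path from `u` to `x • u`, which differs from `x • u` by the absence of
  -- inversions, is strictly better.
  let ρ : V → ℕ := fun u => O.sup fun w => Γ.dist u w
  have hρ : ∀ x ∈ X, ∀ u, ρ (x • u) ≤ ρ u := by
    intro x hx u
    refine Finset.sup_le fun w hw => ?_
    have h1 : Γ.dist (x • u) w = Γ.dist u (x⁻¹ • w) := by
      rw [← dist_smul hadj x u, smul_inv_smul]
    rw [h1]
    exact Finset.le_sup (f := fun w => Γ.dist u w) (hO _ (inv_mem hx) w hw)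
  have : Nonempty V := ⟨v₀⟩
  obtain ⟨u, hu⟩ : ∃ u, ∀ v, ρ u ≤ ρ v :=
    ⟨Function.argmin ρ, fun v => Function.argmin_le ρ v⟩
  refine ⟨u, fun x hx => ?_⟩
  by_contra hne
  obtain ⟨v, hv⟩ : ∃ v, x • u = v := ⟨_, rfl⟩
  obtain ⟨r⟩ := hΓ.connected.preconnected u v
  have hq := r.bypass_isPath
  generalize r.bypass = q at hq
  cases q with
  | nil => exact hne hv
  | cons h q =>
    rename_i w
    have hwu : w ≠ u := h.ne'
    have hwx : w ≠ v := fun h' => hinv x u (by rw [hv, ← h']; exact h)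
    have hlt : ρ w < ρ u := by
      have key : ∀ z ∈ O, Γ.dist w z < ρ u := by
        intro z hz
        rcases hΓ.dist_lt_max hq (by simp) hwu hwx z with h | h
        · exact h.trans_le (Finset.le_sup (f := fun w => Γ.dist u w) hz)
        · rw [← hv] at h
          exact h.trans_le ((Finset.le_sup (f := fun w => Γ.dist (x • u) w) hz).trans (hρ x hx u))
      exact (Finset.sup_lt_iff ((Nat.zero_le _).trans_lt (key v₀ hv₀))).2 key
    exact absurd (hu w) (not_le.2 hlt)

end SimpleGraph

/-! ### Amalgams over a star -/

/-- `G` is the colimit of the star of groups with center `B`, leaves `L i` and edge groups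
`N i ≤ L i`, embedded in `B` by `k i`. -/
structure IsStarAmalgam {ι B G : Type u} [Group B] [Group G] {L : ι → Type u}
    [∀ i, Group (L i)] (N : ∀ i, Subgroup (L i)) (k : ∀ i, N i →* B) (b : B →* G)
    (l : ∀ i, L i →* G) : Prop where
  comm : ∀ i (n : N i), b (k i n) = l i n
  desc : ∀ {H : Type u} [Group H] (f : B →* H) (g : ∀ i, L i →* H),
    (∀ i (n : N i), f (k i n) = g i n) → ∃ F : G →* H, (∀ x, F (b x) = f x) ∧ ∀ i x, F (l i x) =
        g i x
  ext : ∀ {H : Type u} [Group H] (F F' : G →* H), (∀ x, F (b x) = F' (b x)) →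
    (∀ i x, F (l i x) = F' (l i x)) → F = F'

/-- The vertices of the Bass-Serre tree of a star of groups. -/
abbrev StarVertex {ι G B : Type u} [Group G] [Group B] {L : ι → Type u} [∀ i, Group (L i)]
    (b : B →* G) (l : ∀ i, L i →* G) : Type u :=
  (G ⧸ b.range) ⊕ (Σ i, G ⧸ (l i).range)

/-- The Bass-Serre tree of a star of groups. -/
def starTree {ι G B : Type u} [Group G] [Group B] {L : ι → Type u} [∀ i, Group (L i)]
    (b : B →* G) (l : ∀ i, L i →* G) : SimpleGraph (StarVertex b l) where
  Adj u v := ∃ (g : G) (i : ι),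
      (u = Sum.inl (g : G ⧸ b.range) ∧ v = Sum.inr ⟨i, (g : G ⧸ (l i).range)⟩) ∨
    (v = Sum.inl (g : G ⧸ b.range) ∧ u = Sum.inr ⟨i, (g : G ⧸ (l i).range)⟩)
  symm := ⟨fun _ _ ⟨g, i, h⟩ => ⟨g, i, h.symm⟩⟩
  loopless := ⟨by
    rintro v ⟨g, i, ⟨h, h'⟩ | ⟨h, h'⟩⟩ <;> simp [h] at h'⟩

namespace IsStarAmalgam

variable {ι B G : Type u} [Group B] [Group G] {L : ι → Type u} [∀ i, Group (L i)]
  {N : ∀ i, Subgroup (L i)} {k : ∀ i, N i →* B} {b : B →* G} {l : ∀ i, L i →* G}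

theorem starTree_smul (g : G) (u v : StarVertex b l) (h : (starTree b l).Adj u v) :
    (starTree b l).Adj (g • u) (g • v) := by
  obtain ⟨x, i, ⟨rfl, rfl⟩ | ⟨rfl, rfl⟩⟩ := h
  · exact ⟨g * x, i, Or.inl ⟨rfl, rfl⟩⟩
  · exact ⟨g * x, i, Or.inr ⟨rfl, rfl⟩⟩

theorem starTree_not_adj_smul (g : G) (v : StarVertex b l) : ¬ (starTree b l).Adj v (g • v) := by
  rintro ⟨x, i, ⟨rfl, h⟩ | ⟨h, rfl⟩⟩ <;> exact absurd h (by simp)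

/-- The universal property retracts `G` onto `K`, so `G` is generated by the vertex groups. -/
theorem eq_top (h : IsStarAmalgam N k b l) {K : Subgroup G} (hb : ∀ x, b x ∈ K)
    (hl : ∀ i x, l i x ∈ K) : K = ⊤ := by
  obtain ⟨F, hFb, hFl⟩ := h.desc (b.codRestrict K hb) (fun i => (l i).codRestrict K (hl i))
    fun i n => Subtype.ext (h.comm i n)
  have : K.subtype.comp F = MonoidHom.id G := h.ext _ _
    (fun x => by simp [hFb]) (fun i x => by simp [hFl])
  refine eq_top_iff.2 fun g _ => ?_
  rw [← show ((F g : K) : G) = g from DFunLike.congr_fun this g]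
  exact (F g).2

theorem map_le_base (h : IsStarAmalgam N k b l) (i : ι) : (N i).map (l i) ≤ b.range := by
  rintro _ ⟨n, hn, rfl⟩
  exact ⟨k i ⟨n, hn⟩, h.comm i ⟨n, hn⟩⟩

/-- `G` maps to an iterated amalgam: each `Z i` amalgamates `B` and `L i` over `N i`, and then all
`Z i` are amalgamated over `B`. The factors embed at both stages. -/
theorem injective (h : IsStarAmalgam N k b l) (hk : ∀ i, Function.Injective (k i)) :
    Function.Injective b ∧ ∀ i, Function.Injective (l i) := by
  let A (i : ι) (t : Bool) : Type u := bif t then B else L i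
  let _ (i : ι) (t : Bool) : Group (A i t) :=
    match t with
    | true => (inferInstance : Group B)
    | false => (inferInstance : Group (L i))
  let φ (i : ι) (t : Bool) : N i →* A i t :=
    match t with
    | true => k i
    | false => (N i).subtype
  have hφ : ∀ i t, Function.Injective (φ i t) := by
    rintro i (_ | _)
    · exact Subtype.val_injective
    · exact hk i
  let Z (i : ι) : Type u := Monoid.PushoutI (φ i)
  let θ (i : ι) : B →* Z i := Monoid.PushoutI.of (φ := φ i) true
  have hθ : ∀ i, Function.Injective (θ i) := fun i => Monoid.PushoutI.of_injective (hφ i) true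
  let μ (i : ι) : L i →* Z i := Monoid.PushoutI.of (φ := φ i) false
  have hμ : ∀ i, Function.Injective (μ i) := fun i => Monoid.PushoutI.of_injective (hφ i) false
  obtain ⟨F, hFb, hFl⟩ := h.desc (H := Monoid.PushoutI θ) (Monoid.PushoutI.base θ)
    (fun i => (Monoid.PushoutI.of (φ := θ) i).comp (μ i)) fun i n => by
      rw [← Monoid.PushoutI.of_apply_eq_base θ i, MonoidHom.comp_apply]
      congr 1
      exact (Monoid.PushoutI.of_apply_eq_base (φ i) true n).trans
        (Monoid.PushoutI.of_apply_eq_base (φ i) false n).symm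
  refine ⟨fun x y hxy => ?_, fun i x y hxy => ?_⟩
  · apply Monoid.PushoutI.base_injective hθ
    rw [← hFb, ← hFb, hxy]
  · apply hμ i
    apply Monoid.PushoutI.of_injective hθ i
    have := congrArg F hxy
    rwa [hFl, hFl] at this

/-- The linear action of `G` on functions on the set of edges. -/
def edgeAction (M : ι → Subgroup G) : G →* Equiv.Perm ((Σ i, G ⧸ M i) → ℤ) where
  toFun g := ⟨fun f e => f (g⁻¹ • e), fun f e => f (g • e), fun f => by simp, fun f => by simp⟩
  map_one' := by ext f e; simp
  map_mul' g g' := by ext f e; simp [mul_smul]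

-- The map `D` is a potential whose change along an edge is the indicator of that edge, an algebraic
-- form of acyclicity. It comes from an affine action of `G` on functions on edges: `B` acts
-- linearly, and `L i` linearly around the point `δ i`. These agree on `N i`, which fixes `δ i`; the
-- orbits of `0` and `δ i` give the values at the vertices.
open Classical in
theorem exists_potential (h : IsStarAmalgam N k b l) : ∃ D : StarVertex b l →
    ((Σ i, G ⧸ (N i).map (l i)) → ℤ),
    ∀ (g : G) (i : ι), D (Sum.inr ⟨i, (g : G ⧸ (l i).range)⟩) =
      D (Sum.inl (g : G ⧸ b.range)) + Pi.single ⟨i, (g : G ⧸ (N i).map (l i))⟩ 1 := by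
  let M (i : ι) : Subgroup G := (N i).map (l i)
  let lin := edgeAction M
  let δ (i : ι) : (Σ i, G ⧸ M i) → ℤ := Pi.single ⟨i, ((1 : G) : G ⧸ M i)⟩ 1
  have hlin_add : ∀ g f f', lin g (f + f') = lin g f + lin g f' := fun _ _ _ => rfl
  have hlin_sub : ∀ g f f', lin g (f - f') = lin g f - lin g f' := fun _ _ _ => rfl
  have hlinδ : ∀ g i, lin g (δ i) = Pi.single ⟨i, (g : G ⧸ M i)⟩ 1 := by
    intro g i
    funext e
    have : (g⁻¹ • e = ⟨i, ((1 : G) : G ⧸ M i)⟩) ↔ e = ⟨i, (g : G ⧸ M i)⟩ := by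
      rw [inv_smul_eq_iff]
      have : g • (⟨i, ((1 : G) : G ⧸ M i)⟩ : Σ i, G ⧸ M i) = ⟨i, (g : G ⧸ M i)⟩ := by
        change (⟨i, ((g * 1 : G) : G ⧸ M i)⟩ : Σ i, G ⧸ M i) = _
        rw [mul_one]
      rw [this]
    change (δ i) (g⁻¹ • e) = _
    simp only [δ, Pi.single_apply, this]
  let τ (i : ι) : Equiv.Perm ((Σ i, G ⧸ M i) → ℤ) := Equiv.addRight (δ i)
  have hτ : ∀ i f, τ i f = f + δ i := fun _ _ => rfl
  have hτ' : ∀ i f, (τ i)⁻¹ f = f - δ i := fun i f => sub_eq_add_neg f (δ i) ▸ rfl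
  obtain ⟨Θ, hΘb, hΘl⟩ := h.desc (lin.comp b)
    (fun i => (MulAut.conj (τ i)).toMonoidHom.comp (lin.comp (l i))) fun i n => by
      apply Equiv.ext
      intro f
      change lin (b (k i n)) f = τ i (lin (l i n) ((τ i)⁻¹ f))
      rw [h.comm, hτ, hτ', hlin_sub, hlinδ,
        show ((l i n : G) : G ⧸ M i) = ((1 : G) : G ⧸ M i) from
          QuotientGroup.eq.2 (by simpa using ⟨n, n.2, rfl⟩)]
      exact (sub_add_cancel _ _).symm
  have haff : ∀ g f f', Θ g (f + f') = Θ g f + lin g f' := by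
    let K : Subgroup G :=
      { carrier := {g | ∀ f f', Θ g (f + f') = Θ g f + lin g f'}
        one_mem' := fun f f' => by simp
        mul_mem' := fun {x y} hx hy f f' => by
          rw [map_mul, map_mul, Equiv.Perm.mul_apply, hy, hx]
          rfl
        inv_mem' := fun {x} hx f f' => by
          have := hx (Θ x⁻¹ f) (lin x⁻¹ f')
          apply (Θ x).injective
          rw [this, map_inv, map_inv]
          simp }
    have hK : K = ⊤ := h.eq_top (fun x f f' => by rw [hΘb]; exact hlin_add _ _ _)
      fun i x f f' => by
        rw [hΘl]
        change τ i (lin (l i x) ((τ i)⁻¹ (f + f'))) = τ i (lin (l i x) ((τ i)⁻¹ f)) + lin (l i x) f'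
        simp only [hτ, hτ', hlin_sub, hlin_add]
        abel
    intro g
    exact (hK ▸ Subgroup.mem_top g : g ∈ K)
  have hb0 : ∀ x, Θ (b x) 0 = 0 := fun x => by rw [hΘb]; rfl
  have hlδ : ∀ i x, Θ (l i x) (δ i) = δ i := fun i x => by
    rw [hΘl]
    change τ i (lin (l i x) ((τ i)⁻¹ (δ i))) = δ i
    rw [hτ', sub_self, hτ]
    change 0 + δ i = δ i
    exact zero_add _
  have mulΘ : ∀ x y f, Θ (x * y) f = Θ x (Θ y f) := fun x y f => by rw [map_mul]; rfl
  let D : StarVertex b l → ((Σ i, G ⧸ M i) → ℤ) := Sum.elim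
    (Quotient.lift (fun g => Θ g 0) fun x y hxy => by
      obtain ⟨c, hc⟩ := QuotientGroup.leftRel_apply.1 hxy
      rw [show y = x * b c by rw [hc]; group, mulΘ, hb0])
    (fun v => Quotient.lift (fun g => Θ g (δ v.1)) (fun x y hxy => by
      obtain ⟨c, hc⟩ := QuotientGroup.leftRel_apply.1 hxy
      rw [show y = x * l v.1 c by rw [hc]; group, mulΘ, hlδ]) v.2)
  refine ⟨D, fun g i => ?_⟩
  change Θ g (δ i) = Θ g 0 + Pi.single ⟨i, (g : G ⧸ M i)⟩ 1
  rw [← hlinδ g i, ← haff g 0 (δ i), zero_add]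

theorem starTree_connected (h : IsStarAmalgam N k b l) : (starTree b l).Connected := by
  have : Nonempty (StarVertex b l) := ⟨Sum.inl ((1 : G) : G ⧸ b.range)⟩
  let K : Subgroup G :=
    { carrier := {g | (starTree b l).Reachable (Sum.inl ((1 : G) : G ⧸ b.range))
        (Sum.inl (g : G ⧸ b.range))}
      one_mem' := SimpleGraph.Reachable.refl _
      mul_mem' := fun {x y} hx hy => hx.trans (by
        have := hy.map (SimpleGraph.smulHom starTree_smul x)
        change (starTree b l).Reachable (Sum.inl ((x * 1 : G) : G ⧸ b.range))
          (Sum.inl ((x * y : G) : G ⧸ b.range)) at this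
        rwa [mul_one] at this)
      inv_mem' := fun {x} hx => by
        have := hx.map (SimpleGraph.smulHom starTree_smul x⁻¹)
        change (starTree b l).Reachable (Sum.inl ((x⁻¹ * 1 : G) : G ⧸ b.range))
          (Sum.inl ((x⁻¹ * x : G) : G ⧸ b.range)) at this
        rw [mul_one, inv_mul_cancel] at this
        exact this.symm }
  have hadj : ∀ (g : G) (i : ι), (starTree b l).Adj (Sum.inl (g : G ⧸ b.range))
      (Sum.inr ⟨i, (g : G ⧸ (l i).range)⟩) := fun g i => ⟨g, i, Or.inl ⟨rfl, rfl⟩⟩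
  have hK : K = ⊤ := by
    refine h.eq_top (fun x => ?_) fun i x => ?_
    · have : ((b x : G) : G ⧸ b.range) = ((1 : G) : G ⧸ b.range) := QuotientGroup.eq.2 (by simp)
      change (starTree b l).Reachable _ _
      rw [this]
    · have : ((l i x : G) : G ⧸ (l i).range) = ((1 : G) : G ⧸ (l i).range) :=
        QuotientGroup.eq.2 (by simp)
      have h1 := hadj (l i x) i
      rw [this] at h1
      exact (hadj 1 i).reachable.trans h1.symm.reachable
  have hbase : ∀ v : StarVertex b l,
      (starTree b l).Reachable (Sum.inl ((1 : G) : G ⧸ b.range)) v := by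
    rintro (q | ⟨i, q⟩)
    · obtain ⟨g, rfl⟩ := QuotientGroup.mk_surjective q
      exact (hK ▸ Subgroup.mem_top g : g ∈ K)
    · obtain ⟨g, rfl⟩ := QuotientGroup.mk_surjective q
      exact (hK ▸ Subgroup.mem_top g : g ∈ K).trans (hadj g i).reachable
  exact ⟨fun u v => (hbase u).symm.trans (hbase v)⟩

/-- Every edge is a bridge: the coordinate of the potential at an edge changes only across that
edge. -/
theorem starTree_isTree (h : IsStarAmalgam N k b l) : (starTree b l).IsTree := by
  classical
  refine ⟨h.starTree_connected, ?_⟩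
  obtain ⟨D, hD⟩ := h.exists_potential
  rw [SimpleGraph.isAcyclic_iff_forall_adj_isBridge]
  have key : ∀ (g : G) (i : ι), (starTree b l).IsBridge
      s(Sum.inl (g : G ⧸ b.range), Sum.inr ⟨i, (g : G ⧸ (l i).range)⟩) := by
    intro g i
    rw [SimpleGraph.isBridge_iff]
    let e : Σ i, G ⧸ (N i).map (l i) := ⟨i, (g : G ⧸ (N i).map (l i))⟩
    have hstep : ∀ u v, ((starTree b l).deleteEdges {s(Sum.inl (g : G ⧸ b.range),
        Sum.inr ⟨i, (g : G ⧸ (l i).range)⟩)}).Adj u v → D u e = D v e := by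
      have half : ∀ (x : G) (i' : ι), s(Sum.inl (x : G ⧸ b.range),
          Sum.inr (⟨i', (x : G ⧸ (l i').range)⟩ : Σ i, G ⧸ (l i).range)) ≠
            s(Sum.inl (g : G ⧸ b.range), Sum.inr ⟨i, (g : G ⧸ (l i).range)⟩) →
          D (Sum.inl (x : G ⧸ b.range)) e = D (Sum.inr ⟨i', (x : G ⧸ (l i').range)⟩) e := by
        intro x i' hne
        rw [hD, Pi.add_apply, Pi.single_apply, if_neg, add_zero]
        intro he
        obtain ⟨rfl, he⟩ := Sigma.mk.inj_iff.1 he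
        have hm := QuotientGroup.eq.1 (eq_of_heq he)
        apply hne
        rw [show (x : G ⧸ b.range) = g from (QuotientGroup.eq.2 (h.map_le_base _ hm)).symm,
          show (x : G ⧸ (l i).range) = g from (QuotientGroup.eq.2 (by
            obtain ⟨n, -, hn⟩ := hm
            exact ⟨n, hn⟩)).symm]
      intro u v huv
      rw [SimpleGraph.deleteEdges_adj, Set.mem_singleton_iff] at huv
      obtain ⟨⟨x, i', ⟨rfl, rfl⟩ | ⟨rfl, rfl⟩⟩, hne⟩ := huv
      · exact half x i' hne
      · exact (half x i' (by rwa [Sym2.eq_swap])).symm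
    rintro ⟨r⟩
    have : ∀ {u v : StarVertex b l} (_ : ((starTree b l).deleteEdges {s(Sum.inl (g : G ⧸ b.range),
        Sum.inr ⟨i, (g : G ⧸ (l i).range)⟩)}).Walk u v), D u e = D v e := by
      intro u v r
      induction r with
      | nil => rfl
      | cons h' _ ih => exact (hstep _ _ h').trans ih
    have h1 := this r
    rw [hD, Pi.add_apply, Pi.single_eq_same] at h1
    omega
  rintro u v ⟨g, i, ⟨rfl, rfl⟩ | ⟨rfl, rfl⟩⟩
  · exact key g i
  · rw [Sym2.eq_swap]
    exact key g i

/-- The stabilizer of an edge is a conjugate of the edge group. -/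
theorem mem_edge_group (h : IsStarAmalgam N k b l) {x : G} (i : ι) (hb : x ∈ b.range)
    (hl : x ∈ (l i).range) :
    x ∈ (N i).map (l i) := by
  classical
  obtain ⟨D, hD⟩ := h.exists_potential
  -- The edges of `x` and of `1` have the same ends, hence the same change of potential, hence are
  -- equal.
  have h1 := hD x i
  have h2 := hD 1 i
  rw [show (x : G ⧸ b.range) = ((1 : G) : G ⧸ b.range) from QuotientGroup.eq.2 (by simpa using hb),
    show (x : G ⧸ (l i).range) = ((1 : G) : G ⧸ (l i).range) from
      QuotientGroup.eq.2 (by simpa using hl), h2] at h1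
  have h3 := congrFun (add_left_cancel h1) ⟨i, (x : G ⧸ (N i).map (l i))⟩
  rw [Pi.single_eq_same, Pi.single_apply] at h3
  have h4 : (⟨i, (x : G ⧸ (N i).map (l i))⟩ : Σ i, G ⧸ (N i).map (l i)) =
      ⟨i, ((1 : G) : G ⧸ (N i).map (l i))⟩ := by
    by_contra hne
    rw [if_neg hne] at h3
    exact zero_ne_one h3
  have h5 := QuotientGroup.eq.1 (eq_of_heq (Sigma.mk.inj_iff.1 h4).2)
  simpa using h5

end IsStarAmalgam

/-! ### Automorphism groups in a linking system -/

/-- A Sylow subgroup `O` of a finite group is a Sylow subgroup of each intermediate group. -/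
theorem IsSylowSubgroup.exists_conj_mem {p : ℕ} [Fact p.Prime] {G : Type u} [Group G] [Finite G]
    {O K X : Subgroup G} (hO : IsSylowSubgroup p O) (hOK : O ≤ K) (hXK : X ≤ K)
    (hX : IsPGroup p X) : ∃ k ∈ K, ∀ x ∈ X, k * x * k⁻¹ ∈ O := by
  obtain ⟨P, hP⟩ := (hO.1.isPGroup.comap_of_injective K.subtype K.subtype_injective).exists_le_sylow
  obtain ⟨g, hg⟩ := hO.exists_conj (P.2.map K.subtype)
  -- The Sylow subgroup of `K` above `O` is conjugate in `G` into `O`, so it cannot be larger.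
  have hPO : (P : Subgroup K) = O.subgroupOf K := by
    refine le_antisymm ?_ hP
    have hcard : Nat.card P ≤ Nat.card (O.subgroupOf K) := by
      rw [Nat.card_congr (Subgroup.subgroupOfEquivOfLe hOK).toEquiv]
      refine Nat.card_le_card_of_injective
        (fun x : P => (⟨g * x * g⁻¹, hg _ ⟨x, x.2, rfl⟩⟩ : O)) fun x y hxy => ?_
      have := congrArg Subtype.val hxy
      exact Subtype.ext (Subtype.ext (by simpa using this))
    exact (Subgroup.eq_of_le_of_card_ge hP hcard).ge
  obtain ⟨P', hP'⟩ := (hX.comap_of_injective K.subtype K.subtype_injective).exists_le_sylow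
  obtain ⟨k, hk⟩ := MulAction.exists_smul_eq K P' P
  refine ⟨k, k.2, fun x hx => ?_⟩
  have h1 : k * ⟨x, hXK hx⟩ * k⁻¹ ∈ (P : Subgroup K) := by
    rw [← hk]
    exact ⟨⟨x, hXK hx⟩, hP' hx, rfl⟩
  rw [hPO] at h1
  exact h1

namespace TransporterData

variable {p : ℕ} [Fact p.Prime] {S : Type u} [Group S] {F : FusionSystem S} {L : TransporterData F}

/-- The homomorphism `Aut_L(P) → Aut_F(P)`. -/
def ρAut (P : SubgroupObj L.obj) : Aut P →* F.autF P.grp where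
  toFun a := ⟨{ toFun := L.ρ a.hom
                invFun := L.ρ a.inv
                left_inv := fun x => by
                  have := L.ρ_comp a.hom a.inv
                  rw [a.hom_inv_id, L.ρ_id] at this
                  exact (DFunLike.congr_fun this x).symm
                right_inv := fun x => by
                  have := L.ρ_comp a.inv a.hom
                  rw [a.inv_hom_id, L.ρ_id] at this
                  exact (DFunLike.congr_fun this x).symm
                map_mul' := map_mul _ }, L.ρ_mem a.hom, L.ρ_mem a.inv⟩
  map_one' := by
    ext x
    exact congrArg Subtype.val (DFunLike.congr_fun (L.ρ_id P) x)
  map_mul' a b := by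
    ext x
    exact congrArg Subtype.val (DFunLike.congr_fun (L.ρ_comp b.hom a.hom) x)

theorem ρAut_apply (P : SubgroupObj L.obj) (a : Aut P) (x : P.grp) :
    ((L.ρAut P a : MulAut P.grp) x) = L.ρ a.hom x := rfl

/-- The homomorphism `Aut_L(P) → Out_F(P)`. -/
def toOut (P : SubgroupObj L.obj) : Aut P →* F.outF P.grp :=
  (QuotientGroup.mk' (F.innF P.grp)).comp (L.ρAut P)

variable {P : SubgroupObj L.obj}

theorem exists_isoOn (a : Aut P) :
    ∃ α α', F.IsoOn P.grp P.grp α α' ∧ ∀ x : P.grp, (L.ρ a.hom x : S) = α x := by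
  obtain ⟨α, α', h, hα, -⟩ := FusionSystem.autF_isoOn (L.ρAut P a)
  exact ⟨α, α', h, fun x => (hα x).symm⟩

namespace IsTransporterSystem

theorem conj_εAut (hL : L.IsTransporterSystem p) (a : Aut P) (x : P.grp) :
    a * L.εAut P ⟨x, Subgroup.le_normalizer x.2⟩ * a⁻¹ =
      L.εAut P ⟨L.ρ a.hom x, Subgroup.le_normalizer (L.ρ a.hom x).2⟩ := by
  rw [mul_inv_eq_iff_eq_mul]
  ext
  exact hL.comm a.hom x

theorem εAut_injective (hL : L.IsTransporterSystem p) : Function.Injective (L.εAut P) := by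
  intro g h hgh
  have := hL.ε_injective P P (congrArg (fun a : Aut P => a.hom) hgh)
  exact Subtype.ext (congrArg (fun t : transporter P.grp P.grp => (t : S)) this)

theorem ρ_εAut (hL : L.IsTransporterSystem p) (g : Subgroup.normalizer (P.grp : Set S))
    (x : P.grp) : (L.ρ (L.εAut P g).hom x : S) = g * x * (g : S)⁻¹ :=
  hL.ρ_ε _ x

theorem isIso_of_ρ_eq_id (hL : L.IsTransporterSystem p) {φ : P ⟶ P}
    (h : L.ρ φ = MonoidHom.id P.grp) : IsIso φ := by
  obtain ⟨a, -, rfl⟩ := (hL.ρ_eq_iff (𝟙 P) φ).1 ((L.ρ_id P).trans h.symm)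
  rw [Category.comp_id]
  exact Iso.isIso_hom (X := P) (Y := P) a

/-- Lifts of the automorphism and of its inverse compose to endomorphisms over the identity, and
these are isomorphisms. -/
theorem exists_aut (hL : L.IsTransporterSystem p) {α α' : S → S} (h : F.IsoOn P.grp P.grp α α') :
    ∃ a : Aut P, ∀ x : P.grp, (L.ρ a.hom x : S) = α x := by
  obtain ⟨φ, hφ⟩ := hL.ρ_surjective (h.mor.toHom_mem h.maps)
  obtain ⟨ψ, hψ⟩ := hL.ρ_surjective (h.mor_symm.toHom_mem h.maps_symm)
  have h1 : IsIso (φ ≫ ψ) := hL.isIso_of_ρ_eq_id (by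
    ext x
    rw [L.ρ_comp, hφ, hψ]
    exact h.left_inv x x.2)
  have h2 : IsIso (ψ ≫ φ) := hL.isIso_of_ρ_eq_id (by
    ext x
    rw [L.ρ_comp, hφ, hψ]
    exact h.right_inv x x.2)
  have h3 : IsIso φ := by
    have : φ ≫ ψ ≫ inv (φ ≫ ψ) = 𝟙 P := by rw [← Category.assoc, IsIso.hom_inv_id]
    have : IsSplitMono φ := ⟨⟨⟨_, this⟩⟩⟩
    have : (inv (ψ ≫ φ) ≫ ψ) ≫ φ = 𝟙 P := by rw [Category.assoc, IsIso.inv_hom_id]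
    have : IsSplitEpi φ := ⟨⟨⟨_, this⟩⟩⟩
    exact isIso_of_mono_of_isSplitEpi φ
  refine ⟨asIso φ, fun x => ?_⟩
  change (L.ρ φ x : S) = α x
  rw [hφ]
  rfl

/-- Conjugation by an automorphism of `P` in the linking system induces morphisms of the fusion
system on subgroups of `N_S(P)`. -/
theorem mor_of_conj (hL : L.IsTransporterSystem p) (a : Aut P) {Y : Subgroup S}
    (hY : Y ≤ Subgroup.normalizer (P.grp : Set S)) {f : S → S}
    (hf : ∀ y (hy : y ∈ Y), ∃ hfy : f y ∈ Subgroup.normalizer (P.grp : Set S),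
      a * L.εAut P ⟨y, hY hy⟩ * a⁻¹ = L.εAut P ⟨f y, hfy⟩) : F.Mor Y f := by
  let N : Subgroup S := Subgroup.normalizer (P.grp : Set S)
  let K : Subgroup N := (L.εAut P).range.comap ((MulAut.conj a).toMonoidHom.comp (L.εAut P))
  have hRK : Y ⊔ P.grp ≤ K.map N.subtype := by
    refine sup_le (fun y hy => ?_) fun x hx => ?_
    · obtain ⟨hfy, h⟩ := hf y hy
      exact ⟨⟨y, hY hy⟩, ⟨_, h.symm⟩, rfl⟩
    · exact ⟨⟨x, Subgroup.le_normalizer hx⟩, ⟨_, (hL.conj_εAut a ⟨x, hx⟩).symm⟩, rfl⟩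
  have hRN : Y ⊔ P.grp ≤ N := sup_le hY Subgroup.le_normalizer
  let R : SubgroupObj L.obj := ⟨Y ⊔ P.grp, hL.over_closed P.mem le_sup_right⟩
  let R' : SubgroupObj L.obj := ⟨N, hL.over_closed P.mem Subgroup.le_normalizer⟩
  -- Conjugation by `a` carries the images of both `Y` and `P` into that of `N_S(P)`, so `a` extends
  -- over `Y ⊔ P`. It remains to see that `ρ ψ` is `f` on `Y`.
  obtain ⟨ψ, hψ⟩ := hL.extend (P := P) (P' := P) (R := R) (R' := R') a le_sup_right hRN
    Subgroup.le_normalizer le_rfl fun r => by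
      obtain ⟨n, ⟨r', hr'⟩, hn⟩ := hRK r.2
      refine ⟨r', ?_⟩
      have : n = ⟨r, hRN r.2⟩ := Subtype.ext hn
      subst this
      exact (congrArg (fun b : Aut P => b.hom) hr').symm
  refine (FusionSystem.mor_of_mem_hom (φ := f) (F.comp_mem
    (FusionSystem.inclusion_mem (F := F) (le_sup_left : Y ≤ Y ⊔ P.grp)) (L.ρ_mem ψ))) fun y => ?_
  let y' : R.grp := ⟨y, (le_sup_left : Y ≤ Y ⊔ P.grp) y.2⟩
  change f y = (L.ρ ψ y' : S)
  obtain ⟨hfy, h⟩ := hf y y.2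
  have hcomm := hL.comm ψ y'
  have h1 : L.ι P R le_sup_right ≫ (L.εAut R ⟨y', Subgroup.le_normalizer y'.2⟩).hom =
      (L.εAut P ⟨y, hY y.2⟩).hom ≫ L.ι P R le_sup_right := by
    have ht : (y : S) ∈ transporter P.grp R.grp := fun x hx =>
      (le_sup_right : P.grp ≤ Y ⊔ P.grp) (mem_transporter_of_mem_normalizer (hY y.2) x hx)
    refine (L.ε_mul P R R ⟨1, _⟩ ⟨y, _⟩ (by simpa using ht)).symm.trans ?_
    refine Eq.trans ?_ (L.ε_mul P P R ⟨y, _⟩ ⟨1, _⟩ (by simpa using ht))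
    congr 2
    simp
  have h2 : ∀ z : N, L.ι P R' Subgroup.le_normalizer ≫
      (L.εAut R' ⟨z, Subgroup.le_normalizer z.2⟩).hom =
      (L.εAut P z).hom ≫ L.ι P R' Subgroup.le_normalizer ∧
      ∃ ht : (z : S) ∈ transporter P.grp R'.grp,
        (L.εAut P z).hom ≫ L.ι P R' Subgroup.le_normalizer = L.ε P R' ⟨z, ht⟩ := by
    intro z
    have ht : (z : S) ∈ transporter P.grp R'.grp := fun x hx =>
      Subgroup.le_normalizer (mem_transporter_of_mem_normalizer z.2 x hx)
    have e1 : (L.εAut P z).hom ≫ L.ι P R' Subgroup.le_normalizer = L.ε P R' ⟨z, ht⟩ := by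
      refine (L.ε_mul P P R' ⟨z, _⟩ ⟨1, _⟩ (by simpa using ht)).symm.trans ?_
      congr 2
      simp
    refine ⟨?_, ht, e1⟩
    rw [e1]
    refine (L.ε_mul P R' R' ⟨1, _⟩ ⟨z, _⟩ (by simpa using ht)).symm.trans ?_
    congr 2
    simp
  have h3 : (L.εAut P ⟨y, hY y.2⟩).hom ≫ a.hom = a.hom ≫ (L.εAut P ⟨f y, hfy⟩).hom := by
    rw [mul_inv_eq_iff_eq_mul] at h
    exact congrArg (fun b : Aut P => b.hom) h
  -- Both sides describe the extension of `a` applied after `y`. Cancelling `a` and using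
  -- injectivity of `ε` gives `f y = ρ ψ y`.
  have h4 : a.hom ≫ (L.εAut P ⟨f y, hfy⟩).hom ≫ L.ι P R' Subgroup.le_normalizer =
      a.hom ≫ (L.εAut P (L.ρ ψ y')).hom ≫ L.ι P R' Subgroup.le_normalizer := by
    rw [← Category.assoc, ← h3, Category.assoc, ← hψ, ← Category.assoc, ← h1, Category.assoc,
      hcomm, ← Category.assoc, hψ, Category.assoc, (h2 (L.ρ ψ y')).1]
  have : IsIso a.hom := Iso.isIso_hom (X := P) (Y := P) a
  rw [cancel_epi] at h4
  obtain ⟨-, ht, e1⟩ := h2 ⟨f y, hfy⟩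
  obtain ⟨-, ht', e2⟩ := h2 (L.ρ ψ y')
  rw [e1, e2] at h4
  exact congrArg (fun t : transporter P.grp R'.grp => (t : S)) (hL.ε_injective _ _ h4)

end IsTransporterSystem

namespace IsCentricLinkingSystem

theorem isCentric (hL : L.IsCentricLinkingSystem p) (P : SubgroupObj L.obj) : F.IsCentric P.grp :=
  (Set.ext_iff.1 hL.obj_eq P.grp).1 P.mem

/-- Modulo some `ε(s)`, the automorphism `a` lies in `E(P) = ε(Z(P))`. Hence Sylow arguments in
`Aut_L(P)` reduce to the finite group `Out_F(P)`. -/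
theorem mem_range_of_toOut_mem (hL : L.IsCentricLinkingSystem p) {a : Aut P}
    (ha : L.toOut P a ∈ F.outS P.grp) : a ∈ (L.εAut P).range := by
  obtain ⟨s, hs, h⟩ := (FusionSystem.mk_mem_outS_iff (L.ρAut P a)).1 ha
  have : (L.εAut P ⟨s, hs⟩)⁻¹ * a ∈ L.E P := by
    have h1 : L.ρAut P a = L.ρAut P (L.εAut P ⟨s, hs⟩) := by
      ext x
      rw [h x]
      exact (hL.ρ_εAut ⟨s, hs⟩ x).symm
    have h2 : L.ρAut P ((L.εAut P ⟨s, hs⟩)⁻¹ * a) = 1 := by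
      rw [map_mul, map_inv, h1, inv_mul_cancel]
    change L.ρ _ = _
    ext x
    rw [← ρAut_apply, h2]
    rfl
  rw [hL.E_eq] at this
  obtain ⟨z, hz⟩ := this
  exact ⟨⟨s, hs⟩ * _, by rw [map_mul, ← hz, mul_inv_cancel_left]⟩

theorem toOut_εAut_mem (hL : L.IsCentricLinkingSystem p) (g : Subgroup.normalizer (P.grp : Set S)) :
    L.toOut P (L.εAut P g) ∈ F.outS P.grp :=
  (FusionSystem.mk_mem_outS_iff _).2 ⟨g, g.2, fun x => hL.ρ_εAut g x⟩

/-- `N_S(P)` is a Sylow `p`-subgroup of each subgroup of `Aut_L(P)` that contains it. -/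
theorem exists_conj_mem_range (hL : L.IsCentricLinkingSystem p) (hF : F.IsSaturated p)
    (hP : F.IsFullyNormalised p P.grp) {N X : Subgroup (Aut P)} (hN : (L.εAut P).range ≤ N)
    (hXN : X ≤ N) (hX : IsPGroup p X) : ∃ n ∈ N, ∀ x ∈ X, n * x * n⁻¹ ∈ (L.εAut P).range := by
  obtain ⟨-, hfin, hsyl⟩ := hF.sylow P.grp hP
  obtain ⟨_, ⟨n, hn, rfl⟩, h⟩ := hsyl.exists_conj_mem (K := N.map (L.toOut P))
    (X := X.map (L.toOut P)) (fun o ho => by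
      obtain ⟨a, rfl⟩ := QuotientGroup.mk_surjective o
      obtain ⟨s, hs, h⟩ := (FusionSystem.mk_mem_outS_iff a).1 ho
      refine ⟨L.εAut P ⟨s, hs⟩, hN ⟨_, rfl⟩, ?_⟩
      refine congrArg _ (Subtype.ext ?_)
      ext x
      rw [h x]
      exact hL.ρ_εAut ⟨s, hs⟩ x) (Subgroup.map_mono hXN) (hX.map _)
  refine ⟨n, hn, fun x hx => hL.mem_range_of_toOut_mem ?_⟩
  rw [map_mul, map_mul, map_inv]
  exact h _ ⟨x, hx, rfl⟩

/-- With `p ^ c` the order of `Out_S(P)`, the power `g ^ p ^ c` acts on `P` as some `x ∈ P`, so it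
differs from `x` by an element of `C_S(P) = Z(P)`. This forces divisible groups mapped into `N_S(P)`
into `P`. -/
theorem exists_pow_mem (hL : L.IsCentricLinkingSystem p) (hF : F.IsSaturated p)
    (hP : F.IsFullyNormalised p P.grp) :
    ∃ c : ℕ, ∀ g ∈ Subgroup.normalizer (P.grp : Set S), g ^ p ^ c ∈ P.grp := by
  obtain ⟨-, hfin, hsyl⟩ := hF.sylow P.grp hP
  obtain ⟨c, hc⟩ := IsPGroup.iff_card.1 hsyl.1.isPGroup
  refine ⟨c, fun g hg => ?_⟩
  have h1 : (⟨_, hL.toOut_εAut_mem ⟨g, hg⟩⟩ : F.outS P.grp) ^ p ^ c = 1 := by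
    rw [← hc]; exact pow_card_eq_one'
  have h2 : L.toOut P (L.εAut P (⟨g, hg⟩ ^ p ^ c)) = 1 := by
    rw [map_pow, map_pow]
    exact congrArg Subtype.val h1
  obtain ⟨x, hx⟩ := (QuotientGroup.eq_one_iff _).1 h2
  have h3 : (x : S)⁻¹ * g ^ p ^ c ∈ Subgroup.centralizer (P.grp : Set S) := by
    rw [Subgroup.mem_centralizer_iff]
    intro y hy
    have h4 := congrArg Subtype.val (DFunLike.congr_fun hx ⟨y, hy⟩)
    have h5 : (x : S) * y * (x : S)⁻¹ = g ^ p ^ c * y * (g ^ p ^ c)⁻¹ :=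
      h4.trans (hL.ρ_εAut ((⟨g, hg⟩ : Subgroup.normalizer (P.grp : Set S)) ^ p ^ c) ⟨y, hy⟩)
    have h6 : g ^ p ^ c * y = x * y * (x : S)⁻¹ * g ^ p ^ c := by rw [h5]; group
    rw [mul_assoc, h6]
    group
  rw [hL.isCentric P P.grp (FusionSystem.Conj.refl _)] at h3
  obtain ⟨z, -, hz⟩ := h3
  have : g ^ p ^ c = x * z := by
    rw [show (z : S) = (x : S)⁻¹ * g ^ p ^ c from hz, mul_inv_cancel_left]
  rw [this]
  exact mul_mem x.2 z.2

end IsCentricLinkingSystem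

end TransporterData

/-! ### The Robinson amalgam as a star of groups -/

/-- The maps of a star of groups, with base `B ≥ S` and with leaves `L i ≥ N_S(P i)`, to a group
`G` in which the vertex and edge groups have Sylow subgroups `S` and `N_S(P i)`, and in which the
elements of the vertex groups induce morphisms of `F`. -/
structure IsFusionStar (p : ℕ) {S : Type u} [Group S] (F : FusionSystem S) {ι G : Type u} [Group G]
    (j : S →* G) (P : ι → Subgroup S) (B : Subgroup G) (L M : ι → Subgroup G) : Prop where
  injective : Function.Injective j
  base_mem : ∀ s, j s ∈ B
  base_conj : ∀ c ∈ B, ∃ α α', F.IsoOn ⊤ ⊤ α α' ∧ ∀ s, j (α s) = c * j s * c⁻¹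
  leaf_conj : ∀ i, ∀ c ∈ L i, ∃ α α', F.IsoOn (P i) (P i) α α' ∧
    ∀ s ∈ P i, j (α s) = c * j s * c⁻¹
  leaf_mor : ∀ i, ∀ c ∈ L i, ∀ (Y : Subgroup S) (f : S → S),
    (∀ y ∈ Y, y ∈ Subgroup.normalizer (P i : Set S)) →
    (∀ y ∈ Y, f y ∈ Subgroup.normalizer (P i : Set S)) →
    (∀ y ∈ Y, j (f y) = c * j y * c⁻¹) → F.Mor Y f
  edge_le_base : ∀ i, M i ≤ B
  edge_le_leaf : ∀ i, M i ≤ L i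
  base_sylow : ∀ X : Subgroup G, IsPGroup p X → X ≤ B → ∃ c ∈ B, ∀ x ∈ X, ∃ s, c * x * c⁻¹ = j s
  leaf_sylow : ∀ i, ∀ X : Subgroup G, IsPGroup p X → X ≤ L i →
    ∃ c ∈ L i, ∀ x ∈ X, ∃ s ∈ Subgroup.normalizer (P i : Set S), c * x * c⁻¹ = j s
  edge_sylow : ∀ i, ∀ X : Subgroup G, IsPGroup p X → X ≤ M i →
    ∃ c ∈ M i, ∀ x ∈ X, ∃ s ∈ Subgroup.normalizer (P i : Set S), c * x * c⁻¹ = j s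

namespace RobinsonSetup

variable {p : ℕ} [Fact p.Prime] {S : Type u} [Group S] {𝒢 : PLocalCompactGroup p S}
  (R : RobinsonSetup 𝒢)

/-- The members of the family other than `S`. -/
abbrev Leaf : Type u := {P : R.family // P.1 ≠ ⊤}

/-- The canonical homomorphism from a vertex group to the amalgam. -/
noncomputable def fromVertex (P : R.family) : Aut (R.vertexObj P) →* R.amalgam :=
  (colimit.ι R.treeOfGroups.multispan (WalkingMultispan.right P)).hom

theorem isStarAmalgam : IsStarAmalgam (fun i : R.Leaf => R.N i.1) (fun i => R.k i.1 i.2)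
    (R.fromVertex R.base) fun i : R.Leaf => R.fromVertex i.1 where
  comm i n := congrArg (fun f => f.hom n) (Multicoequalizer.condition R.treeOfGroups i)
  desc := by
    classical
    intro H _ f g hfg
    let c (P : R.family) : R.treeOfGroups.right P ⟶ GrpCat.of H :=
      if h : P = R.base then GrpCat.ofHom (h ▸ f) else
        GrpCat.ofHom (g ⟨P, fun h' => h (Subtype.ext h')⟩)
    have hbase : c R.base = GrpCat.ofHom f := dif_pos rfl
    have hleaf : ∀ i : R.Leaf, c i.1 = GrpCat.ofHom (g i) := fun i =>
      dif_neg fun h => i.2 (congrArg Subtype.val h)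
    have hc : ∀ i : R.treeShape.L, R.treeOfGroups.fst i ≫ c R.base =
        R.treeOfGroups.snd i ≫ c i.1 := by
      intro i
      rw [hbase, hleaf i]
      ext n
      exact hfg i n
    refine ⟨(Multicoequalizer.desc R.treeOfGroups (GrpCat.of H) c hc).hom, fun x => ?_,
      fun i x => ?_⟩
    · have := Multicoequalizer.π_desc R.treeOfGroups (GrpCat.of H) c hc R.base
      rw [hbase] at this
      exact congrArg (fun f => f.hom x) this
    · have := Multicoequalizer.π_desc R.treeOfGroups (GrpCat.of H) c hc i.1
      rw [hleaf] at this
      exact congrArg (fun f => f.hom x) this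
  ext := by
    intro H _ f f' hb hl
    have : (GrpCat.ofHom f : R.amalgam ⟶ GrpCat.of H) = GrpCat.ofHom f' := by
      refine Multicoequalizer.hom_ext R.treeOfGroups _ _ fun P => ?_
      ext x
      by_cases h : P = R.base
      · subst h
        exact hb x
      · exact hl ⟨P, fun h' => h (Subtype.ext h')⟩ x
    exact congrArg GrpCat.Hom.hom this

theorem fromVertex_injective (P : R.family) : Function.Injective (R.fromVertex P) := by
  obtain ⟨hb, hl⟩ := R.isStarAmalgam.injective fun i => R.k_injective i.1 i.2
  by_cases h : P = R.base
  · subst h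
    exact hb
  · exact hl ⟨P, fun h' => h (Subtype.ext h')⟩

/-- The homomorphisms from `S` and from `L_P` to the amalgam agree on `N_S(P)`. -/
theorem fromVertex_εAut (P : R.family) (s : Subgroup.normalizer ((R.vertexObj P).grp : Set S)) :
    R.fromVertex P (𝒢.L.εAut (R.vertexObj P) s) = R.fromSylow s := by
  by_cases h : P = R.base
  · subst h
    rfl
  · have hP : P.1 ≠ ⊤ := fun h' => h (Subtype.ext h')
    have h1 := R.isStarAmalgam.comm ⟨P, hP⟩ ⟨_, R.normalizer_le P s hP⟩
    rw [R.k_normalizer P hP s] at h1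
    exact h1.symm

theorem fromSylow_injective : Function.Injective R.fromSylow := by
  intro s t h
  have h1 : 𝒢.L.εAut (R.vertexObj R.base) ⟨s, Subgroup.le_normalizer (Subgroup.mem_top s)⟩ =
      𝒢.L.εAut (R.vertexObj R.base) ⟨t, Subgroup.le_normalizer (Subgroup.mem_top t)⟩ :=
    R.fromVertex_injective R.base h
  exact congrArg Subtype.val (𝒢.linking.εAut_injective h1)

theorem vertex_conj (P : R.family) (a : Aut (R.vertexObj P)) :
    ∃ α α', 𝒢.F.IsoOn P P α α' ∧ (∀ x : (R.vertexObj P).grp, (𝒢.L.ρ a.hom x : S) = α x) ∧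
    ∀ s ∈ P.1, R.fromSylow (α s) = R.fromVertex P a * R.fromSylow s * (R.fromVertex P a)⁻¹ := by
  obtain ⟨α, α', h, hα⟩ := TransporterData.exists_isoOn a
  refine ⟨α, α', h, hα, fun s hs => ?_⟩
  have := congrArg (R.fromVertex P) (𝒢.linking.conj_εAut a ⟨s, hs⟩)
  rw [map_mul, map_mul, map_inv, fromVertex_εAut, fromVertex_εAut] at this
  rw [this, hα ⟨s, hs⟩]

theorem vertex_mor (P : R.family) (a : Aut (R.vertexObj P)) {Y : Subgroup S} {f : S → S}
    (hY : ∀ y ∈ Y, y ∈ Subgroup.normalizer (P.1 : Set S))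
    (hf : ∀ y ∈ Y, f y ∈ Subgroup.normalizer (P.1 : Set S))
    (h : ∀ y ∈ Y, R.fromSylow (f y) = R.fromVertex P a * R.fromSylow y * (R.fromVertex P a)⁻¹) :
    𝒢.F.Mor Y f := by
  refine 𝒢.linking.mor_of_conj a hY fun y hy => ⟨hf y hy, R.fromVertex_injective P ?_⟩
  rw [map_mul, map_mul, map_inv, fromVertex_εAut, fromVertex_εAut, h y hy]

theorem vertex_sylow (P : R.family) {N : Subgroup (Aut (R.vertexObj P))}
    (hN : (𝒢.L.εAut (R.vertexObj P)).range ≤ N) {X : Subgroup R.amalgam} (hX : IsPGroup p X)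
    (hXN : X ≤ N.map (R.fromVertex P)) : ∃ c ∈ N.map (R.fromVertex P), ∀ x ∈ X,
      ∃ s ∈ Subgroup.normalizer (P.1 : Set S), c * x * c⁻¹ = R.fromSylow s := by
  obtain ⟨n, hn, h⟩ := 𝒢.linking.exists_conj_mem_range 𝒢.saturated
    (R.controlling.fullyNormalised P P.2) hN (X := X.comap (R.fromVertex P)) (fun x hx => by
      obtain ⟨y, hy, hyx⟩ := hXN hx
      rwa [← R.fromVertex_injective P hyx])
    (hX.comap_of_injective _ (R.fromVertex_injective P))
  refine ⟨_, ⟨n, hn, rfl⟩, fun x hx => ?_⟩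
  obtain ⟨y, hy, rfl⟩ := hXN hx
  obtain ⟨s, hs⟩ := h y hx
  refine ⟨s, s.2, ?_⟩
  rw [← fromVertex_εAut, hs, map_mul, map_mul, map_inv]

theorem isFusionStar : IsFusionStar p 𝒢.F R.fromSylow (fun i : R.Leaf => i.1.1)
    (R.fromVertex R.base).range (fun i => (R.fromVertex i.1).range)
    fun i => (R.N i.1).map (R.fromVertex i.1) where
  injective := R.fromSylow_injective
  base_mem _ := ⟨_, rfl⟩
  base_conj := by
    rintro _ ⟨a, rfl⟩
    obtain ⟨α, α', h, -, hα⟩ := R.vertex_conj R.base a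
    exact ⟨α, α', h, fun s => hα s (Subgroup.mem_top s)⟩
  leaf_conj := by
    rintro i _ ⟨a, rfl⟩
    obtain ⟨α, α', h, -, hα⟩ := R.vertex_conj i.1 a
    exact ⟨α, α', h, hα⟩
  leaf_mor := by
    rintro i _ ⟨a, rfl⟩ Y f hY hf h
    exact R.vertex_mor i.1 a hY hf h
  edge_le_base := R.isStarAmalgam.map_le_base
  edge_le_leaf _ := by rintro _ ⟨n, -, rfl⟩; exact ⟨n, rfl⟩
  base_sylow X hX hXB := by
    rw [MonoidHom.range_eq_map] at hXB ⊢
    obtain ⟨c, hc, h⟩ := R.vertex_sylow R.base le_top hX hXB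
    exact ⟨c, hc, fun x hx => let ⟨s, _, hs⟩ := h x hx; ⟨s, hs⟩⟩
  leaf_sylow i X hX hXL := by
    rw [MonoidHom.range_eq_map] at hXL ⊢
    exact R.vertex_sylow i.1 le_top hX hXL
  edge_sylow i X hX hXM :=
    R.vertex_sylow i.1 (by rintro _ ⟨s, rfl⟩; exact R.normalizer_le i.1 s i.2) hX hXM

/-- Every automorphism in `F` of a member of the family is induced by conjugation in the amalgam. -/
theorem induced {Q : Subgroup S} (hQ : Q ∈ R.family) {φ ψ : S → S} (h : 𝒢.F.IsoOn Q Q φ ψ) :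
    FusionSystem.Induced R.fromSylow Q φ := by
  obtain ⟨a, ha⟩ := 𝒢.linking.exists_aut (P := R.vertexObj ⟨Q, hQ⟩) h
  obtain ⟨α, α', -, hα, hα'⟩ := R.vertex_conj ⟨Q, hQ⟩ a
  refine ⟨R.fromVertex ⟨Q, hQ⟩ a, fun x hx => ?_⟩
  rw [← hα' x hx, ← hα ⟨x, hx⟩, ha ⟨x, hx⟩]

end RobinsonSetup

/-! ### Conjugation in the colimit of a star of groups -/

/-- The common properties of the cosets of the vertex groups of a star of groups that reflect that
they are the vertices of a tree. -/
structure IsTreeLike {ι G : Type u} [Group G] (B : Subgroup G) (L M : ι → Subgroup G) : Prop where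
  walk : ∀ (X : Set G) (Cb : G → Prop) (Cl : ι → G → Prop),
    (∀ g, ∀ c ∈ B, Cb g → Cb (g * c)) → (∀ i g, ∀ c ∈ L i, Cl i g → Cl i (g * c)) →
    (∀ i g, (∀ x ∈ X, g⁻¹ * x * g ∈ M i) → Cb g → Cl i g) →
    (∀ i g, (∀ x ∈ X, g⁻¹ * x * g ∈ M i) → Cl i g → Cb g) →
    ∀ g g', (∀ x ∈ X, g⁻¹ * x * g ∈ B) → (∀ x ∈ X, g'⁻¹ * x * g' ∈ B) → Cb g → Cb g'
  exists_fixed : ∀ (X : Subgroup G) (g₀ : G),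
    {q : G ⧸ B | ∃ x ∈ X, q = x • (g₀ : G ⧸ B)}.Finite →
    ∃ g, (∀ x ∈ X, g⁻¹ * x * g ∈ B) ∨ ∃ i, ∀ x ∈ X, g⁻¹ * x * g ∈ L i

theorem smul_mk_eq_iff {G : Type*} [Group G] {H : Subgroup G} {x g : G} :
    x • (g : G ⧸ H) = g ↔ g⁻¹ * x * g ∈ H := by
  rw [eq_comm, mul_assoc]
  exact QuotientGroup.eq

theorem IsStarAmalgam.isTreeLike {ι B G : Type u} [Group B] [Group G] {L : ι → Type u}
    [∀ i, Group (L i)] {N : ∀ i, Subgroup (L i)} {k : ∀ i, N i →* B} {b : B →* G}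
    {l : ∀ i, L i →* G} (h : IsStarAmalgam N k b l) :
    IsTreeLike b.range (fun i => (l i).range) fun i => (N i).map (l i) where
  walk X Cb Cl hb hl hbl hlb g g' hg hg' hC := by
    have hinl : ∀ (x a : G), x • (Sum.inl (a : G ⧸ b.range) : StarVertex b l) =
        Sum.inl (a : G ⧸ b.range) ↔ a⁻¹ * x * a ∈ b.range := fun x a =>
      Iff.trans (Sum.inl_injective.eq_iff (a := x • (a : G ⧸ b.range))) smul_mk_eq_iff
    have hinr : ∀ (x a : G) (i : ι), x • (Sum.inr ⟨i, (a : G ⧸ (l i).range)⟩ : StarVertex b l) =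
        Sum.inr ⟨i, (a : G ⧸ (l i).range)⟩ → a⁻¹ * x * a ∈ (l i).range := fun x a i hx => by
      have h1 := Sum.inr_injective (α := G ⧸ b.range)
        (a₁ := (⟨i, x • (a : G ⧸ (l i).range)⟩ : Σ i, G ⧸ (l i).range)) hx
      exact smul_mk_eq_iff.1 (eq_of_heq (Sigma.mk.inj h1).2)
    -- A coset is fixed by `X` when a representative conjugates `X` into the vertex group; an edge
    -- with both ends fixed gives the edge group by `mem_edge_group`.
    let C : StarVertex b l → Prop := Sum.elim (fun q => ∀ a : G, (a : G ⧸ b.range) = q → Cb a)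
      fun v => ∀ a : G, (a : G ⧸ (l v.1).range) = v.2 → Cl v.1 a
    have hstep : ∀ u v, (starTree b l).Adj u v → (∀ x ∈ X, x • u = u) → (∀ x ∈ X, x • v = v) →
        C u → C v := by
      rintro _ _ ⟨a, i, ⟨rfl, rfl⟩ | ⟨rfl, rfl⟩⟩ hu hv hC a' ha'
      · have := hl i a _ (QuotientGroup.eq.1 ha'.symm) (hbl i a (fun x hx => h.mem_edge_group i
          ((hinl x a).1 (hu x hx)) (hinr x a i (hv x hx))) (hC a rfl))
        rwa [mul_inv_cancel_left] at this
      · have := hb a _ (QuotientGroup.eq.1 ha'.symm) (hlb i a (fun x hx => h.mem_edge_group i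
          ((hinl x a).1 (hv x hx)) (hinr x a i (hu x hx))) (hC a rfl))
        rwa [mul_inv_cancel_left] at this
    have hCg : C (Sum.inl (g : G ⧸ b.range)) := fun a ha => by
      have := hb g _ (QuotientGroup.eq.1 ha.symm) hC
      rwa [mul_inv_cancel_left] at this
    exact h.starTree_isTree.fixed_induction starTree_smul X hstep (C := C)
      (fun x hx => (hinl x g).2 (hg x hx)) (fun x hx => (hinl x g').2 (hg' x hx)) hCg g' rfl
  exists_fixed X g₀ hfin := by
    obtain ⟨v, hv⟩ := h.starTree_isTree.exists_fixed starTree_smul starTree_not_adj_smul X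
      (Sum.inl (g₀ : G ⧸ b.range)) ((hfin.image Sum.inl).subset (by
        rintro _ ⟨x, hx, rfl⟩
        exact ⟨_, ⟨x, hx, rfl⟩, rfl⟩))
    obtain q | ⟨i, q⟩ := v
    · obtain ⟨g, rfl⟩ := QuotientGroup.mk_surjective q
      exact ⟨g, Or.inl fun x hx => smul_mk_eq_iff.1 (Sum.inl_injective (hv x hx))⟩
    · obtain ⟨g, rfl⟩ := QuotientGroup.mk_surjective q
      exact ⟨g, Or.inr ⟨i, fun x hx => smul_mk_eq_iff.1
        (eq_of_heq (Sigma.mk.inj (Sum.inr_injective (hv x hx))).2)⟩⟩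

namespace IsFusionStar

open FusionSystem

variable {p : ℕ} [hp : Fact p.Prime] {S : Type u} [Group S] {F : FusionSystem S} {T : Subgroup S}
  {m : ℕ} {ι G : Type u} [Group G] {j : S →* G} {P : ι → Subgroup S} {B : Subgroup G}
  {L M : ι → Subgroup G}

/-- If a conjugate of `X` lies in an edge group, then it can be moved into the Sylow subgroup of
that group. -/
theorem exists_edge_frame (h : IsFusionStar p F j P B L M) {i : ι} {g : G} {X : Subgroup G}
    (hX : IsPGroup p X) (hg : ∀ x ∈ X, g⁻¹ * x * g ∈ M i) :
    ∃ d ∈ M i, ∀ x ∈ X, ∃ s ∈ Subgroup.normalizer (P i : Set S), j s = (g * d)⁻¹ * x * (g * d) := by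
  obtain ⟨c, hc, hcs⟩ := h.edge_sylow i (X.map (MulAut.conj g⁻¹).toMonoidHom) (hX.map _) (by
    rintro _ ⟨x, hx, rfl⟩
    simpa using hg x hx)
  refine ⟨c⁻¹, inv_mem hc, fun x hx => ?_⟩
  obtain ⟨s, hs, hsx⟩ := hcs _ ⟨x, hx, rfl⟩
  refine ⟨s, hs, hsx.symm.trans ?_⟩
  simp [mul_assoc]

/-- Conjugation in `G` induces morphisms of `F`. -/
theorem mor_of_conj (h : IsFusionStar p F j P B L M) (ht : IsTreeLike B L M)
    (hT : IsMaximalTorus p T m) {Q : Subgroup S} {f : S → S} {g : G}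
    (hf : ∀ x ∈ Q, j (f x) = g * j x * g⁻¹) : F.Mor Q f := by
  have hX : IsPGroup p (Q.map j) := (hT.isPGroup Q).map j
  have hedge : ∀ i a, (∀ x ∈ Q.map j, a⁻¹ * x * a ∈ M i) → ∃ d ∈ M i, ∃ f' : S → S,
      ∀ x ∈ Q, f' x ∈ Subgroup.normalizer (P i : Set S) ∧ j (f' x) = (a * d)⁻¹ * j x * (a * d) := by
    intro i a ha
    obtain ⟨d, hd, hs⟩ := h.exists_edge_frame hX ha
    choose! f' hf' using fun x (hx : x ∈ Q) => hs (j x) ⟨x, hx, rfl⟩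
    exact ⟨d, hd, f', hf'⟩
  -- The property carried along the path: relative to a suitable representative of the coset, `Q` is
  -- conjugated into `S` by a morphism of `F`. At a leaf the image must also lie in `N_S(P i)`, as
  -- `leaf_mor` requires.
  have hwalk := ht.walk (Q.map j)
    (fun a => ∃ c ∈ B, ∃ f' : S → S, F.Mor Q f' ∧ ∀ x ∈ Q, j (f' x) = (a * c)⁻¹ * j x * (a * c))
    (fun i a => ∃ c ∈ L i, ∃ f' : S → S, F.Mor Q f' ∧ ∀ x ∈ Q,
      f' x ∈ Subgroup.normalizer (P i : Set S) ∧ j (f' x) = (a * c)⁻¹ * j x * (a * c))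
    (fun a d hd ⟨c, hc, f', hf'⟩ =>
        ⟨d⁻¹ * c, mul_mem (inv_mem hd) hc, f', by simpa [mul_assoc] using hf'⟩)
    (fun i a d hd ⟨c, hc, f', hf'⟩ =>
        ⟨d⁻¹ * c, mul_mem (inv_mem hd) hc, f', by simpa [mul_assoc] using hf'⟩)
    (fun i a ha ⟨c, hc, f', hf', hc'⟩ => by
      obtain ⟨d, hd, f₁, hf₁⟩ := hedge i a ha
      refine ⟨d, h.edge_le_leaf i hd, f₁, ?_, hf₁⟩
      obtain ⟨α, α', iα, hα⟩ := h.base_conj (d⁻¹ * c) (mul_mem (inv_mem (h.edge_le_base i hd)) hc)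
      refine (iα.mor.comp hf' fun _ _ => Subgroup.mem_top _).congr fun x hx => h.injective ?_
      rw [hα, (hf₁ x hx).2, hc' x hx]
      group)
    (fun i a ha ⟨c, hc, f', hf', hc'⟩ => by
      obtain ⟨d, hd, f₁, hf₁⟩ := hedge i a ha
      refine ⟨d, h.edge_le_base i hd, f₁, ?_, fun x hx => (hf₁ x hx).2⟩
      obtain ⟨Q', ψ, iψ⟩ := hf'.exists_isoOn
      have := h.leaf_mor i (d⁻¹ * c) (mul_mem (inv_mem (h.edge_le_leaf i hd)) hc) Q'
        (fun y => f₁ (ψ y)) (fun y hy => by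
          rw [← iψ.right_inv y hy]; exact (hc' _ (iψ.maps_symm y hy)).1)
        (fun y hy => (hf₁ _ (iψ.maps_symm y hy)).1) (fun y hy => by
          rw [(hf₁ _ (iψ.maps_symm y hy)).2]
          conv_rhs => rw [← iψ.right_inv y hy]
          rw [(hc' _ (iψ.maps_symm y hy)).2]
          group)
      refine (this.comp hf' iψ.maps).congr fun x hx => ?_
      rw [iψ.left_inv x hx])
    1 g⁻¹ (by
      rintro _ ⟨x, hx, rfl⟩
      simpa using h.base_mem x) (by
      rintro _ ⟨x, hx, rfl⟩
      rw [inv_inv, ← hf x hx]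
      exact h.base_mem _) ⟨1, one_mem B, fun x => x, Mor.id Q, by simp⟩
  obtain ⟨c, hc, f', hf', hc'⟩ := hwalk
  obtain ⟨α, α', iα, hα⟩ := h.base_conj c hc
  refine (iα.mor.comp hf' fun _ _ => Subgroup.mem_top _).congr fun x hx => h.injective ?_
  rw [hα, hf x hx, hc' x hx]
  group

/-- `X` fixes a vertex, so it is conjugate into a vertex group and from there into its Sylow
subgroup. -/
theorem exists_conj_of_finite_orbit (h : IsFusionStar p F j P B L M) (ht : IsTreeLike B L M)
    {X : Subgroup G} (hX : IsPGroup p X) (g₀ : G)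
    (hfin : {q : G ⧸ B | ∃ x ∈ X, q = x • (g₀ : G ⧸ B)}.Finite) :
    ∃ g, ∀ x ∈ X, ∃ s, j s = g⁻¹ * x * g := by
  obtain ⟨g, hg⟩ := ht.exists_fixed X g₀ hfin
  obtain ⟨c, hc⟩ : ∃ c, ∀ x ∈ X.map (MulAut.conj g⁻¹).toMonoidHom, ∃ s, c * x * c⁻¹ = j s := by
    obtain hg | ⟨i, hg⟩ := hg
    · obtain ⟨c, -, hc⟩ := h.base_sylow (X.map (MulAut.conj g⁻¹).toMonoidHom) (hX.map _) (by
        rintro _ ⟨x, hx, rfl⟩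
        simpa using hg x hx)
      exact ⟨c, hc⟩
    · obtain ⟨c, -, hc⟩ := h.leaf_sylow i (X.map (MulAut.conj g⁻¹).toMonoidHom) (hX.map _) (by
        rintro _ ⟨x, hx, rfl⟩
        simpa using hg x hx)
      exact ⟨c, fun x hx => let ⟨s, _, hs⟩ := hc x hx; ⟨s, hs⟩⟩
  refine ⟨g * c⁻¹, fun x hx => ?_⟩
  obtain ⟨s, hs⟩ := hc _ ⟨x, hx, rfl⟩
  refine ⟨s, hs.symm.trans ?_⟩
  simp [mul_assoc]

end IsFusionStar

/-! ### Discrete tori in the colimit of a star of groups -/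

theorem Set.Finite.exists_forall_of_monotone {α : Type*} {Z : Set α} (hZ : Z.Finite)
    {Q : α → ℕ → Prop} (hmono : ∀ z m n, m ≤ n → Q z m → Q z n) (h : ∀ z ∈ Z, ∃ n, Q z n) :
    ∃ n, ∀ z ∈ Z, Q z n := by
  choose! n hn using h
  obtain ⟨M, hM⟩ := (hZ.image n).bddAbove
  exact ⟨M, fun z hz => hmono z _ _ (hM ⟨z, hz, rfl⟩) (hn z hz)⟩

theorem pow_pow_eq_one_of_le {G : Type*} [Group G] {p m n : ℕ} {x : G} (h : m ≤ n)
    (hx : x ^ p ^ m = 1) : x ^ p ^ n = 1 := by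
  rw [← Nat.add_sub_cancel' h, pow_add, pow_mul, hx, one_pow]

namespace FusionSystem

variable {p : ℕ} [hp : Fact p.Prime] {S : Type u} [Group S] {F : FusionSystem S} {T : Subgroup S}
  {m : ℕ} {D : Subgroup S}

/-- Automorphisms of the torus in `F` that agree on a large finite part of `D` agree on `D`. -/
theorem exists_agree_bound (hT : IsMaximalTorus p T m) (hF : F.IsSaturated p) (hD : D ≤ T) :
    ∃ n : ℕ, ∀ v w, F.Mor T v → F.Mor T w → (∀ t ∈ D, t ^ p ^ n = 1 → v t = w t) →
      ∀ t ∈ D, v t = w t := by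
  have hfin := finite_torus_automorphisms hT hF
  obtain ⟨n, hn⟩ := (hfin.prod hfin).exists_forall_of_monotone
    (Q := fun z n => (∀ t (ht : t ∈ D), t ^ p ^ n = 1 → z.1 ⟨t, hD ht⟩ = z.2 ⟨t, hD ht⟩) →
      ∀ t (ht : t ∈ D), z.1 ⟨t, hD ht⟩ = z.2 ⟨t, hD ht⟩)
    (fun z m n hmn hz h => hz fun t ht htm => h t ht (pow_pow_eq_one_of_le hmn htm)) (by
      rintro z -
      by_cases hz : ∀ t (ht : t ∈ D), z.1 ⟨t, hD ht⟩ = z.2 ⟨t, hD ht⟩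
      · exact ⟨0, fun _ => hz⟩
      · push Not at hz
        obtain ⟨t, ht, hne⟩ := hz
        obtain ⟨n, hn⟩ := hT.exists_pow_eq_one t
        exact ⟨n, fun h => absurd (h t ht hn) hne⟩)
  exact ⟨n, fun v w hv hw h => hn (fun t => v t, fun t => w t)
    ⟨⟨v, hv, fun _ => rfl⟩, ⟨w, hw, fun _ => rfl⟩⟩ h⟩

/-- If an automorphism of the torus in `F` maps a large finite part of `D` to a group `N` of finite
exponent over `K`, then it maps `D` to `K`. -/
theorem exists_mem_bound (hT : IsMaximalTorus p T m) (hF : F.IsSaturated p) (hD : D ≤ T)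
    (hdiv : IsPDivisible p D) {ι : Type*} [Finite ι] (N K : ι → Subgroup S)
    (hNK : ∀ i, ∃ c : ℕ, ∀ g ∈ N i, g ^ p ^ c ∈ K i) :
    ∃ n : ℕ, ∀ i w, F.Mor T w → (∀ t ∈ D, t ^ p ^ n = 1 → w t ∈ N i) → ∀ t ∈ D, w t ∈ K i := by
  have hfin := finite_torus_automorphisms hT hF
  obtain ⟨n, hn⟩ := ((Set.finite_univ (α := ι)).prod hfin).exists_forall_of_monotone
    (Q := fun z n => (∀ t (ht : t ∈ D), t ^ p ^ n = 1 → z.2 ⟨t, hD ht⟩ ∈ N z.1) →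
      ∀ t (ht : t ∈ D), z.2 ⟨t, hD ht⟩ ∈ K z.1)
    (fun z m n hmn hz h => hz fun t ht htm => h t ht (pow_pow_eq_one_of_le hmn htm)) (by
      rintro ⟨i, f⟩ ⟨-, w, hw, hf⟩
      by_cases hz : ∀ t (ht : t ∈ D), f ⟨t, hD ht⟩ ∈ K i
      · exact ⟨0, fun _ => hz⟩
      · push Not at hz
        obtain ⟨t, ht, hne⟩ := hz
        obtain ⟨c, hc⟩ := hNK i
        -- If `w t` is outside `K i`, then `w y` is outside `N i` for a `p ^ c`-th root `y`; a level
        -- containing `y` excludes this automorphism.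
        obtain ⟨y, hy, rfl⟩ := hdiv.exists_pow c t ht
        obtain ⟨n, hn⟩ := hT.exists_pow_eq_one y
        refine ⟨n, fun h => absurd ?_ hne⟩
        have := hc _ (h y hy hn)
        rw [hf, ← hw.map_pow (hD hy)] at this
        have hf' : f ⟨_, hD ht⟩ = w (y ^ p ^ c) := hf _
        rwa [hf'])
  exact ⟨n, fun i w hw h => hn (i, fun t => w t) ⟨Set.mem_univ _, w, hw, fun _ => rfl⟩ h⟩

/-- A morphism on a large finite part of a divisible subgroup `D` of the torus extends to the
torus. -/
theorem exists_torus_extension_of_bound (hT : IsMaximalTorus p T m) (hF : F.IsSaturated p)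
    (hD : D ≤ T) (hdiv : IsPDivisible p D) {K n : ℕ} (hn : K + m ≤ n)
    (hK : ∀ v w, F.Mor T v → F.Mor T w → (∀ t ∈ D, t ^ p ^ K = 1 → v t = w t) →
      ∀ t ∈ D, v t = w t) {Y : Subgroup S} (hY : ∀ t, t ∈ Y ↔ t ∈ D ∧ t ^ p ^ n = 1) {f : S → S}
    (hf : F.Mor Y f) : ∃ w, F.Mor T w ∧ ∀ t ∈ Y, f t = w t := by
  obtain ⟨w, hw, hwf⟩ := exists_torus_mor hT hF hf
  refine ⟨w, hw, fun t ht => eq_on_torusHull hT hF hf hw hwf ht ?_⟩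
  -- As `K + m ≤ n`, the `p ^ m`-th powers of `Y` exhaust the part of `D` of exponent `p ^ K`, which
  -- determines automorphisms on `D`. So `D` lies in the torus hull of `Y`.
  have hDh : D ≤ F.hull T (powers p m Y) := fun x hx => ⟨hD hx, fun v hv hvA => ?_⟩
  · exact le_divisiblePart hDh hdiv ((hY t).1 ht).1
  refine hK v (fun x => x) hv (Mor.id T) (fun a ha haK => hvA a ?_) x hx
  obtain ⟨y, hy, rfl⟩ := hdiv.exists_pow m a ha
  refine ⟨y, (hY y).2 ⟨hy, pow_pow_eq_one_of_le hn ?_⟩, rfl⟩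
  rw [add_comm, pow_add, pow_mul]
  exact haK

end FusionSystem

namespace IsFusionStar

open FusionSystem

variable {p : ℕ} [hp : Fact p.Prime] {S : Type u} [Group S] {F : FusionSystem S} {T : Subgroup S}
  {m : ℕ} {ι G : Type u} [Group G] {j : S →* G} {P : ι → Subgroup S} {B : Subgroup G}
  {L M : ι → Subgroup G}

/-- A map from a divisible subgroup of the torus to `G` that is conjugation in `G` on each finite
subgroup is conjugation in `G`. -/
theorem exists_conj_of_locally_conj [Finite ι] (h : IsFusionStar p F j P B L M)
    (ht : IsTreeLike B L M) (hT : IsMaximalTorus p T m) (hF : F.IsSaturated p)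
    (hP : ∀ i, ∃ c : ℕ, ∀ g ∈ Subgroup.normalizer (P i : Set S), g ^ p ^ c ∈ P i)
    {D : Subgroup S} (hdiv : IsPDivisible p D) {τ : S → G}
    (hτ : ∀ k : ℕ, ∃ g, ∀ t ∈ D, t ^ p ^ k = 1 → τ t = g * j t * g⁻¹) :
    ∃ g, ∀ t ∈ D, τ t = g * j t * g⁻¹ := by
  have hD : D ≤ T := hT.le_of_divisible hdiv
  obtain ⟨K, hK⟩ := exists_agree_bound hT hF hD
  obtain ⟨K', hK'⟩ := exists_mem_bound hT hF hD hdiv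
    (fun i => Subgroup.normalizer (P i : Set S)) P hP
  -- At this level morphisms on `Y` extend uniquely to `D`, and one that maps `Y` into `N_S(P i)`
  -- maps `D` into `P i`.
  let n := max (K + m) K'
  have hcomm : ∀ x ∈ D, ∀ y ∈ D, x * y = y * x := fun x hx y hy => hT.comm x (hD hx) y (hD hy)
  let Y : Subgroup S := torsionSubgroup D hcomm (p ^ n)
  have hY : ∀ t, t ∈ Y ↔ t ∈ D ∧ t ^ p ^ n = 1 := fun t => Iff.rfl
  have hKY : ∀ t ∈ D, t ^ p ^ K = 1 → t ∈ Y := fun t ht htK =>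
    ⟨ht, pow_pow_eq_one_of_le ((Nat.le_add_right K m).trans (le_max_left _ _)) htK⟩
  obtain ⟨g₀, hg₀⟩ := hτ n
  let X : Subgroup G := Y.map ((MulAut.conj g₀).toMonoidHom.comp j)
  have hX : IsPGroup p X := (hT.isPGroup Y).map _
  have hXmem : ∀ t ∈ Y, g₀ * j t * g₀⁻¹ ∈ X := fun t ht => ⟨t, ht, rfl⟩
  -- A morphism defined on the image of `D` is determined on `D` by its effect on `Y`.
  have hagree : ∀ {Q : Subgroup S} {α w v : S → S}, F.Mor Q α → F.Mor T w → F.Mor T v →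
      (∀ t ∈ D, w t ∈ Q) → (∀ t ∈ Y, v t = α (w t)) → ∀ t ∈ D, v t = α (w t) := by
    intro Q α w v hα hw hv hwQ hY' t htD
    have hαw : F.Mor D fun x => α (w x) := hα.comp (hw.mono hD) hwQ
    obtain ⟨u, hu, huα⟩ := exists_torus_extension hT hF hαw hD fun x hx =>
      hαw.map_mem_torus hT hdiv hx
    rw [← huα t htD]
    exact hK v u hv hu (fun x hx hxK => by rw [hY' x (hKY x hx hxK), huα x hx]) t htD
  have hedge : ∀ i a, (∀ x ∈ X, a⁻¹ * x * a ∈ M i) → ∃ d ∈ M i, ∃ w : S → S, F.Mor T w ∧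
      (∀ t ∈ D, w t ∈ P i) ∧
      ∀ t ∈ Y, j (w t) = (a * d)⁻¹ * (g₀ * j t * g₀⁻¹) * (a * d) := by
    intro i a ha
    obtain ⟨d, hd, hs⟩ := h.exists_edge_frame hX ha
    choose! f hfN hf using fun t (ht : t ∈ Y) => hs _ (hXmem t ht)
    obtain ⟨w, hw, hfw⟩ := exists_torus_extension_of_bound hT hF hD hdiv (le_max_left _ _) hK hY
      (h.mor_of_conj ht hT (Q := Y) (f := f) (g := (a * d)⁻¹ * g₀) fun x hx => by
        rw [hf x hx]; group)
    refine ⟨d, hd, w, hw, hK' i w hw fun t htD htK => ?_, fun t htY => ?_⟩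
    · have htY : t ∈ Y := ⟨htD, pow_pow_eq_one_of_le (le_max_right _ _) htK⟩
      rw [← hfw t htY]
      exact hfN t htY
    · rw [← hfw t htY, hf t htY]
  -- The element found for level `n` works at all levels. With `g` for a level containing `t`, the
  -- finite group `X` fixes the vertices of `g₀` and of `g`; walking between them transports data on
  -- all of `D`, since at each step `Y` determines `D`.
  refine ⟨g₀, fun t htD => ?_⟩
  obtain ⟨k, hk⟩ := hT.exists_pow_eq_one t
  obtain ⟨g, hg⟩ := hτ (max n k)
  have hgY : ∀ y ∈ Y, g₀ * j y * g₀⁻¹ = g * j y * g⁻¹ := fun y hy =>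
    (hg₀ y hy.1 hy.2).symm.trans (hg y hy.1 (pow_pow_eq_one_of_le (le_max_left _ _) hy.2))
  obtain ⟨c, hc, w, hw, hwc⟩ := ht.walk X
    (fun a => ∃ c ∈ B, ∃ w : S → S, F.Mor T w ∧
      ∀ t ∈ D, j (w t) = (a * c)⁻¹ * (g₀ * j t * g₀⁻¹) * (a * c))
    (fun i a => ∃ c ∈ L i, ∃ w : S → S, F.Mor T w ∧ (∀ t ∈ D, w t ∈ P i) ∧
      ∀ t ∈ D, j (w t) = (a * c)⁻¹ * (g₀ * j t * g₀⁻¹) * (a * c))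
    (fun a d hd ⟨c, hc, w, hw⟩ =>
      ⟨d⁻¹ * c, mul_mem (inv_mem hd) hc, w, by simpa [mul_assoc] using hw⟩)
    (fun i a d hd ⟨c, hc, w, hw⟩ =>
      ⟨d⁻¹ * c, mul_mem (inv_mem hd) hc, w, by simpa [mul_assoc] using hw⟩)
    (fun i a ha ⟨c, hc, w, hw, hwc⟩ => by
      obtain ⟨d, hd, v, hv, hvP, hvd⟩ := hedge i a ha
      refine ⟨d, h.edge_le_leaf i hd, v, hv, hvP, fun t htD => ?_⟩
      obtain ⟨α, α', iα, hα⟩ := h.base_conj (d⁻¹ * c) (mul_mem (inv_mem (h.edge_le_base i hd)) hc)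
      rw [hagree iα.mor hw hv (fun _ _ => Subgroup.mem_top _) (fun y hy => h.injective (by
        rw [hα, hvd y hy, hwc y hy.1]; group)) t htD, hα, hwc t htD]
      group)
    (fun i a ha ⟨c, hc, w, hw, hwP, hwc⟩ => by
      obtain ⟨d, hd, v, hv, hvP, hvd⟩ := hedge i a ha
      refine ⟨d, h.edge_le_base i hd, v, hv, fun t htD => ?_⟩
      obtain ⟨α, α', iα, hα⟩ := h.leaf_conj i (d⁻¹ * c)
        (mul_mem (inv_mem (h.edge_le_leaf i hd)) hc)
      rw [hagree iα.mor hw hv hwP (fun y hy => h.injective (by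
        rw [hα _ (hwP y hy.1), hvd y hy, hwc y hy.1]; group)) t htD, hα _ (hwP t htD), hwc t htD]
      group)
    g₀ g (by
      rintro _ ⟨y, hy, rfl⟩
      simpa [mul_assoc] using h.base_mem y) (by
      rintro _ ⟨y, hy, rfl⟩
      have : g⁻¹ * (g₀ * j y * g₀⁻¹) * g = j y := by rw [hgY y hy]; group
      exact this ▸ h.base_mem y)
    ⟨1, one_mem B, fun x => x, Mor.id T, fun t _ => by group⟩
  obtain ⟨α, α', iα, hα⟩ := h.base_conj c hc
  -- `g₀` and `g` agree on `Y`, so the transported map is the identity there and hence on `D`. So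
  -- `g⁻¹ * g₀` centralizes `j t`.
  have h1 := hagree iα.mor hw (Mor.id T) (fun _ _ => Subgroup.mem_top _)
      (fun y hy => h.injective (by
    rw [hα, hwc y hy.1, hgY y hy]; group)) t htD
  have h2 : j t = g⁻¹ * (g₀ * j t * g₀⁻¹) * g := by
    refine (congrArg j h1).trans ?_
    rw [hα, hwc t htD]
    group
  rw [hg t htD (pow_pow_eq_one_of_le (le_max_right _ _) hk)]
  conv_lhs => rw [h2]
  group

end IsFusionStar

/-! ### Conjugating discrete tori and discrete `p`-toral subgroups into `S`. -/

namespace IsFusionStar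

open FusionSystem

variable {p : ℕ} [hp : Fact p.Prime] {S : Type u} [Group S] {F : FusionSystem S} {T : Subgroup S}
  {m : ℕ} {ι G : Type u} [Group G] {j : S →* G} {P : ι → Subgroup S} {B : Subgroup G}
  {L M : ι → Subgroup G}

/-- On a discrete torus of `G` there is a map to the torus of `S` which is conjugation in `G` on
each finite subgroup. -/
theorem exists_locally_conj (h : IsFusionStar p F j P B L M) (ht : IsTreeLike B L M)
    (hT : IsMaximalTorus p T m) {A : Subgroup G} (hA : IsDiscreteTorus p A) :
    ∃ f : G → S, ∀ k : ℕ, ∃ g, ∀ a ∈ A, a ^ p ^ k = 1 → j (f a) = g⁻¹ * a * g := by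
  have hfin : ∀ k : ℕ, {a | a ∈ A ∧ a ^ p ^ k = 1}.Finite := finite_torsion hA.comm hA.fin
  have hconj : ∀ n : ℕ, ∃ g, ∀ a, a ∈ A ∧ a ^ p ^ n = 1 → ∃ s, j s = g⁻¹ * a * g := by
    intro n
    refine h.exists_conj_of_finite_orbit ht (X := torsionSubgroup A hA.comm (p ^ n))
      (fun x => ⟨n, Subtype.ext (by simpa using x.2.2)⟩) 1 (((hfin n).image
        fun a => a • ((1 : G) : G ⧸ B)).subset ?_)
    rintro _ ⟨x, hx, rfl⟩
    exact ⟨x, hx, rfl⟩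
  choose g hg using hconj
  choose! η hη using hg
  -- The maps `η n` need not be compatible, so a limit along an ultrafilter is taken. Writing `a` as
  -- a `p ^ m`-th power puts `η n a` in `T` for large `n`, so its values lie in a finite torsion set
  -- and the limit exists.
  have hlim : ∀ a ∈ A, ∃ s, ∀ᶠ n in (Filter.hyperfilter ℕ : Filter ℕ), η n a = s := by
    intro a ha
    obtain ⟨k, hk⟩ := hA.tors a ha
    obtain ⟨y, hy, rfl⟩ := hA.div.exists_pow m a ha
    have hmem : {s | s ∈ T ∧ s ^ p ^ k = 1} ∈
        (Filter.hyperfilter ℕ).map fun n => η n (y ^ p ^ m) := by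
      have : ∀ᶠ n in (Filter.hyperfilter ℕ : Filter ℕ), m + k ≤ n :=
        Nat.hyperfilter_le_atTop (Filter.eventually_ge_atTop (m + k))
      refine Ultrafilter.mem_map.2 (Filter.mem_of_superset this fun n hn => ?_)
      have hkn : (y ^ p ^ m) ^ p ^ n = 1 :=
        pow_pow_eq_one_of_le ((Nat.le_add_left k m).trans hn) hk
      have hyn : y ^ p ^ n = 1 :=
        pow_pow_eq_one_of_le hn (by rw [pow_add, pow_mul, hk])
      have h1 : η n (y ^ p ^ m) = η n y ^ p ^ m := h.injective (by
        rw [map_pow, hη n _ ⟨ha, hkn⟩, hη n _ ⟨hy, hyn⟩]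
        simpa using (conj_pow (a := (g n)⁻¹) (b := y) (i := p ^ m)).symm)
      refine ⟨?_, h.injective ?_⟩
      · change η n (y ^ p ^ m) ∈ T
        rw [h1]
        exact hT.pow_mem _
      · rw [map_pow, map_one, hη n _ ⟨ha, hkn⟩]
        have := conj_pow (a := (g n)⁻¹) (b := y ^ p ^ m) (i := p ^ k)
        rw [inv_inv, hk] at this
        simpa using this
    obtain ⟨s, -, hs⟩ := Ultrafilter.eq_pure_of_finite_mem (hT.finite_torsion k) hmem
    refine ⟨s, ?_⟩
    have : ({s} : Set S) ∈ (Filter.hyperfilter ℕ).map fun n => η n (y ^ p ^ m) := by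
      rw [hs]; exact Set.mem_singleton s
    exact this
  choose! f hf using hlim
  refine ⟨f, fun k => ?_⟩
  -- On a finite torsion part the limit equals one single `η n`.
  have h1 : ∀ᶠ n in (Filter.hyperfilter ℕ : Filter ℕ), ∀ a ∈ {a | a ∈ A ∧ a ^ p ^ k = 1},
      η n a = f a := (Filter.eventually_all_finite (hfin k)).2 fun a ha => hf a ha.1
  have h2 : ∀ᶠ n in (Filter.hyperfilter ℕ : Filter ℕ), k ≤ n :=
    Nat.hyperfilter_le_atTop (Filter.eventually_ge_atTop k)
  obtain ⟨n, hn, hkn⟩ := (h1.and h2).exists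
  exact ⟨g n, fun a ha hak => by
    rw [← hn a ⟨ha, hak⟩, hη n a ⟨ha, pow_pow_eq_one_of_le hkn hak⟩]⟩

/-- A discrete torus of `G` is conjugate to a subgroup of `S`. -/
theorem exists_conj_of_isDiscreteTorus [Finite ι] (h : IsFusionStar p F j P B L M)
    (ht : IsTreeLike B L M) (hT : IsMaximalTorus p T m) (hF : F.IsSaturated p)
    (hP : ∀ i, ∃ c : ℕ, ∀ g ∈ Subgroup.normalizer (P i : Set S), g ^ p ^ c ∈ P i)
    {A : Subgroup G} (hA : IsDiscreteTorus p A) : ∃ g, ∀ a ∈ A, ∃ s, j s = g⁻¹ * a * g := by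
  obtain ⟨f, hf⟩ := h.exists_locally_conj ht hT hA
  have hf₂ : ∀ a ∈ A, ∀ b ∈ A, ∃ g, j (f a) = g⁻¹ * a * g ∧ j (f b) = g⁻¹ * b * g ∧
      j (f (a * b)) = g⁻¹ * (a * b) * g ∧ j (f a⁻¹) = g⁻¹ * a⁻¹ * g := by
    intro a ha b hb
    obtain ⟨k, hk⟩ := hA.tors a ha
    obtain ⟨l, hl⟩ := hA.tors b hb
    obtain ⟨g, hg⟩ := hf (max k l)
    have ha' := pow_pow_eq_one_of_le (le_max_left k l) hk
    have hb' := pow_pow_eq_one_of_le (le_max_right k l) hl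
    exact ⟨g, hg a ha ha', hg b hb hb', hg _ (mul_mem ha hb) (by
      rw [mul_pow_of_comm hA.comm ha hb, ha', hb', one_mul]), hg _ (inv_mem ha) (by
      rw [inv_pow, ha', inv_one])⟩
  have hmul : ∀ a ∈ A, ∀ b ∈ A, f (a * b) = f a * f b := fun a ha b hb => by
    obtain ⟨g, h1, h2, h3, -⟩ := hf₂ a ha b hb
    exact h.injective (by rw [map_mul, h1, h2, h3]; group)
  have hinv : ∀ a ∈ A, f a⁻¹ = (f a)⁻¹ := fun a ha => by
    obtain ⟨g, h1, -, -, h4⟩ := hf₂ a ha a ha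
    exact h.injective (by rw [map_inv, h1, h4]; group)
  have hone : f 1 = 1 := by simpa using hmul 1 (one_mem A) 1 (one_mem A)
  have hpow : ∀ a ∈ A, ∀ n : ℕ, f (a ^ n) = f a ^ n := fun a ha n => by
    induction n with
    | zero => simpa using hone
    | succ n ih => rw [pow_succ, pow_succ, hmul _ (pow_mem ha n) _ ha, ih]
  have hinj : Set.InjOn f A := fun a ha b hb hab => by
    obtain ⟨g, h1, h2, -⟩ := hf₂ a ha b hb
    rw [hab, h2] at h1
    simpa using h1.symm
  -- `f` is an injective homomorphism on `A`, being conjugation on each finite part; the gluing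
  -- result is applied to its inverse on the image `D`.
  let D : Subgroup S :=
    { carrier := f '' A
      one_mem' := ⟨1, one_mem A, hone⟩
      mul_mem' := by
        rintro _ _ ⟨a, ha, rfl⟩ ⟨b, hb, rfl⟩
        exact ⟨a * b, mul_mem ha hb, hmul a ha b hb⟩
      inv_mem' := by
        rintro _ ⟨a, ha, rfl⟩
        exact ⟨a⁻¹, inv_mem ha, hinv a ha⟩ }
  have hD : IsPDivisible p D := by
    rintro _ ⟨a, ha, rfl⟩
    obtain ⟨b, hb, rfl⟩ := hA.div a ha
    exact ⟨f b, ⟨b, hb, rfl⟩, (hpow b hb p).symm⟩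
  have hτ : ∀ a ∈ A, Function.invFunOn f A (f a) = a := hinj.leftInvOn_invFunOn
  obtain ⟨g, hg⟩ := h.exists_conj_of_locally_conj ht hT hF hP hD (τ := Function.invFunOn f A)
    fun k => by
      obtain ⟨g, hg⟩ := hf k
      refine ⟨g, ?_⟩
      rintro _ ⟨a, ha, rfl⟩ hk
      rw [← hpow a ha, ← hone] at hk
      rw [hτ a ha, hg a ha (hinj (pow_mem ha _) (one_mem A) hk)]
      group
  refine ⟨g, fun a ha => ⟨f a, ?_⟩⟩
  have := hg (f a) ⟨a, ha, rfl⟩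
  rw [hτ a ha] at this
  conv_rhs => rw [this]
  group

/-- A discrete `p`-toral subgroup of `G` is conjugate to a subgroup of `S`. -/
theorem exists_conj_of_isDiscretePToral [Finite ι] (h : IsFusionStar p F j P B L M)
    (ht : IsTreeLike B L M) (hT : IsMaximalTorus p T m) (hF : F.IsSaturated p)
    (hP : ∀ i, ∃ c : ℕ, ∀ g ∈ Subgroup.normalizer (P i : Set S), g ^ p ^ c ∈ P i)
    {Q : Subgroup G} (hQ : IsDiscretePToral p Q) : ∃ g, ∀ x ∈ Q, ∃ s, j s = g⁻¹ * x * g := by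
  obtain ⟨A, n, hA⟩ := hQ.exists_maximalTorus
  have hA' : IsDiscreteTorus p (A.map Q.subtype) := by
    refine ⟨?_, ?_, ?_, hA.div.map _⟩
    · rintro _ ⟨x, hx, rfl⟩ _ ⟨y, hy, rfl⟩
      exact congrArg Subtype.val (hA.comm x hx y hy)
    · rintro _ ⟨x, hx, rfl⟩
      obtain ⟨k, hk⟩ := hA.tors x hx
      exact ⟨k, congrArg Subtype.val hk⟩
    · refine (hA.fin.image Q.subtype).subset ?_
      rintro _ ⟨⟨x, hx, rfl⟩, hx'⟩
      exact ⟨x, ⟨hx, Subtype.ext hx'⟩, rfl⟩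
  obtain ⟨g, hg⟩ := h.exists_conj_of_isDiscreteTorus ht hT hF hP hA'
  refine h.exists_conj_of_finite_orbit ht hQ.isPGroup g ?_
  have := hA.finite_quotient
  -- The torus fixes the coset of `g`, so its `Q`-orbit is indexed by the finite quotient `Q ⧸ A`.
  refine (Set.finite_range fun q : Q ⧸ A => (q.out : G) • (g : G ⧸ B)).subset ?_
  rintro _ ⟨x, hx, rfl⟩
  obtain ⟨a, ha⟩ := QuotientGroup.mk_out_eq_mul A ⟨x, hx⟩
  refine ⟨((⟨x, hx⟩ : Q) : Q ⧸ A), ?_⟩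
  have h1 : ((a : Q) : G) • (g : G ⧸ B) = g := by
    obtain ⟨s, hs⟩ := hg a ⟨a, a.2, rfl⟩
    exact smul_mk_eq_iff.2 (hs ▸ h.base_mem s)
  change ((Quotient.out _ : Q) : G) • (g : G ⧸ B) = _
  rw [ha, Subgroup.coe_mul, mul_smul, h1]

end IsFusionStar

theorem mainTheorem4 {p : ℕ} [Fact p.Prime] {S : Type u} [Group S]
    (𝒢 : PLocalCompactGroup p S) (R : RobinsonSetup 𝒢) :
    ∃ hinj : Function.Injective R.fromSylow,
      IsSylowSubgroup p R.fromSylow.range ∧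
      FusionSystem.ofGroup R.fromSylow hinj = 𝒢.F := by
  obtain ⟨T, m, hT⟩ := 𝒢.toral.exists_maximalTorus
  have ht := R.isStarAmalgam.isTreeLike
  have h := R.isFusionStar
  have : Finite R.Leaf := by
    have : Finite R.family := R.controlling.finite
    infer_instance
  refine ⟨h.injective, ⟨?_, fun Q hQ => ?_⟩, ?_⟩
  · obtain ⟨r, n, hS⟩ := 𝒢.toral
    exact ⟨r, n, hS.of_equiv (MonoidHom.ofInjective h.injective)⟩
  · obtain ⟨g, hg⟩ := h.exists_conj_of_isDiscretePToral ht hT 𝒢.saturated (fun i =>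
      𝒢.linking.exists_pow_mem (P := R.vertexObj i.1) 𝒢.saturated
        (R.controlling.fullyNormalised i.1 i.1.2)) hQ
    refine ⟨g⁻¹, fun x hx => ?_⟩
    rw [inv_inv]
    exact hg x hx
  · ext P Q f
    constructor
    · rintro ⟨g, hg⟩
      -- The value outside `P` is immaterial.
      let φ : S → S := Function.extend Subtype.val (fun x : P => (f x : S)) 1
      have hφ : ∀ x : P, φ x = f x := Subtype.val_injective.extend_apply _ _
      have hmor : 𝒢.F.Mor P φ := h.mor_of_conj ht hT (g := g) fun x hx => by
        rw [hφ ⟨x, hx⟩]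
        exact hg ⟨x, hx⟩
      exact hmor.mem_hom f hφ
    · intro hf
      obtain ⟨φ, hφ, hφf⟩ := FusionSystem.exists_mor_of_mem_hom hf
      obtain ⟨g, hg⟩ := hφ.induced hT 𝒢.saturated R.controlling (j := R.fromSylow)
        fun Q hQ φ ψ hφ => R.induced hQ hφ
      exact ⟨g, fun x => by rw [← hφf x, hg x x.2]⟩
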